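/- Let $\Sigma=\{0,\dots,s-1\}$ be an alphabet of constant size $s$. For a matrix $D$ over $\Sigma$ let $M_D$ be the cost of a minimum spanning tree of the rows of $D$, i.e. the minimum, over all trees $T$ spanning the set of row indices, of the sum over the edges $\{i,j\}$ of $T$ of the Hamming distance between the rows $D_{i*}$ and $D_{j*}$. Then the Hamming distance matrix product of a $p\times q$ matrix $A$ and a $q\times r$ matrix $B$ over $\Sigma$ (the Hamming distances between $A_{i*}$ and $B_{*j}$ for all $1\le i\le p$, $1\le j\le r$) can be computed by a randomized algorithm in time $\tilde O\big((p+r)(p+q+r)+\min\{rM_A,\;pM_{B^{\top}}\}\big)$ with high probability. Precisely: there is an absolute constant $k$ such that for all $s\in\mathbb N$ and all real $\alpha\ge 1$ there are a program for a random access machine with fair coin tosses, its time being measured by the logarithmic cost criterion (every step costs one plus the bit lengths of the numbers it handles), and a constant $C$ such that the following holds for all $p,q,r\ge 1$, every $A\in\Sigma^{p\times q}$ and every $B\in\Sigma^{q\times r}$. On input $p,q,r,A,B$ the program halts with the correct $p\times r$ matrix of Hamming distances for every outcome of the coin tosses, and, with $N=pq+qr$, with probability at least $1-N^{-\alpha}$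 it does so in time at most $$C\,\big((p+r)(p+q+r)+\min\{rM_A,\;pM_{B^{\top}}\}\big)\,(\log N)^k .$$ -/

import Mathlib

open MeasureTheory

/-! ## Hamming distances and minimum spanning trees -/

/-- The Hamming length of an edge of the complete graph on the rows of `P`. -/
def rowEdgeLength {n d s : ℕ} (P : Matrix (Fin n) (Fin d) (Fin s)) : Sym2 (Fin n) → ℕ :=
  Sym2.lift ⟨fun i j => hammingDist (P i) (P j), fun _ _ => hammingDist_comm _ _⟩

open Classical in
/-- The cost of a spanning tree `T` of the rows of `P`: the sum of the Hamming lengths of its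
edges. -/
noncomputable def treeCost {n d s : ℕ} (P : Matrix (Fin n) (Fin d) (Fin s))
    (T : SimpleGraph (Fin n)) : ℕ :=
  ∑ e ∈ T.edgeFinset, rowEdgeLength P e

/-- `mstCost P` is the cost of a minimum spanning tree of the rows of `P` in the (generalized)
Hamming space. -/
noncomputable def mstCost {n d s : ℕ} (P : Matrix (Fin n) (Fin d) (Fin s)) : ℕ :=
  sInf {c | ∃ T : SimpleGraph (Fin n), T.IsTree ∧ treeCost P T = c}

/-- The infimum in `mstCost` is a minimum: some spanning tree attains it. -/
theorem exists_isTree_treeCost_eq_mstCost {n d s : ℕ} (hn : 0 < n)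
    (P : Matrix (Fin n) (Fin d) (Fin s)) :
    ∃ T : SimpleGraph (Fin n), T.IsTree ∧ treeCost P T = mstCost P := by
  have : Nonempty (Fin n) := ⟨⟨0, hn⟩⟩
  obtain ⟨T, -, hT⟩ := (SimpleGraph.connected_top (V := Fin n)).exists_isTree_le
  exact Nat.sInf_mem (s := {c | ∃ T : SimpleGraph (Fin n), T.IsTree ∧ treeCost P T = c})
    ⟨_, T, hT, rfl⟩

/-! ## Randomized random access machines with logarithmic cost

Programs are structured programs over finitely many registers and an unbounded random access
memory, all cells of which hold natural numbers. Every elementary step is charged one unit plus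
the bit lengths of the numbers (operands, addresses, contents) that it handles, which is
the logarithmic cost criterion; in particular the cost is at least the number of steps. -/

namespace RandRAM

/-- The binary arithmetic operations (subtraction is truncated, and division by zero follows the
convention of `ℕ`). -/
inductive Op
  | add
  | sub
  | mul
  | div
  | mod

/-- The value of an operation. -/
def Op.eval : Op → ℕ → ℕ → ℕ
  | .add, x, y => x + y
  | .sub, x, y => x - y
  | .mul, x, y => x * y
  | .div, x, y => x / y
  | .mod, x, y => x % y

/-- Programs. Registers are named by natural numbers. -/
inductive Cmd
  /-- do nothing -/
  | skip
  /-- `reg d := n` -/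
  | const (d n : ℕ)
  /-- `reg d := reg a ⋄ reg b` -/
  | arith (o : Op) (d a b : ℕ)
  /-- `reg d := mem (reg a)` -/
  | load (d a : ℕ)
  /-- `mem (reg a) := reg b` -/
  | store (a b : ℕ)
  /-- `reg d :=` a fresh fair coin toss, `0` or `1` -/
  | flip (d : ℕ)
  /-- sequential composition -/
  | seq (c₁ c₂ : Cmd)
  /-- run `c₁` if `reg a ≠ 0`, and `c₂` otherwise -/
  | ite (a : ℕ) (c₁ c₂ : Cmd)
  /-- run `c` as long as `reg a ≠ 0` -/
  | loop (a : ℕ) (c : Cmd)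

/-- A configuration: registers, memory, and the number of coins tossed so far (which programs
cannot read). -/
@[ext]
structure State where
  reg : ℕ → ℕ
  mem : ℕ → ℕ
  coins : ℕ

/-- Write `v` into register `d`. -/
def State.setReg (S : State) (d v : ℕ) : State :=
  { S with reg := Function.update S.reg d v }

/-- Write `v` into memory cell `x`. -/
def State.setMem (S : State) (x v : ℕ) : State :=
  { S with mem := Function.update S.mem x v }

/-- `Exec ω c S S' t`: with the sequence of coin tosses `ω`, the program `c` started in `S` halts
in `S'` after time `t`. Here `Nat.size x` is the length of the binary expansion of `x`. -/
inductive Exec (ω : ℕ → Bool) : Cmd → State → State → ℕ → Prop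
  | skip (S : State) : Exec ω .skip S S 1
  | const (S : State) (d n : ℕ) :
      Exec ω (.const d n) S (S.setReg d n) (1 + n.size)
  | arith (S : State) (o : Op) (d a b : ℕ) :
      Exec ω (.arith o d a b) S (S.setReg d (o.eval (S.reg a) (S.reg b)))
        (1 + (S.reg a).size + (S.reg b).size)
  | load (S : State) (d a : ℕ) :
      Exec ω (.load d a) S (S.setReg d (S.mem (S.reg a)))
        (1 + (S.reg a).size + (S.mem (S.reg a)).size)
  | store (S : State) (a b : ℕ) :
      Exec ω (.store a b) S (S.setMem (S.reg a) (S.reg b))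
        (1 + (S.reg a).size + (S.reg b).size)
  | flip (S : State) (d : ℕ) :
      Exec ω (.flip d) S { S.setReg d (ω S.coins).toNat with coins := S.coins + 1 } 1
  | seq {S S' S'' : State} {c₁ c₂ : Cmd} {t₁ t₂ : ℕ} :
      Exec ω c₁ S S' t₁ → Exec ω c₂ S' S'' t₂ → Exec ω (.seq c₁ c₂) S S'' (t₁ + t₂)
  | ite_true {S S' : State} {a : ℕ} {c₁ c₂ : Cmd} {t : ℕ} : S.reg a ≠ 0 →
      Exec ω c₁ S S' t → Exec ω (.ite a c₁ c₂) S S' (1 + (S.reg a).size + t)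
  | ite_false {S S' : State} {a : ℕ} {c₁ c₂ : Cmd} {t : ℕ} : S.reg a = 0 →
      Exec ω c₂ S S' t → Exec ω (.ite a c₁ c₂) S S' (1 + t)
  | loop_true {S S' S'' : State} {a : ℕ} {c : Cmd} {t₁ t₂ : ℕ} : S.reg a ≠ 0 →
      Exec ω c S S' t₁ → Exec ω (.loop a c) S' S'' t₂ →
      Exec ω (.loop a c) S S'' (1 + (S.reg a).size + t₁ + t₂)
  | loop_false {S : State} {a : ℕ} {c : Cmd} : S.reg a = 0 →
      Exec ω (.loop a c) S S 1

/-- Runs are deterministic once the coin tosses are fixed. -/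
theorem Exec.unique {ω : ℕ → Bool} {c : Cmd} {S S₁ S₂ : State} {t₁ t₂ : ℕ}
    (h₁ : Exec ω c S S₁ t₁) (h₂ : Exec ω c S S₂ t₂) : S₁ = S₂ ∧ t₁ = t₂ := by
  induction h₁ generalizing S₂ t₂ with
  | skip | const | arith | load | store | flip => cases h₂; exact ⟨rfl, rfl⟩
  | seq _ _ ih₁ ih₂ =>
    cases h₂ with
    | seq k₁ k₂ =>
      obtain ⟨rfl, rfl⟩ := ih₁ k₁
      obtain ⟨rfl, rfl⟩ := ih₂ k₂
      exact ⟨rfl, rfl⟩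
  | ite_true h _ ih =>
    cases h₂ with
    | ite_true _ k => obtain ⟨rfl, rfl⟩ := ih k; exact ⟨rfl, rfl⟩
    | ite_false h' _ => exact absurd h' h
  | ite_false h _ ih =>
    cases h₂ with
    | ite_true h' _ => exact absurd h h'
    | ite_false _ k => obtain ⟨rfl, rfl⟩ := ih k; exact ⟨rfl, rfl⟩
  | loop_true h _ _ ih₁ ih₂ =>
    cases h₂ with
    | loop_true _ k₁ k₂ =>
      obtain ⟨rfl, rfl⟩ := ih₁ k₁
      obtain ⟨rfl, rfl⟩ := ih₂ k₂
      exact ⟨rfl, rfl⟩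
    | loop_false h' => exact absurd h' h
  | loop_false h =>
    cases h₂ with
    | loop_true h' _ _ => exact absurd h h'
    | loop_false _ => exact ⟨rfl, rfl⟩

/-- The law of an infinite sequence of independent fair coin tosses. -/
noncomputable def coinMeasure : Measure (ℕ → Bool) :=
  Measure.infinitePi fun _ => (PMF.uniformOfFintype Bool).toMeasure

instance : IsProbabilityMeasure coinMeasure := by
  unfold coinMeasure; infer_instance

/-- The initial configuration on input `A`, `B`: registers `0`, `1`, `2` hold the dimensions
`p`, `q`, `r`; the memory holds, from cell `0` on, the rows of `A` one after the other and then
the rows of `B`; everything else is `0`. -/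
def inputState {p q r s : ℕ} (A : Matrix (Fin p) (Fin q) (Fin s))
    (B : Matrix (Fin q) (Fin r) (Fin s)) : State where
  reg x := if x = 0 then p else if x = 1 then q else if x = 2 then r else 0
  mem x :=
    if h : x < p * q then
      let ij := finProdFinEquiv.symm (⟨x, h⟩ : Fin (p * q))
      (A ij.1 ij.2 : ℕ)
    else if h : x - p * q < q * r then
      let ij := finProdFinEquiv.symm (⟨x - p * q, h⟩ : Fin (q * r))
      (B ij.1 ij.2 : ℕ)
    else 0
  coins := 0

/-- The final configuration `S` holds the Hamming distances between the rows of `A` and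
the columns of `B`, in row-major order, in the memory cells directly after the input. -/
def OutputsHamming {p q r s : ℕ} (A : Matrix (Fin p) (Fin q) (Fin s))
    (B : Matrix (Fin q) (Fin r) (Fin s)) (S : State) : Prop :=
  ∀ (i : Fin p) (j : Fin r),
    S.mem (p * q + q * r + (i * r + j)) = hammingDist (fun l => A i l) (fun l => B l j)

theorem inputState_mem_left {p q r s : ℕ} (A : Matrix (Fin p) (Fin q) (Fin s))
    (B : Matrix (Fin q) (Fin r) (Fin s)) (i : Fin p) (l : Fin q) :
    (inputState A B).mem (i * q + l) = A i l := by
  have e : (i * q + l : ℕ) = (finProdFinEquiv (i, l) : Fin (p * q)) := by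
    simp [finProdFinEquiv]; ring
  have h : (i * q + l : ℕ) < p * q := e ▸ (finProdFinEquiv (i, l)).2
  have e' : (⟨i * q + l, h⟩ : Fin (p * q)) = finProdFinEquiv (i, l) := Fin.ext e
  simp only [inputState, dif_pos h, e', Equiv.symm_apply_apply]

theorem inputState_mem_right {p q r s : ℕ} (A : Matrix (Fin p) (Fin q) (Fin s))
    (B : Matrix (Fin q) (Fin r) (Fin s)) (l : Fin q) (j : Fin r) :
    (inputState A B).mem (p * q + (l * r + j)) = B l j := by
  have e : (l * r + j : ℕ) = (finProdFinEquiv (l, j) : Fin (q * r)) := by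
    simp [finProdFinEquiv]; ring
  have h : (l * r + j : ℕ) < q * r := e ▸ (finProdFinEquiv (l, j)).2
  have e' : (⟨l * r + j, h⟩ : Fin (q * r)) = finProdFinEquiv (l, j) := Fin.ext e
  have h0 : ¬ (p * q + (l * r + j : ℕ) < p * q) := by omega
  simp only [inputState, dif_neg h0, Nat.add_sub_cancel_left, dif_pos h, e',
    Equiv.symm_apply_apply]

end RandRAM

/-! Suppose the rows of `A` are arranged in a rooted tree in which every parent has a smaller index.
The first output row is computed directly. Each other output row starts as a copy of its parent's,
and every column in which the two rows of `A` differ is corrected in all `r` entries. This takes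
about `r` times the cost of the tree, and it is correct for every tree. The columns of `B` are
treated in the same way with time `p` times the cost, and the program uses the cheaper side.
Randomness is needed only to find a tree of cost `polylog * mstCost`.

The tree comes from random sampling of columns. Column `l` gets `lam` coins, where `2 ^ lam` is
about `N`, and it reaches level `t` if its first `t` coins are heads, which has probability `2⁻ᵗ`.
Let `R t` be the set of columns that reach level `t`. From the top level downwards, the rows are
partitioned by agreement on `R t`. A row that becomes the first of its class keeps its previous
parent; any other row takes the first of its class as parent. So whenever some earlier row agrees
with `v` on `R t`, the parent of `v` does too (`sweepStm_wp`).

The tree is cheap for two reasons. Rows at distance at least `L * 2 ^ t` agree on `R t` with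
probability at most `2⁻ᴸ` (`card_agreeOn_mul_le`). So, up to a small failure probability, a row that
is first at level `t` but not at `t + 1` has distance at most `L * 2 ^ (t + 1)` from its parent.
Also, the number of rows other than row `0` that are first at level `t` is at most the number of
edges of any spanning tree separated by `R t` (`card_first_occurrence_le`). An edge of length `d` is
separated with probability at most `d * 2⁻ᵗ`. Summing `2 ^ t` times these counts over the levels
gives expected weight at most `(lam + 1)` times the tree cost (`sum_separation_le`), and
`sum_rowDist_parent_le` turns this into a bound for the parent table.

By a union bound and Markov's inequality one trial is good with probability at least 1/2
(`card_not_goodLevels_le`). The cheapest of `⌈α⌉ * lam` independent trials is then good up to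
probability `N ^ (-α)` (`one_sub_le_coinMeasure_of_goodLevels`). Only the side that attains the
minimum has to succeed.

To run this on the machine, the algorithm is written in a small language of bounded loops with a
step counter. `Stm.sound` compiles it with a constant factor times the word length per step, and
weakest preconditions carry the correctness, the value bounds and the step counts. One logarithm in
the final bound is the word length. The two others come from trials times levels in the search for
the tree, and from `L * (lam + 1)` in the quality of the tree. -/

/-! ## A language of bounded loops over named arrays -/

namespace ForLang
open RandRAM

/-- Expressions over 32 variables, the low memory and a family of arrays. -/
inductive Ex
  | var (x : Fin 32)
  | lit (n : ℕ)
  | op (o : Op) (e₁ e₂ : Ex)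
  | raw (e : Ex)
  | arr (k e : Ex)

/-- A configuration; the clock `clk` counts the executed statements. -/
structure St where
  v : Fin 32 → ℕ
  lo : ℕ → ℕ
  a : ℕ → ℕ → ℕ
  coins : ℕ
  clk : ℕ

/-- The value of an expression. -/
def Ex.eval (σ : St) : Ex → ℕ
  | .var x => σ.v x
  | .lit n => n
  | .op o e₁ e₂ => o.eval (e₁.eval σ) (e₂.eval σ)
  | .raw e => σ.lo (e.eval σ)
  | .arr k e => σ.a (k.eval σ) (e.eval σ)

/-- All low addresses are below `b` and all array names below `M`. -/
def Ex.ok (b M : ℕ) (σ : St) : Ex → Prop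
  | .var _ => True
  | .lit _ => True
  | .op _ e₁ e₂ => e₁.ok b M σ ∧ e₂.ok b M σ
  | .raw e => e.ok b M σ ∧ e.eval σ < b
  | .arr k e => k.ok b M σ ∧ e.ok b M σ ∧ k.eval σ < M

/-- A bound for the bit length of the value of an expression, in units of the word length. -/
def Ex.nodes : Ex → ℕ
  | .var _ => 1
  | .lit n => n
  | .op _ e₁ e₂ => e₁.nodes + e₂.nodes + 1
  | .raw _ => 1
  | .arr _ _ => 1

/-- A bound for the time of evaluating an expression, in units of the word length. -/
def Ex.weight (M : ℕ) : Ex → ℕ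
  | .var _ => 2
  | .lit n => 1 + n
  | .op _ e₁ e₂ => e₁.weight M + e₂.weight M + e₁.nodes + e₂.nodes + 1
  | .raw e => e.weight M + e.nodes + 2
  | .arr k e => k.weight M + e.weight M + 3 * k.nodes + 4 * e.nodes + 5 * M + 12

/-- Code that evaluates an expression into register `d`, using only registers from `d` on. -/
def Ex.code (M : ℕ) : Ex → ℕ → Cmd
  -- The machine has no move instruction; adding to a zeroed register copies the variable.
  | .var x, d => .seq (.const d 0) (.arith .add d d x)
  | .lit n, d => .const d n
  | .op o e₁ e₂, d => .seq (e₁.code M d) (.seq (e₂.code M (d + 1)) (.arith o d d (d + 1)))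
  | .raw e, d => .seq (e.code M d) (.load d d)
  -- The address is `k + e * M + b`; the base `b` sits permanently in register `32`, just above the
  -- variables, and scratch registers start at `33`.
  | .arr k e, d => .seq (k.code M d) (.seq (e.code M (d + 1)) (.seq (.const (d + 2) M)
      (.seq (.arith .mul (d + 1) (d + 1) (d + 2)) (.seq (.arith .add d d (d + 1))
        (.seq (.arith .add d d 32) (.load d d))))))

/-- Statements. -/
inductive Stm
  | skip
  | assign (x : Fin 32) (e : Ex)
  | put (k i e : Ex)
  | putRaw (i e : Ex)
  | flip (x : Fin 32)
  | seq (c₁ c₂ : Stm)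
  | ite (e : Ex) (c₁ c₂ : Stm)
  | loop (x : Fin 32) (e : Ex) (c : Stm)

/-- Advance the clock. -/
def St.tick (σ : St) : St := { σ with clk := σ.clk + 1 }
/-- Write a variable. -/
def St.set (σ : St) (x : Fin 32) (n : ℕ) : St := { σ with v := Function.update σ.v x n }
/-- Write an array entry. -/
def St.put (σ : St) (k i n : ℕ) : St :=
  { σ with a := Function.update σ.a k (Function.update (σ.a k) i n) }
/-- Write a low memory cell. -/
def St.putRaw (σ : St) (i n : ℕ) : St := { σ with lo := Function.update σ.lo i n }

@[simp] theorem St.tick_v (σ : St) : σ.tick.v = σ.v := rfl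
@[simp] theorem St.tick_lo (σ : St) : σ.tick.lo = σ.lo := rfl
@[simp] theorem St.tick_a (σ : St) : σ.tick.a = σ.a := rfl
@[simp] theorem St.tick_coins (σ : St) : σ.tick.coins = σ.coins := rfl
@[simp] theorem St.tick_clk (σ : St) : σ.tick.clk = σ.clk + 1 := rfl
@[simp] theorem St.set_v (σ : St) (x n) : (σ.set x n).v = Function.update σ.v x n := rfl
@[simp] theorem St.set_lo (σ : St) (x n) : (σ.set x n).lo = σ.lo := rfl
@[simp] theorem St.set_a (σ : St) (x n) : (σ.set x n).a = σ.a := rfl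
@[simp] theorem St.set_coins (σ : St) (x n) : (σ.set x n).coins = σ.coins := rfl
@[simp] theorem St.set_clk (σ : St) (x n) : (σ.set x n).clk = σ.clk := rfl
@[simp] theorem St.put_v (σ : St) (k i n) : (σ.put k i n).v = σ.v := rfl
@[simp] theorem St.put_lo (σ : St) (k i n) : (σ.put k i n).lo = σ.lo := rfl
@[simp] theorem St.put_a (σ : St) (k i n) :
    (σ.put k i n).a = Function.update σ.a k (Function.update (σ.a k) i n) := rfl
@[simp] theorem St.put_coins (σ : St) (k i n) : (σ.put k i n).coins = σ.coins := rfl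
@[simp] theorem St.put_clk (σ : St) (k i n) : (σ.put k i n).clk = σ.clk := rfl
@[simp] theorem St.putRaw_v (σ : St) (i n) : (σ.putRaw i n).v = σ.v := rfl
@[simp] theorem St.putRaw_lo (σ : St) (i n) : (σ.putRaw i n).lo = Function.update σ.lo i n := rfl
@[simp] theorem St.putRaw_a (σ : St) (i n) : (σ.putRaw i n).a = σ.a := rfl
@[simp] theorem St.putRaw_coins (σ : St) (i n) : (σ.putRaw i n).coins = σ.coins := rfl
@[simp] theorem St.putRaw_clk (σ : St) (i n) : (σ.putRaw i n).clk = σ.clk := rfl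

/-! ### Weakest preconditions with a step counter and bounded values -/

/-- All stored numbers are at most `B`. -/
structure St.Bdd (B : ℕ) (σ : St) : Prop where
  v : ∀ x, σ.v x ≤ B
  lo : ∀ i, σ.lo i ≤ B
  a : ∀ k i, σ.a k i ≤ B

/-- The weakest precondition of a loop with `n` further rounds, the next one with index `i`, given
that of its body. -/
def loopWp (W : (St → Prop) → St → Prop) (x : Fin 32) : ℕ → ℕ → (St → Prop) → St → Prop
  | 0, _, Q, σ => Q σ
  | n + 1, i, Q, σ => W (fun σ' => loopWp W x n (i + 1) Q σ') (σ.set x i).tick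

/-- Weakest preconditions, for total correctness and for numbers bounded by `B`. -/
def Stm.wp (ω : ℕ → Bool) (b M B : ℕ) : Stm → (St → Prop) → St → Prop
  | .skip, Q, σ => Q σ.tick
  -- The value bound may assume `Bdd`, so that values merely read from the store cost no proof.
  -- Boundedness itself is threaded through by the soundness proof and need not appear in
  -- invariants.
  | .assign x e, Q, σ => e.ok b M σ ∧ (σ.Bdd B → e.eval σ ≤ B) ∧ Q (σ.set x (e.eval σ)).tick
  | .put k i e, Q, σ => k.ok b M σ ∧ i.ok b M σ ∧ e.ok b M σ ∧ k.eval σ < M ∧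
      (σ.Bdd B → e.eval σ ≤ B) ∧ Q (σ.put (k.eval σ) (i.eval σ) (e.eval σ)).tick
  | .putRaw i e, Q, σ => i.ok b M σ ∧ e.ok b M σ ∧ i.eval σ < b ∧
      (σ.Bdd B → e.eval σ ≤ B) ∧ Q (σ.putRaw (i.eval σ) (e.eval σ)).tick
  | .flip x, Q, σ => Q { (σ.set x (ω σ.coins).toNat).tick with coins := σ.coins + 1 }
  | .seq c₁ c₂, Q, σ => c₁.wp ω b M B (fun σ' => c₂.wp ω b M B Q σ') σ
  | .ite e c₁ c₂, Q, σ => e.ok b M σ ∧ (e.eval σ ≠ 0 → c₁.wp ω b M B Q σ.tick) ∧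
      (e.eval σ = 0 → c₂.wp ω b M B Q σ.tick)
  | .loop x e c, Q, σ => e.ok b M σ ∧ (σ.Bdd B → e.eval σ ≤ B) ∧
      loopWp (c.wp ω b M B) x (e.eval σ) 0 Q σ.tick

theorem loopWp_mono {W : (St → Prop) → St → Prop} {x : Fin 32}
    (hW : ∀ Q Q' : St → Prop, (∀ σ, Q σ → Q' σ) → ∀ σ, W Q σ → W Q' σ) (n : ℕ) :
    ∀ (i : ℕ) (Q Q' : St → Prop), (∀ σ, Q σ → Q' σ) → ∀ σ, loopWp W x n i Q σ →
      loopWp W x n i Q' σ := by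
  induction n with
  | zero => intro i Q Q' h σ hσ; exact h σ hσ
  | succ n ih => intro i Q Q' h σ hσ; exact hW _ _ (fun τ => ih (i + 1) Q Q' h τ) _ hσ

theorem Stm.wp_mono {ω : ℕ → Bool} {b M B : ℕ} (c : Stm) : ∀ {Q Q' : St → Prop},
    (∀ σ, Q σ → Q' σ) → ∀ {σ}, c.wp ω b M B Q σ → c.wp ω b M B Q' σ := by
  induction c with
  | skip => intro Q Q' h σ hσ; exact h _ hσ
  | assign | put | putRaw | flip =>
    intro Q Q' h σ hσ
    simp only [Stm.wp] at hσ ⊢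
    first
      | exact h _ hσ
      | exact ⟨hσ.1, hσ.2.1, h _ hσ.2.2⟩
      | exact ⟨hσ.1, hσ.2.1, hσ.2.2.1, hσ.2.2.2.1, h _ hσ.2.2.2.2⟩
      | exact ⟨hσ.1, hσ.2.1, hσ.2.2.1, hσ.2.2.2.1, hσ.2.2.2.2.1, h _ hσ.2.2.2.2.2⟩
  | seq c₁ c₂ ih₁ ih₂ => intro Q Q' h σ hσ; exact ih₁ (fun τ => ih₂ h) hσ
  | ite e c₁ c₂ ih₁ ih₂ =>
    intro Q Q' h σ hσ
    exact ⟨hσ.1, fun h0 => ih₁ h (hσ.2.1 h0), fun h0 => ih₂ h (hσ.2.2 h0)⟩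
  | loop x e c ih =>
    intro Q Q' h σ hσ
    exact ⟨hσ.1, hσ.2.1, loopWp_mono (W := c.wp ω b M B) (fun Q Q' h σ => ih h) _ _ _ _ h _ hσ.2.2⟩

theorem loopWp_of_inv {W : (St → Prop) → St → Prop} {x : Fin 32}
    (hW : ∀ Q Q' : St → Prop, (∀ σ, Q σ → Q' σ) → ∀ σ, W Q σ → W Q' σ) {N : ℕ}
    (I : ℕ → St → Prop) (step : ∀ i < N, ∀ τ, I i τ → W (I (i + 1)) (τ.set x i).tick) (n : ℕ) :
    ∀ (i : ℕ) (σ : St), i + n = N → I i σ → loopWp W x n i (I N) σ := by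
  induction n with
  | zero => intro i σ h hI; obtain rfl : i = N := by omega
            exact hI
  | succ n ih =>
    intro i σ h hI
    exact hW _ _ (fun τ hτ => ih (i + 1) τ (by omega) hτ) _ (step i (by omega) σ hI)

/-- The invariant rule for loops. -/
theorem Stm.wp_loop {ω : ℕ → Bool} {b M B : ℕ} {x : Fin 32} {e : Ex} {c : Stm} {Q : St → Prop}
    {σ : St} (I : ℕ → St → Prop) (n : ℕ) (hn : e.eval σ = n) (hok : e.ok b M σ)
    (hB : σ.Bdd B → n ≤ B) (h0 : I 0 σ.tick)
    (step : ∀ i < n, ∀ τ, I i τ → c.wp ω b M B (I (i + 1)) (τ.set x i).tick)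
    (hQ : ∀ τ, I n τ → Q τ) : (Stm.loop x e c).wp ω b M B Q σ := by
  subst hn
  have hW : ∀ Q Q' : St → Prop, (∀ σ, Q σ → Q' σ) → ∀ σ, c.wp ω b M B Q σ → c.wp ω b M B Q' σ :=
    fun Q Q' h σ => c.wp_mono h
  exact ⟨hok, hB, loopWp_mono hW _ _ _ _ hQ _
    (loopWp_of_inv hW I step _ 0 _ (Nat.zero_add _) h0)⟩

/-! ### Compilation -/

/-- The machine configuration `S` implements `σ`, with the low memory below `b` and array `k` in
the cells `b + M * i + k`. -/
structure Rel (b M : ℕ) (S : State) (σ : St) : Prop where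
  v : ∀ x : Fin 32, S.reg x = σ.v x
  base : S.reg 32 = b
  lo : ∀ x < b, S.mem x = σ.lo x
  a : ∀ k < M, ∀ i, S.mem (b + M * i + k) = σ.a k i
  coins : S.coins = σ.coins

@[simp] theorem setReg_reg (S : State) (d n : ℕ) :
    (S.setReg d n).reg = Function.update S.reg d n := rfl
@[simp] theorem setReg_mem (S : State) (d n : ℕ) : (S.setReg d n).mem = S.mem := rfl
@[simp] theorem setReg_coins (S : State) (d n : ℕ) : (S.setReg d n).coins = S.coins := rfl
@[simp] theorem setMem_reg (S : State) (d n : ℕ) : (S.setMem d n).reg = S.reg := rfl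
@[simp] theorem setMem_mem (S : State) (d n : ℕ) :
    (S.setMem d n).mem = Function.update S.mem d n := rfl
@[simp] theorem setMem_coins (S : State) (d n : ℕ) : (S.setMem d n).coins = S.coins := rfl

/-- Registers from `d` on are irrelevant. -/
structure Same (d : ℕ) (S S' : State) : Prop where
  reg : ∀ x < d, S'.reg x = S.reg x
  mem : S'.mem = S.mem
  coins : S'.coins = S.coins

theorem Same.trans {d : ℕ} {S S' S'' : State} (h : Same d S S') (h' : Same d S' S'') :
    Same d S S'' :=
  ⟨fun x hx => (h'.reg x hx).trans (h.reg x hx), h'.mem.trans h.mem, h'.coins.trans h.coins⟩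

theorem Same.mono {d d' : ℕ} {S S' : State} (h : Same d' S S') (hd : d ≤ d') : Same d S S' :=
  ⟨fun x hx => h.reg x (hx.trans_le hd), h.mem, h.coins⟩

theorem Same.setReg {d d' n : ℕ} (S : State) (hd : d ≤ d') : Same d S (S.setReg d' n) :=
  ⟨fun x hx => by simp [Function.update_of_ne (show x ≠ d' by omega)], rfl, rfl⟩

theorem Rel.same {b M d : ℕ} {S S' : State} {σ : St} (h : Rel b M S σ) (hs : Same d S S')
    (hd : 33 ≤ d) : Rel b M S' σ :=
  ⟨fun x => (hs.reg x (by omega)).trans (h.v x), (hs.reg 32 (by omega)).trans h.base,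
    fun x hx => by rw [hs.mem, h.lo x hx], fun k hk i => by rw [hs.mem, h.a k hk i],
    hs.coins.trans h.coins⟩

theorem Rel.tick {b M : ℕ} {S : State} {σ : St} (h : Rel b M S σ) : Rel b M S σ.tick :=
  ⟨h.v, h.base, h.lo, h.a, h.coins⟩

/-! ### Bit lengths and evaluation of expressions -/

theorem size_le_self (n : ℕ) : n.size ≤ n := Nat.size_le.2 n.lt_two_pow_self

theorem size_add_le (m n : ℕ) : (m + n).size ≤ m.size + n.size + 1 := by
  refine Nat.size_le.2 ?_
  have h1 := m.lt_size_self
  have h2 := n.lt_size_self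
  have h3 : 2 ^ m.size ≤ 2 ^ (m.size + n.size) := Nat.pow_le_pow_right (by norm_num) (by omega)
  have h4 : 2 ^ n.size ≤ 2 ^ (m.size + n.size) := Nat.pow_le_pow_right (by norm_num) (by omega)
  rw [pow_succ]; omega

theorem size_mul_le (m n : ℕ) : (m * n).size ≤ m.size + n.size := by
  refine Nat.size_le.2 ?_
  rw [pow_add]
  exact Nat.mul_lt_mul'' m.lt_size_self n.lt_size_self

theorem size_op_le (o : Op) (m n : ℕ) : (o.eval m n).size ≤ m.size + n.size + 1 := by
  cases o with
  | add => exact size_add_le m n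
  | sub => have := Nat.size_le_size (Nat.sub_le m n); simp only [Op.eval]; omega
  | mul => have := size_mul_le m n; simp only [Op.eval]; omega
  | div => have := Nat.size_le_size (Nat.div_le_self m n); simp only [Op.eval]; omega
  | mod => have := Nat.size_le_size (Nat.mod_le m n); simp only [Op.eval]; omega

/-- An operation yields at most one bit more than its operands have together, and everything read
from the store has at most `B.size` bits. Intermediate results may therefore exceed `B`; only stored
values must not. -/
theorem Ex.size_eval_le {B : ℕ} {σ : St} (hσ : σ.Bdd B) (e : Ex) :
    (e.eval σ).size ≤ e.nodes * (B.size + 1) := by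
  induction e with
  | var x => have := Nat.size_le_size (hσ.v x); simp only [eval, nodes]; omega
  | lit n => have := size_le_self n; simp only [eval, nodes]; nlinarith
  | op o e₁ e₂ h₁ h₂ =>
    have := size_op_le o (e₁.eval σ) (e₂.eval σ)
    simp only [eval, nodes, add_mul, one_mul]; omega
  | raw e _ => have := Nat.size_le_size (hσ.lo (e.eval σ)); simp only [eval, nodes]; omega
  | arr k e _ _ =>
    have := Nat.size_le_size (hσ.a (k.eval σ) (e.eval σ)); simp only [eval, nodes]; omega

/-- The second operand is evaluated from register `d + 1` on, so the first one survives in register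
`d`. The bound `b ≤ B` pays for handling the base address. -/
theorem Ex.code_exec {ω : ℕ → Bool} {b M B : ℕ} (hb : b ≤ B) {σ : St} (hσ : σ.Bdd B) (e : Ex) :
    ∀ {S : State} {d : ℕ}, Rel b M S σ → e.ok b M σ → 33 ≤ d →
      ∃ S' t, Exec ω (e.code M d) S S' t ∧ S'.reg d = e.eval σ ∧ Same d S S' ∧
        t ≤ e.weight M * (B.size + 1) := by
  induction e with
  | var x =>
    intro S d hS _ hd
    refine ⟨_, _, .seq (.const _ _ _) (.arith _ _ _ _ _), ?_, (Same.setReg _ le_rfl).trans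
      (Same.setReg _ le_rfl), ?_⟩
    · simp [Op.eval, eval, ← hS.v x, Function.update_of_ne (show (x : ℕ) ≠ d by omega)]
    · have := Nat.size_le_size (hσ.v x)
      simp [weight, Function.update_of_ne (show (x : ℕ) ≠ d by omega), hS.v x]
      omega
  | lit n =>
    intro S d hS _ hd
    refine ⟨_, _, .const _ _ _, ?_, Same.setReg _ le_rfl, ?_⟩
    · simp [eval]
    · have := size_le_self n
      simp only [weight]; nlinarith
  | op o e₁ e₂ h₁ h₂ =>
    intro S d hS hok hd
    obtain ⟨S₁, t₁, x₁, r₁, s₁, b₁⟩ := h₁ hS hok.1 hd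
    obtain ⟨S₂, t₂, x₂, r₂, s₂, b₂⟩ := h₂ (hS.same s₁ hd) hok.2 (d := d + 1) (by omega)
    refine ⟨_, _, .seq x₁ (.seq x₂ (.arith _ _ _ _ _)), ?_,
      (s₁.trans (s₂.mono (by omega))).trans (Same.setReg _ le_rfl), ?_⟩
    · simp [eval, r₂, s₂.reg d (by omega), r₁]
    · rw [r₂, s₂.reg d (by omega), r₁]
      have := e₁.size_eval_le hσ
      have := e₂.size_eval_le hσ
      simp only [weight, add_mul]; omega
  | raw e h =>
    intro S d hS hok hd
    obtain ⟨S₁, t₁, x₁, r₁, s₁, b₁⟩ := h hS hok.1 hd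
    have hl : S₁.mem (S₁.reg d) = σ.lo (e.eval σ) := by rw [r₁, s₁.mem, hS.lo _ hok.2]
    refine ⟨_, _, .seq x₁ (.load _ _ _), ?_, s₁.trans (Same.setReg _ le_rfl), ?_⟩
    · simp [eval, hl]
    · have := e.size_eval_le hσ
      have := Nat.size_le_size (hσ.lo (e.eval σ))
      rw [hl, r₁]
      simp only [weight, add_mul]; omega
  | arr k e h₁ h₂ =>
    intro S d hS hok hd
    obtain ⟨S₁, t₁, x₁, r₁, s₁, b₁⟩ := h₁ hS hok.1 hd
    obtain ⟨S₂, t₂, x₂, r₂, s₂, b₂⟩ := h₂ (hS.same s₁ hd) hok.2.1 (d := d + 1) (by omega)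
    have e1 : S₂.reg d = k.eval σ := by rw [s₂.reg d (by omega), r₁]
    have e2 : S₂.reg 32 = b := by rw [s₂.reg 32 (by omega), s₁.reg 32 (by omega), hS.base]
    have e3 : S₂.mem (k.eval σ + e.eval σ * M + b) = σ.a (k.eval σ) (e.eval σ) := by
      rw [s₂.mem, s₁.mem, ← hS.a _ hok.2.2]; congr 1; ring
    refine ⟨_, _, .seq x₁ (.seq x₂ (.seq (.const _ _ _) (.seq (.arith _ _ _ _ _)
      (.seq (.arith _ _ _ _ _) (.seq (.arith _ _ _ _ _) (.load _ _ _)))))), ?_,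
      (s₁.trans (s₂.mono (by omega))).trans ((Same.setReg _ (by omega)).trans
        ((Same.setReg _ (by omega)).trans ((Same.setReg _ le_rfl).trans
        ((Same.setReg _ le_rfl).trans (Same.setReg _ le_rfl))))), ?_⟩
    · simp [eval, Op.eval, show 32 ≠ d by omega, show 32 ≠ d + 1 by omega,
        show 32 ≠ d + 2 by omega, e1, e2, r₂, e3]
    · simp [Op.eval, show 32 ≠ d by omega, show 32 ≠ d + 1 by omega,
        show 32 ≠ d + 2 by omega, e1, e2, r₂, e3]
      have z1 := k.size_eval_le hσ
      have z2 := e.size_eval_le hσ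
      have z3 := Nat.size_le_size (hσ.a (k.eval σ) (e.eval σ))
      have z4 := Nat.size_le_size hb
      have z5 := size_le_self M
      have z6 := size_mul_le (e.eval σ) M
      have z7 := size_add_le (k.eval σ) (e.eval σ * M)
      have z8 := size_add_le (k.eval σ + e.eval σ * M) b
      have z9 : M ≤ M * (B.size + 1) := Nat.le_mul_of_pos_right _ (by omega)
      simp only [weight, add_mul, mul_assoc]; omega

/-- A bound for the time per tick of the clock, in units of the word length. -/
def Stm.weight (M : ℕ) : Stm → ℕ
  | .skip => 1
  | .assign _ e => e.weight M + e.nodes + 4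
  | .put k i e => k.weight M + i.weight M + e.weight M + 3 * k.nodes + 4 * i.nodes + e.nodes +
      5 * M + 12
  | .putRaw i e => i.weight M + e.weight M + i.nodes + e.nodes + 1
  | .flip _ => 1
  | .seq c₁ c₂ => c₁.weight M + c₂.weight M
  | .ite e c₁ c₂ => e.weight M + e.nodes + 1 + c₁.weight M + c₂.weight M
  | .loop _ e c => e.weight M + 20 + c.weight M

/-- Code for a statement, using the registers from `d` on as scratch registers. -/
def Stm.code (M : ℕ) : Stm → ℕ → Cmd
  | .skip, _ => .skip
  | .assign x e, d => .seq (e.code M d) (.seq (.const (d + 1) 0) (.arith .add x d (d + 1)))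
  | .put k i e, d => .seq (k.code M d) (.seq (i.code M (d + 1)) (.seq (e.code M (d + 2))
      (.seq (.const (d + 3) M) (.seq (.arith .mul (d + 1) (d + 1) (d + 3))
        (.seq (.arith .add d d (d + 1)) (.seq (.arith .add d d 32) (.store d (d + 2))))))))
  | .putRaw i e, d => .seq (i.code M d) (.seq (e.code M (d + 1)) (.store d (d + 1)))
  | .flip x, _ => .flip x
  | .seq c₁ c₂, d => .seq (c₁.code M d) (c₂.code M d)
  | .ite e c₁ c₂, d => .seq (e.code M d) (.ite d (c₁.code M d) (c₂.code M d))
  -- Register `d` counts the remaining rounds, `d + 1` holds the index and `d + 2` holds constants.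
  -- The body gets its scratch registers from `d + 3` on and so cannot disturb the control.
  | .loop x e c, d => .seq (e.code M d) (.seq (.const (d + 1) 0)
      (.loop d (.seq (.const (d + 2) 0) (.seq (.arith .add x (d + 1) (d + 2))
        (.seq (c.code M (d + 3)) (.seq (.const (d + 2) 1) (.seq (.arith .sub d d (d + 2))
          (.arith .add (d + 1) (d + 1) (d + 2)))))))))

/-- What the soundness of the compilation says about a statement. -/
def Sound (ω : ℕ → Bool) (b M B : ℕ) (c : Cmd) (w d : ℕ) (Q : St → Prop) (σ : St) (S : State) :
    Prop :=
  ∃ S' σ' t, Exec ω c S S' t ∧ Rel b M S' σ' ∧ σ'.Bdd B ∧ Q σ' ∧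
    (∀ x, 32 ≤ x → x < d → S'.reg x = S.reg x) ∧
    ∃ δ, σ'.clk = σ.clk + δ ∧ t ≤ w * (B.size + 1) * δ

theorem Rel.set {b M : ℕ} {S : State} {σ : St} (h : Rel b M S σ) (x : Fin 32) (n : ℕ) :
    Rel b M (S.setReg x n) (σ.set x n) := by
  refine ⟨fun y => ?_, ?_, h.lo, h.a, h.coins⟩
  · by_cases hy : y = x
    · subst hy; simp
    · simp [Function.update_of_ne hy, Function.update_of_ne (Fin.val_ne_of_ne hy), h.v]
  · simp [Function.update_of_ne (show 32 ≠ (x : ℕ) by omega), h.base]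

theorem St.Bdd.set {B : ℕ} {σ : St} (h : σ.Bdd B) (x : Fin 32) {n : ℕ} (hn : n ≤ B) :
    (σ.set x n).Bdd B := by
  refine ⟨fun y => ?_, h.lo, h.a⟩
  by_cases hy : y = x
  · subst hy; simpa
  · simp [Function.update_of_ne hy, h.v]

theorem St.Bdd.tick {B : ℕ} {σ : St} (h : σ.Bdd B) : σ.tick.Bdd B := ⟨h.v, h.lo, h.a⟩

theorem St.Bdd.put {B : ℕ} {σ : St} (h : σ.Bdd B) (k i : ℕ) {n : ℕ} (hn : n ≤ B) :
    (σ.put k i n).Bdd B := by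
  refine ⟨h.v, h.lo, fun k' i' => ?_⟩
  simp only [St.put_a, Function.update_apply]
  split_ifs with h1
  · by_cases hi : i' = i
    · simpa [hi]
    · simpa [Function.update_of_ne hi] using h.a _ _
  · exact h.a _ _

theorem St.Bdd.putRaw {B : ℕ} {σ : St} (h : σ.Bdd B) (i : ℕ) {n : ℕ} (hn : n ≤ B) :
    (σ.putRaw i n).Bdd B := by
  refine ⟨h.v, fun j => ?_, h.a⟩
  simp only [St.putRaw_lo, Function.update_apply]
  split_ifs
  · exact hn
  · exact h.lo _

theorem Rel.putRaw {b M : ℕ} {S : State} {σ : St} (h : Rel b M S σ) {i : ℕ} (hi : i < b) (n : ℕ) :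
    Rel b M (S.setMem i n) (σ.putRaw i n) := by
  refine ⟨h.v, h.base, fun x hx => ?_, fun k hk j => ?_, h.coins⟩
  · simp only [setMem_mem, St.putRaw_lo, Function.update_apply, h.lo x hx]
  · rw [setMem_mem, Function.update_of_ne (by omega)]; exact h.a k hk j

theorem Rel.put {b M : ℕ} {S : State} {σ : St} (h : Rel b M S σ) {k : ℕ} (hk : k < M) (i n : ℕ) :
    Rel b M (S.setMem (b + M * i + k) n) (σ.put k i n) := by
  refine ⟨h.v, h.base, fun x hx => ?_, fun k' hk' j => ?_, h.coins⟩
  · rw [setMem_mem, Function.update_of_ne (by omega)]; exact h.lo x hx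
  · simp only [setMem_mem, St.put_a]
    by_cases hkk : k' = k
    · subst hkk
      by_cases hj : j = i
      · subst hj; simp
      · have : M * j ≠ M * i := fun e => hj (Nat.eq_of_mul_eq_mul_left (by omega) e)
        rw [Function.update_of_ne (by omega), Function.update_self, Function.update_of_ne hj]
        exact h.a _ hk' j
    · rw [Function.update_of_ne (a := k') hkk, Function.update_of_ne, h.a _ hk' j]
      intro e
      -- Array names are below `M`, so the remainder modulo `M` recovers the name from the address.
      have h1 : (M * j + k') % M = (M * i + k) % M := by congr 1; omega
      rw [Nat.mul_add_mod, Nat.mul_add_mod, Nat.mod_eq_of_lt hk', Nat.mod_eq_of_lt hk] at h1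
      exact hkk h1

/-- Induction on the remaining rounds. Counter and index are preserved by the body and have sum at
most `B`, so they fit into a word. The summand 16 covers the bookkeeping of a round, charged to the
tick at its beginning; the leading 1 is the final test. -/
theorem loop_sound {ω : ℕ → Bool} {b M B : ℕ} {x : Fin 32} {c : Cmd} {w d : ℕ} (hd : 33 ≤ d)
    {W : (St → Prop) → St → Prop}
    (hW : ∀ Q σ S, Rel b M S σ → σ.Bdd B → W Q σ → Sound ω b M B c w (d + 3) Q σ S)
    (n : ℕ) : ∀ (i : ℕ) (Q : St → Prop) (σ : St) (S : State), Rel b M S σ → σ.Bdd B → n + i ≤ B →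
      S.reg d = n → S.reg (d + 1) = i → loopWp W x n i Q σ →
      ∃ S' σ' t, Exec ω (.loop d (.seq (.const (d + 2) 0) (.seq (.arith .add x (d + 1) (d + 2))
          (.seq c (.seq (.const (d + 2) 1) (.seq (.arith .sub d d (d + 2))
          (.arith .add (d + 1) (d + 1) (d + 2)))))))) S S' t ∧ Rel b M S' σ' ∧ σ'.Bdd B ∧ Q σ' ∧
        (∀ x, 32 ≤ x → x < d → S'.reg x = S.reg x) ∧
        ∃ δ, σ'.clk = σ.clk + δ ∧ t ≤ 1 + (w + 16) * (B.size + 1) * δ := by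
  induction n with
  | zero =>
    intro i Q σ S hS hσ _ h0 _ h
    exact ⟨S, σ, 1, .loop_false h0, hS, hσ, h, fun _ _ _ => rfl, 0, rfl, by omega⟩
  | succ n ih =>
    intro i Q σ S hS hσ hB h0 h1 h
    have hx : (x : ℕ) < 32 := x.2
    set S₁ := (S.setReg (d + 2) 0).setReg x i with hS₁
    have r₁ : Rel b M S₁ (σ.set x i).tick :=
      ((hS.same (Same.setReg _ (d := d) (by omega)) hd).set x i).tick
    obtain ⟨S₂, τ, t₂, e₂, r₂, b₂, q₂, f₂, δ, c₂, l₂⟩ :=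
      hW _ _ _ r₁ (hσ.set x (by omega)).tick h
    have g0 : S₂.reg d = n + 1 := by
      rw [f₂ d (by omega) (by omega)]
      simp [hS₁, Function.update_of_ne (show d ≠ (x : ℕ) by omega), h0]
    have g1 : S₂.reg (d + 1) = i := by
      rw [f₂ _ (by omega) (by omega)]
      simp [hS₁, Function.update_of_ne (show d + 1 ≠ (x : ℕ) by omega), h1]
    set S₃ := ((S₂.setReg (d + 2) 1).setReg d n).setReg (d + 1) (i + 1) with hS₃
    have s₃ : Same d S₂ S₃ := (Same.setReg _ (by omega)).trans
      ((Same.setReg _ le_rfl).trans (Same.setReg _ (by omega)))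
    obtain ⟨S₄, σ', t₄, e₄, r₄, b₄, q₄, f₄, δ', c₄, l₄⟩ :=
      ih (i + 1) Q τ S₃ (r₂.same s₃ hd) b₂ (by omega) (by simp [hS₃]) (by simp [hS₃]) q₂
    have a1 : Exec ω (.arith .add x (d + 1) (d + 2)) (S.setReg (d + 2) 0) S₁ (1 + i.size + 0) := by
      have := Exec.arith (ω := ω) (S.setReg (d + 2) 0) .add x (d + 1) (d + 2)
      simpa [Op.eval, h1] using this
    have a2 : Exec ω (.arith .sub d d (d + 2)) (S₂.setReg (d + 2) 1)
        ((S₂.setReg (d + 2) 1).setReg d n) (1 + (n + 1).size + 1) := by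
      have := Exec.arith (ω := ω) (S₂.setReg (d + 2) 1) .sub d d (d + 2)
      simpa [Op.eval, g0] using this
    have a3 : Exec ω (.arith .add (d + 1) (d + 1) (d + 2)) ((S₂.setReg (d + 2) 1).setReg d n)
        S₃ (1 + i.size + 1) := by
      have := Exec.arith (ω := ω) ((S₂.setReg (d + 2) 1).setReg d n) .add (d + 1) (d + 1) (d + 2)
      simpa [Op.eval, g1, Function.update_of_ne (show d + 2 ≠ d by omega)] using this
    refine ⟨S₄, σ', _, .loop_true (by omega) (.seq (.const _ _ _) (.seq a1 (.seq e₂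
      (.seq (.const _ _ _) (.seq a2 a3))))) e₄, r₄, b₄, q₄, fun y hy hy' => ?_, 1 + δ + δ', ?_, ?_⟩
    · rw [f₄ y hy hy', s₃.reg y hy', f₂ y hy (by omega)]
      simp [hS₁, Function.update_of_ne (show y ≠ (x : ℕ) by omega),
        Function.update_of_ne (show y ≠ d + 2 by omega)]
    · rw [c₄, c₂]; simp; ring
    · have z1 : i.size ≤ B.size := Nat.size_le_size (by omega)
      have z2 : (n + 1).size ≤ B.size := Nat.size_le_size (by omega)
      have z3 : w * (B.size + 1) * δ ≤ (w + 16) * (B.size + 1) * δ := by gcongr; omega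
      have z4 : (w + 16) * (B.size + 1) * (1 + δ + δ') = w * (B.size + 1) + 16 * (B.size + 1) +
        (w + 16) * (B.size + 1) * δ + (w + 16) * (B.size + 1) * δ' := by ring
      rw [z4, h0]
      simp only [Nat.size_zero, Nat.size_one]
      omega

/-- The compilation is correct, and its time is proportional to the clock. -/
theorem Stm.sound {ω : ℕ → Bool} {b M B : ℕ} (hB1 : 1 ≤ B) (hb : b ≤ B) (c : Stm) :
    ∀ {d : ℕ}, 33 ≤ d → ∀ (Q : St → Prop) (σ : St) (S : State), Rel b M S σ → σ.Bdd B →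
      c.wp ω b M B Q σ → Sound ω b M B (c.code M d) (c.weight M) d Q σ S := by
  induction c with
  | skip =>
    intro d hd Q σ S hS hσ h
    exact ⟨S, σ.tick, 1, .skip _, hS.tick, hσ.tick, h, fun _ _ _ => rfl, 1, rfl, by simp [weight]⟩
  | assign x e =>
    intro d hd Q σ S hS hσ h
    obtain ⟨S₁, t₁, x₁, r₁, s₁, b₁⟩ := e.code_exec (ω := ω) hb hσ hS h.1 hd
    have s₂ := s₁.trans (Same.setReg (n := 0) S₁ (show d ≤ d + 1 by omega))
    have a1 : Exec ω (.arith .add x d (d + 1)) (S₁.setReg (d + 1) 0)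
        ((S₁.setReg (d + 1) 0).setReg x (e.eval σ)) (1 + (e.eval σ).size + 0) := by
      have := Exec.arith (ω := ω) (S₁.setReg (d + 1) 0) .add x d (d + 1)
      simpa [Op.eval, r₁] using this
    refine ⟨_, _, _, .seq x₁ (.seq (.const _ _ _) a1), ((hS.same s₂ hd).set x _).tick,
      (hσ.set x (h.2.1 hσ)).tick, h.2.2, fun y hy hy' => ?_, 1, rfl, ?_⟩
    · rw [← s₂.reg y hy', setReg_reg, Function.update_of_ne (by omega)]
    · have := e.size_eval_le hσ
      simp only [weight, add_mul, Nat.size_zero]; omega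
  | put k i e =>
    intro d hd Q σ S hS hσ h
    obtain ⟨hk, hi, he, hkM, hB, hQ⟩ := h
    obtain ⟨S₁, t₁, x₁, r₁, s₁, b₁⟩ := k.code_exec (ω := ω) hb hσ hS hk hd
    obtain ⟨S₂, t₂, x₂, r₂, s₂, b₂⟩ := i.code_exec (ω := ω) (d := d + 1) hb hσ (hS.same s₁ hd) hi
      (by omega)
    have s₂' := s₁.trans (s₂.mono (show d ≤ d + 1 by omega))
    obtain ⟨S₃, t₃, x₃, r₃, s₃, b₃⟩ := e.code_exec (ω := ω) (d := d + 2) hb hσ (hS.same s₂' hd) he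
      (by omega)
    have s₃' := s₂'.trans (s₃.mono (show d ≤ d + 2 by omega))
    have e1 : S₃.reg d = k.eval σ := by rw [s₃.reg d (by omega), s₂.reg d (by omega), r₁]
    have e2 : S₃.reg (d + 1) = i.eval σ := by rw [s₃.reg _ (by omega), r₂]
    have e4 : S₃.reg 32 = b := by rw [s₃'.reg 32 (by omega), hS.base]
    set S₄ := S₃.setReg (d + 3) M with hS₄
    set S₅ := S₄.setReg (d + 1) (i.eval σ * M) with hS₅
    set S₆ := S₅.setReg d (k.eval σ + i.eval σ * M) with hS₆
    set S₇ := S₆.setReg d (k.eval σ + i.eval σ * M + b) with hS₇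
    have a1 : Exec ω (.arith .mul (d + 1) (d + 1) (d + 3)) S₄ S₅
        (1 + (i.eval σ).size + M.size) := by
      have := Exec.arith (ω := ω) S₄ .mul (d + 1) (d + 1) (d + 3)
      simpa [Op.eval, e2, hS₄] using this
    have a2 : Exec ω (.arith .add d d (d + 1)) S₅ S₆
        (1 + (k.eval σ).size + (i.eval σ * M).size) := by
      have := Exec.arith (ω := ω) S₅ .add d d (d + 1)
      simpa [Op.eval, e1, hS₄, hS₅] using this
    have a3 : Exec ω (.arith .add d d 32) S₆ S₇
        (1 + (k.eval σ + i.eval σ * M).size + b.size) := by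
      have := Exec.arith (ω := ω) S₆ .add d d 32
      simpa [Op.eval, e4, hS₄, hS₅, hS₆, show 32 ≠ d by omega, show 32 ≠ d + 1 by omega,
        show 32 ≠ d + 3 by omega] using this
    have g1 : S₇.reg d = b + M * i.eval σ + k.eval σ := by simp [hS₇]; ring
    have g2 : S₇.reg (d + 2) = e.eval σ := by simp [hS₄, hS₅, hS₆, hS₇, r₃]
    have s₇ : Same d S S₇ := s₃'.trans ((Same.setReg _ (by omega)).trans
      ((Same.setReg _ (by omega)).trans ((Same.setReg _ le_rfl).trans (Same.setReg _ le_rfl))))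
    refine ⟨_, _, _, .seq x₁ (.seq x₂ (.seq x₃ (.seq (.const _ _ _) (.seq a1 (.seq a2 (.seq a3
      (.store _ _ _))))))), ?_, (hσ.put _ _ (hB hσ)).tick, hQ, fun y hy hy' => ?_, 1, rfl, ?_⟩
    · rw [g1, g2]
      exact ((hS.same s₇ hd).put hkM _ _).tick
    · rw [setMem_reg, s₇.reg y hy']
    · have z0 := e.size_eval_le hσ
      have z1 := k.size_eval_le hσ
      have z2 := i.size_eval_le hσ
      have z4 := Nat.size_le_size hb
      have z5 := size_le_self M
      have z6 := size_mul_le (i.eval σ) M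
      have z7 := size_add_le (k.eval σ) (i.eval σ * M)
      have z8 := size_add_le (k.eval σ + i.eval σ * M) b
      have z9 : M ≤ M * (B.size + 1) := Nat.le_mul_of_pos_right _ (by omega)
      rw [g2, show S₇.reg d = k.eval σ + i.eval σ * M + b by rw [g1]; ring]
      simp only [weight, add_mul, mul_assoc, mul_one]; omega
  | putRaw i e =>
    intro d hd Q σ S hS hσ h
    obtain ⟨hi, he, hib, hB, hQ⟩ := h
    obtain ⟨S₁, t₁, x₁, r₁, s₁, b₁⟩ := i.code_exec (ω := ω) hb hσ hS hi hd
    obtain ⟨S₂, t₂, x₂, r₂, s₂, b₂⟩ := e.code_exec (ω := ω) (d := d + 1) hb hσ (hS.same s₁ hd) he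
      (by omega)
    have s₂' := s₁.trans (s₂.mono (show d ≤ d + 1 by omega))
    have e1 : S₂.reg d = i.eval σ := by rw [s₂.reg d (by omega), r₁]
    refine ⟨_, _, _, .seq x₁ (.seq x₂ (.store _ _ _)), ?_, (hσ.putRaw _ (hB hσ)).tick, hQ,
      fun y hy hy' => ?_, 1, rfl, ?_⟩
    · rw [e1, r₂]
      exact ((hS.same s₂' hd).putRaw hib _).tick
    · rw [setMem_reg, s₂'.reg y hy']
    · have z0 := e.size_eval_le hσ
      have z2 := i.size_eval_le hσ
      rw [e1, r₂]
      simp only [weight, add_mul, mul_one]; omega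
  | flip x =>
    intro d hd Q σ S hS hσ h
    refine ⟨_, _, _, .flip _ _, ?_, ?_, h, fun y hy hy' => ?_, 1, rfl, by simp [weight]⟩
    · rw [hS.coins]
      have := hS.set x (ω σ.coins).toNat
      exact ⟨this.v, this.base, this.lo, this.a, rfl⟩
    · have := hσ.set x ((Bool.toNat_le (ω σ.coins)).trans hB1)
      exact ⟨this.v, this.lo, this.a⟩
    · simp [Function.update_of_ne (show y ≠ (x : ℕ) by omega)]
  | seq c₁ c₂ ih₁ ih₂ =>
    intro d hd Q σ S hS hσ h
    obtain ⟨S₁, σ₁, t₁, x₁, r₁, b₁, q₁, f₁, δ₁, k₁, l₁⟩ := ih₁ hd _ σ S hS hσ h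
    obtain ⟨S₂, σ₂, t₂, x₂, r₂, b₂, q₂, f₂, δ₂, k₂, l₂⟩ := ih₂ hd _ σ₁ S₁ r₁ b₁ q₁
    refine ⟨S₂, σ₂, _, .seq x₁ x₂, r₂, b₂, q₂, fun y hy hy' => (f₂ y hy hy').trans (f₁ y hy hy'),
      δ₁ + δ₂, by omega, ?_⟩
    -- Sequencing costs no tick, so the weight of the compound dominates both parts and the ticks
    -- add up.
    have h₁ : c₁.weight M * (B.size + 1) * δ₁ ≤ (Stm.seq c₁ c₂).weight M * (B.size + 1) * δ₁ := by
      gcongr; simp only [weight]; omega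
    have h₂ : c₂.weight M * (B.size + 1) * δ₂ ≤ (Stm.seq c₁ c₂).weight M * (B.size + 1) * δ₂ := by
      gcongr; simp only [weight]; omega
    rw [mul_add]; omega
  | ite e c₁ c₂ ih₁ ih₂ =>
    intro d hd Q σ S hS hσ h
    obtain ⟨S₁, t₁, x₁, r₁, s₁, b₁⟩ := e.code_exec (ω := ω) hb hσ hS h.1 hd
    have z := e.size_eval_le hσ
    have key : ∀ (δ t w : ℕ), t ≤ w * (B.size + 1) * δ → w ≤ c₁.weight M + c₂.weight M →
        t₁ + (1 + (e.eval σ).size + t) ≤ (Stm.ite e c₁ c₂).weight M * (B.size + 1) * (1 + δ) := by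
      intro δ t w ht hw
      have : w * (B.size + 1) * δ ≤ (Stm.ite e c₁ c₂).weight M * (B.size + 1) * δ := by
        gcongr; simp only [weight]; omega
      rw [mul_add, mul_one]
      simp only [weight, add_mul] at this ⊢
      omega
    by_cases h0 : e.eval σ = 0
    · obtain ⟨S₂, σ₂, t₂, x₂, r₂, b₂, q₂, f₂, δ₂, k₂, l₂⟩ :=
        ih₂ hd Q σ.tick S₁ (hS.same s₁ hd).tick hσ.tick (h.2.2 h0)
      refine ⟨S₂, σ₂, _, .seq x₁ (.ite_false (r₁.trans h0) x₂), r₂, b₂, q₂,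
        fun y hy hy' => (f₂ y hy hy').trans (s₁.reg y hy'), 1 + δ₂, ?_, ?_⟩
      · rw [k₂, St.tick_clk]; ring
      · have := key _ _ _ l₂ (by omega); omega
    · obtain ⟨S₂, σ₂, t₂, x₂, r₂, b₂, q₂, f₂, δ₂, k₂, l₂⟩ :=
        ih₁ hd Q σ.tick S₁ (hS.same s₁ hd).tick hσ.tick (h.2.1 h0)
      refine ⟨S₂, σ₂, _, .seq x₁ (.ite_true (by rwa [r₁]) x₂), r₂, b₂, q₂,
        fun y hy hy' => (f₂ y hy hy').trans (s₁.reg y hy'), 1 + δ₂, ?_, ?_⟩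
      · rw [k₂, St.tick_clk]; ring
      · rw [r₁]; exact key _ _ _ l₂ (by omega)
  | loop x e c ih =>
    intro d hd Q σ S hS hσ h
    obtain ⟨S₁, t₁, x₁, r₁, s₁, b₁⟩ := e.code_exec (ω := ω) hb hσ hS h.1 hd
    have s₂ := s₁.trans (Same.setReg (n := 0) S₁ (show d ≤ d + 1 by omega))
    obtain ⟨S₂, σ₂, t₂, x₂, r₂, b₂, q₂, f₂, δ₂, k₂, l₂⟩ :=
      loop_sound (ω := ω) (b := b) (M := M) (B := B) (x := x) hd
        (fun Q σ S h1 h2 h3 => ih (d := d + 3) (by omega) Q σ S h1 h2 h3) (e.eval σ) 0 Q σ.tick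
        (S₁.setReg (d + 1) 0) (hS.same s₂ hd).tick hσ.tick (h.2.1 hσ) (by simp [r₁]) (by simp)
        h.2.2
    refine ⟨S₂, σ₂, _, .seq x₁ (.seq (.const _ _ _) x₂), r₂, b₂, q₂,
      fun y hy hy' => (f₂ y hy hy').trans (s₂.reg y hy'), 1 + δ₂, ?_, ?_⟩
    · rw [k₂, St.tick_clk]; ring
    · have : (c.weight M + 16) * (B.size + 1) * δ₂ ≤
          (Stm.loop x e c).weight M * (B.size + 1) * δ₂ := by
        gcongr; simp only [weight]; omega
      rw [mul_add, mul_one]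
      simp only [weight, add_mul, Nat.size_zero] at this l₂ ⊢
      omega

end ForLang

/-! ## Parent tables and spanning trees -/

open Classical in
/-- The number of values of `f` is at most one more than the number of edges of a connected graph
whose ends have different values; the values are counted by their first occurrences. -/
theorem card_first_occurrence_le {n : ℕ} {κ : Type*} {G : SimpleGraph (Fin n)} (hG : G.Connected)
    (f : Fin n → κ) :
    (Finset.univ.filter fun v : Fin n => ∀ u < v, f u ≠ f v).card ≤
      (G.edgeFinset.filter fun e => ¬ (e.map f).IsDiag).card + 1 := by
  set f' : Fin n → Set.range f := Set.rangeFactorization f with hf'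
  have ff : ∀ u v, f' u = f' v ↔ f u = f v := fun u v => by simp [hf', Subtype.ext_iff]
  have hsurj : Function.Surjective f' := Set.rangeFactorization_surjective
  -- Contracting the fibres of `f` keeps the graph connected, and a connected graph has at most one
  -- more vertex than edges.
  have hH : (G.map f').Connected := by
    have : Nonempty (Set.range f) := hG.nonempty.map f'
    refine ⟨fun a b => ?_⟩
    obtain ⟨u, rfl⟩ := hsurj a
    obtain ⟨v, rfl⟩ := hsurj b
    obtain ⟨w⟩ := hG.preconnected u v
    induction w with
    | nil => exact SimpleGraph.Reachable.refl _
    | @cons u v w h _ ih =>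
      by_cases e : f' u = f' v
      · rw [e]; exact ih
      · have : (G.map f').Adj (f' u) (f' v) := ⟨e, u, v, h, rfl, rfl⟩
        exact this.reachable.trans ih
  have h1 : Nat.card (Set.range f) ≤ Nat.card (G.map f').edgeSet + 1 :=
    hH.card_vert_le_card_edgeSet_add_one
  have h2 : (Finset.univ.filter fun v : Fin n => ∀ u < v, f u ≠ f v).card ≤
      Nat.card (Set.range f) := by
    rw [Nat.card_eq_fintype_card, ← Finset.card_univ]
    refine Finset.card_le_card_of_injOn f' (fun _ _ => Finset.mem_coe.2 (Finset.mem_univ _)) ?_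
    intro u hu v hv huv
    simp only [Finset.coe_filter, Finset.mem_univ, true_and, Set.mem_ofPred_eq] at hu hv
    rw [ff] at huv
    rcases lt_trichotomy u v with h | h | h
    · exact absurd huv (hv u h)
    · exact h
    · exact absurd huv.symm (hu v h)
  -- Each edge of the contracted graph is the image of an edge whose ends have different values.
  have h3 : Nat.card (G.map f').edgeSet ≤
      (G.edgeFinset.filter fun e => ¬ (e.map f).IsDiag).card := by
    have : (G.map f').edgeSet ⊆
        ((G.edgeFinset.filter fun e => ¬ (e.map f).IsDiag).image (Sym2.map f') : Finset _) := by
      intro e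
      induction e using Sym2.ind with
      | _ a b =>
        rw [SimpleGraph.mem_edgeSet]
        rintro ⟨hab, u, v, huv, rfl, rfl⟩
        refine Finset.mem_coe.2 (Finset.mem_image.2 ⟨s(u, v), ?_, rfl⟩)
        simp only [Finset.mem_filter, SimpleGraph.mem_edgeFinset, SimpleGraph.mem_edgeSet,
          Sym2.map_mk, Sym2.mk_isDiag_iff]
        exact ⟨huv, fun h => hab ((ff _ _).2 h)⟩
    calc Nat.card (G.map f').edgeSet ≤ _ := Nat.card_mono (Finset.finite_toSet _) this
      _ ≤ _ := by rw [Nat.card_eq_card_toFinset, Finset.toFinset_coe]; exact Finset.card_image_le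
  omega

/-! ### Charging a parent table to separated tree edges -/

/-- Rows `u` and `v` of `X` agree on the columns in `R`. -/
def AgreeOn (X : ℕ → ℕ → ℕ) (q : ℕ) (R : ℕ → Prop) (u v : ℕ) : Prop :=
  ∀ l < q, R l → X u l = X v l

theorem AgreeOn.mono {X : ℕ → ℕ → ℕ} {q u v : ℕ} {R R' : ℕ → Prop} (h : AgreeOn X q R u v)
    (hR : ∀ l < q, R' l → R l) : AgreeOn X q R' u v :=
  fun l hl h' => h l hl (hR l hl h')

theorem AgreeOn.symm {X : ℕ → ℕ → ℕ} {q u v : ℕ} {R : ℕ → Prop} (h : AgreeOn X q R u v) :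
    AgreeOn X q R v u := fun l hl h' => (h l hl h').symm

theorem AgreeOn.trans {X : ℕ → ℕ → ℕ} {q u v w : ℕ} {R : ℕ → Prop} (h : AgreeOn X q R u v)
    (h' : AgreeOn X q R v w) : AgreeOn X q R u w :=
  fun l hl hR => (h l hl hR).trans (h' l hl hR)

/-- The Hamming distance of the rows `u` and `v` of `X`. -/
def rowDist (X : ℕ → ℕ → ℕ) (q u v : ℕ) : ℕ :=
  ((Finset.range q).filter fun l => X u l ≠ X v l).card

theorem rowDist_le (X : ℕ → ℕ → ℕ) (q u v : ℕ) : rowDist X q u v ≤ q := by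
  have := Finset.card_filter_le (Finset.range q) (fun l => X u l ≠ X v l)
  simpa [rowDist] using this

open Classical in
/-- The weight of the edges of `T` whose ends are separated by the column sets `R 0, R 1, …`,
where separation by `R t` counts `2 ^ t`. -/
noncomputable def separation {n : ℕ} (T : SimpleGraph (Fin n)) (X : ℕ → ℕ → ℕ) (q lam : ℕ)
    (R : ℕ → ℕ → Prop) : ℕ :=
  ∑ t ∈ Finset.range (lam + 1), 2 ^ t * (T.edgeFinset.filter fun e =>
    ¬ (e.map fun (v : Fin n) (l : ℕ) => if l < q ∧ R t l then X v l else 0).IsDiag).card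

theorem agreeOn_iff_ite_eq {X : ℕ → ℕ → ℕ} {q u v : ℕ} {R : ℕ → Prop} [DecidablePred R] :
    AgreeOn X q R u v ↔ (fun l => if l < q ∧ R l then X u l else 0) =
      fun l => if l < q ∧ R l then X v l else 0 := by
  constructor
  · intro h
    funext l
    split_ifs with hl
    · exact h l hl.1 hl.2
    · rfl
  · intro h l hl hR
    simpa [hl, hR] using congrFun h l

open Classical in
/-- A parent table that respects a decreasing family of column sets is almost as cheap as any
connected graph, if agreement on a column set bounds the distance. -/
theorem sum_rowDist_parent_le {n q lam L : ℕ} {T : SimpleGraph (Fin n)} (hT : T.Connected)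
    {X : ℕ → ℕ → ℕ} {R : ℕ → ℕ → Prop} {par : ℕ → ℕ} (hL : 1 ≤ L) (hq : q ≤ 2 ^ lam)
    (h0 : par 0 = 0) (hlt : ∀ v < n, 0 < v → par v < v)
    (hR0 : ∀ l, R 0 l)
    (hpar : ∀ v < n, ∀ t ≤ lam, (∃ u < v, AgreeOn X q (R t) u v) → AgreeOn X q (R t) (par v) v)
    (good : ∀ u < n, ∀ v < n, ∀ t ≤ lam, AgreeOn X q (R t) u v → rowDist X q u v ≤ L * 2 ^ t) :
    ∑ v ∈ Finset.range n, rowDist X q (par v) v ≤ 2 * L * separation T X q lam R := by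
  -- Row `v` is charged to the largest level `t` at which no earlier row agrees with it: at level `t
  -- + 1` the parent agrees with `v` and is therefore close.
  have key : ∀ v < n, rowDist X q (par v) v ≤ ∑ t ∈ Finset.range (lam + 1),
      2 * L * (2 ^ t * if 0 < v ∧ ∀ u < v, ¬ AgreeOn X q (R t) u v then 1 else 0) := by
    intro v hv
    rcases Nat.eq_zero_or_pos v with rfl | hv0
    · simp [h0, rowDist]
    have hpv := hlt v hv hv0
    by_cases hS : ∃ t, t ≤ lam ∧ ∀ u < v, ¬ AgreeOn X q (R t) u v
    · obtain ⟨t₀, ht₀, hu₀⟩ := hS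
      set P : ℕ → Prop := fun t => ∀ u < v, ¬ AgreeOn X q (R t) u v with hP
      set t := Nat.findGreatest P lam with ht
      have htl : t ≤ lam := Nat.findGreatest_le lam
      have hPt : P t := Nat.findGreatest_spec ht₀ hu₀
      refine le_trans ?_ (Finset.single_le_sum (f := fun t => 2 * L *
        (2 ^ t * if 0 < v ∧ ∀ u < v, ¬ AgreeOn X q (R t) u v then 1 else 0))
        (fun _ _ => Nat.zero_le _) (Finset.mem_range.2 (Nat.lt_succ_of_le htl)))
      simp only [if_pos (show 0 < v ∧ ∀ u < v, ¬ AgreeOn X q (R t) u v from ⟨hv0, hPt⟩), mul_one]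
      rcases htl.eq_or_lt with h | h
      -- There is no level above `lam`, but there the trivial bound `q ≤ 2 ^ lam` suffices.
      · rw [h]
        calc rowDist X q (par v) v ≤ q := rowDist_le _ _ _ _
          _ ≤ 1 * 2 ^ lam := by omega
          _ ≤ _ := by gcongr; omega
      · have hn : ¬ P (t + 1) := Nat.findGreatest_is_greatest (Nat.lt_succ_self _) h
        simp only [hP, not_forall, not_not] at hn
        obtain ⟨u, hu, hag⟩ := hn
        calc _ ≤ L * 2 ^ (t + 1) :=
              good _ (hpv.trans hv) v hv (t + 1) h (hpar v hv (t + 1) h ⟨u, hu, hag⟩)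
          _ = _ := by ring
    -- If `v` is not first even at level `0`, it has an earlier copy; since `R 0` contains all
    -- columns, the parent is such a copy.
    · push Not at hS
      have := hpar v hv 0 (Nat.zero_le _) (hS 0 (Nat.zero_le _))
      have h00 : rowDist X q (par v) v = 0 := by
        rw [rowDist, Finset.card_eq_zero, Finset.filter_eq_empty_iff]
        intro l hl
        simp [this l (Finset.mem_range.1 hl) (hR0 l)]
      omega
  calc _ ≤ ∑ v ∈ Finset.range n, ∑ t ∈ Finset.range (lam + 1),
      2 * L * (2 ^ t * if 0 < v ∧ ∀ u < v, ¬ AgreeOn X q (R t) u v then 1 else 0) :=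
        Finset.sum_le_sum fun v hv => key v (Finset.mem_range.1 hv)
    _ = 2 * L * ∑ t ∈ Finset.range (lam + 1), 2 ^ t * ∑ v ∈ Finset.range n,
        if 0 < v ∧ ∀ u < v, ¬ AgreeOn X q (R t) u v then 1 else 0 := by
      rw [Finset.sum_comm, Finset.mul_sum]
      simp only [Finset.mul_sum]
    _ ≤ _ := by
      unfold separation
      gcongr with t ht
      have hc := card_first_occurrence_le hT
        (fun (v : Fin n) (l : ℕ) => if l < q ∧ R t l then X v l else 0)
      rw [Finset.sum_range]
      obtain ⟨v₀⟩ := hT.nonempty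
      have hn : 0 < n := v₀.pos
      -- Row `0` is always a first occurrence but pays nothing; this absorbs the `+ 1` of
      -- `card_first_occurrence_le`.
      have hs : insert (⟨0, hn⟩ : Fin n) (Finset.univ.filter fun v : Fin n =>
          0 < (v : ℕ) ∧ ∀ u < (v : ℕ), ¬ AgreeOn X q (R t) u v) ⊆
          Finset.univ.filter fun v : Fin n => ∀ u < v,
            (fun (v : Fin n) (l : ℕ) => if l < q ∧ R t l then X v l else 0) u ≠
            (fun (v : Fin n) (l : ℕ) => if l < q ∧ R t l then X v l else 0) v := by
        intro v hv
        simp only [Finset.mem_insert, Finset.mem_filter, Finset.mem_univ, true_and] at hv ⊢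
        intro u hu
        rcases hv with rfl | hv
        · exact absurd hu (by simp [Fin.lt_def])
        · exact fun h => hv.2 u hu (agreeOn_iff_ite_eq.2 h)
      have := (Finset.card_le_card hs).trans hc
      rw [Finset.card_insert_of_notMem (by simp)] at this
      rw [← Finset.card_filter]
      omega

/-! ## Random column levels -/

open RandRAM in
/-- The probability that `m` disjoint blocks of coin tosses are all bad. -/
theorem coinMeasure_forall_block_le {b m off : ℕ} (bad : Finset (Fin b → Bool))
    (h : 2 * bad.card ≤ 2 ^ b) :
    coinMeasure.real {ω | ∀ k < m, (fun j : Fin b => ω (off + (k * b + j))) ∈ bad} ≤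
      (1 / 2) ^ m := by
  classical
  set e : Fin m × Fin b → ℕ := fun x => off + (x.1 * b + x.2) with he
  have einj : Function.Injective e := by
    intro x y hxy
    have h1 : (x.1 : ℕ) * b + x.2 = y.1 * b + y.2 := by simp only [he] at hxy; omega
    apply finProdFinEquiv.injective
    ext
    simp only [finProdFinEquiv_apply_val]
    linarith
  -- Distinct pairs use distinct coins, so fixing all of them gives a cylinder of `m * b`
  -- independent fair tosses.
  have hpt : ∀ z : Fin m × Fin b → Bool,
      coinMeasure {ω | ∀ x, ω (e x) = z x} = (1 / 2) ^ (m * b) := by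
    intro z
    have : {ω : ℕ → Bool | ∀ x, ω (e x) = z x} =
        Set.pi ((Finset.univ.map ⟨e, einj⟩ : Finset ℕ) : Set ℕ)
          (fun j => {ω | ∀ x, e x = j → ω = z x}) := by
      ext ω
      simp only [Set.mem_ofPred_eq, Set.mem_pi, Finset.coe_map, Function.Embedding.coeFn_mk,
        Finset.coe_univ, Set.image_univ, Set.mem_range, forall_exists_index]
      constructor
      · rintro h _ x rfl y hy
        rw [← hy]; exact h y
      · intro h x
        exact h _ x rfl x rfl
    rw [this, coinMeasure, Measure.infinitePi_pi]
    · rw [Finset.prod_map]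
      have hx : ∀ x ∈ (Finset.univ : Finset (Fin m × Fin b)),
          (PMF.uniformOfFintype Bool).toMeasure {ω | ∀ y, e y = e x → ω = z y} = 1 / 2 := by
        intro x _
        have : {ω | ∀ y, e y = e x → ω = z y} = {z x} := by
          ext ω
          simp only [Set.mem_ofPred_eq, Set.mem_singleton_iff]
          exact ⟨fun h => h x rfl, fun h y hy => by rw [h, einj hy]⟩
        rw [this, PMF.toMeasure_apply_singleton _ _ (measurableSet_singleton _)]
        simp
      exact (Finset.prod_congr rfl hx).trans (by simp)
    · intro i _; exact MeasurableSet.of_discrete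
  set Z : Finset (Fin m × Fin b → Bool) := Finset.univ.filter fun z => ∀ k, (fun j => z (k, j)) ∈ bad
    with hZ
  have hcard : Z.card = bad.card ^ m := by
    have : bad.card ^ m = (Fintype.piFinset fun _ : Fin m => bad).card := by
      simp [Fintype.card_piFinset]
    rw [this]
    refine Finset.card_equiv (Equiv.curry _ _ _) fun z => ?_
    simp only [hZ, Finset.mem_filter, Finset.mem_univ, true_and, Fintype.mem_piFinset]
    rfl
  have hsub : {ω : ℕ → Bool | ∀ k < m, (fun j : Fin b => ω (off + (k * b + j))) ∈ bad} ⊆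
      ⋃ z ∈ Z, {ω | ∀ x, ω (e x) = z x} := by
    intro ω hω
    simp only [Set.mem_iUnion]
    exact ⟨fun x => ω (e x), by simpa [hZ, he] using fun k : Fin m => hω k k.2, fun _ => rfl⟩
  have h1 : coinMeasure {ω | ∀ k < m, (fun j : Fin b => ω (off + (k * b + j))) ∈ bad} ≤
      (1 / 2) ^ m := by
    calc _ ≤ _ := measure_mono hsub
      _ ≤ ∑ z ∈ Z, coinMeasure {ω | ∀ x, ω (e x) = z x} := measure_biUnion_finset_le _ _
      _ = (bad.card : ENNReal) ^ m * (1 / 2) ^ (m * b) := by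
        simp only [hpt, Finset.sum_const, hcard, nsmul_eq_mul, Nat.cast_pow]
      _ = ((bad.card : ENNReal) * (1 / 2) ^ b) ^ m := by rw [mul_pow, ← pow_mul, mul_comm m]
      _ ≤ (1 / 2) ^ m := by
        gcongr
        have h2 : (2 : ENNReal) * bad.card ≤ 2 ^ b := by exact_mod_cast h
        calc (bad.card : ENNReal) * (1 / 2) ^ b = (1 / 2) * (2 * bad.card) * (1 / 2) ^ b := by
              rw [← mul_assoc (1 / 2), one_div, ENNReal.inv_mul_cancel (by simp) (by simp), one_mul]
          _ ≤ (1 / 2) * 2 ^ b * (1 / 2) ^ b := by gcongr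
          _ = 1 / 2 := by
              rw [mul_assoc, ← mul_pow, one_div, ENNReal.mul_inv_cancel (by simp) (by simp),
                one_pow, mul_one]
  rw [measureReal_def]
  calc _ ≤ ((1 / 2 : ENNReal) ^ m).toReal := ENNReal.toReal_mono (by simp) h1
    _ = _ := by simp

/-! ### Counting coin tosses: agreement and separation at one level -/

/-- Column `l` reaches level `t` if its first `t` coins are heads. -/
def Reach (lam : ℕ) (y : ℕ → Bool) (t l : ℕ) : Prop := ∀ i < t, y (l * lam + i) = true

/-- The first `t` coins are forced and the others free: a column reaches level `t` with probability
`2⁻ᵗ`. Probabilities are written multiplicatively as counts, to stay in `ℕ`. -/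
theorem card_forall_lt {lam t : ℕ} (ht : t ≤ lam) :
    (Finset.univ.filter fun z : Fin lam → Bool => ∀ i : Fin lam, (i : ℕ) < t → z i = true).card *
      2 ^ t = 2 ^ lam := by
  classical
  have : (Finset.univ.filter fun z : Fin lam → Bool => ∀ i : Fin lam, (i : ℕ) < t → z i = true) =
      Fintype.piFinset fun i : Fin lam => if (i : ℕ) < t then {true} else Finset.univ := by
    ext z
    simp only [Finset.mem_filter, Finset.mem_univ, true_and, Fintype.mem_piFinset]
    refine forall_congr' fun i => ?_
    split_ifs with h <;> simp [h]
  rw [this, Fintype.card_piFinset]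
  have hc : ∀ i : Fin lam, (if (i : ℕ) < t then ({true} : Finset Bool) else Finset.univ).card =
      if (i : ℕ) < t then 1 else 2 := fun i => by split_ifs <;> simp
  simp only [hc]
  rw [Fin.prod_univ_eq_prod_range (fun i => if i < t then 1 else 2) lam]
  obtain ⟨k, rfl⟩ := Nat.exists_eq_add_of_le ht
  rw [Finset.prod_range_add, Finset.prod_congr rfl (fun i hi => if_pos (Finset.mem_range.1 hi))]
  simp [pow_add, mul_comm]

/-- The event concerns one column only, so its probability `1 / c` is unaffected by the other
columns. -/
theorem card_column_mem {q : ℕ} {β : Type*} [Fintype β] [DecidableEq β] (Z : Finset β) {c : ℕ}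
    (h : Z.card * c = Fintype.card β) (l : Fin q) :
    (Finset.univ.filter fun y : Fin q → β => y l ∈ Z).card * c = Fintype.card β ^ q := by
  have : (Finset.univ.filter fun y : Fin q → β => y l ∈ Z) =
      Fintype.piFinset fun i => if i = l then Z else Finset.univ := by
    ext y
    simp only [Finset.mem_filter, Finset.mem_univ, true_and, Fintype.mem_piFinset]
    constructor
    · intro h i
      split_ifs with hi
      · rwa [hi]
      · simp
    · intro h; simpa using h l
  rw [this, Fintype.card_piFinset, ← Finset.mul_prod_erase _ _ (Finset.mem_univ l), if_pos rfl,
    Finset.prod_congr rfl (g := fun _ => Fintype.card β)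
      (fun i hi => by rw [if_neg (Finset.ne_of_mem_erase hi), Finset.card_univ]),
    Finset.prod_const, Finset.card_erase_of_mem (Finset.mem_univ l), Finset.card_univ,
    Fintype.card_fin, mul_right_comm, h, ← pow_succ', Nat.sub_add_cancel l.pos]

/-- This is `(1 - 1/m) ^ d ≤ 2⁻ᴸ` for `d ≥ L * m`. It reduces to `2 * (m - 1) ^ m ≤ m ^ m`, which
follows from the two leading terms of the binomial expansion of `((m - 1) + 1) ^ m`. -/
theorem pred_pow_mul_two_pow_le {m d L : ℕ} (hm : 1 ≤ m) (h : L * m ≤ d) :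
    (m - 1) ^ d * 2 ^ L ≤ m ^ d := by
  have h1 : (m - 1) ^ m * 2 ≤ m ^ m := by
    obtain ⟨k, rfl⟩ := Nat.exists_eq_add_of_le' hm
    rw [Nat.add_sub_cancel]
    have : k ^ (k + 1) + (k + 1) * k ^ k ≤ (k + 1) ^ (k + 1) := by
      rw [add_pow]
      simp only [Nat.cast_id]
      have e := Finset.add_sum_erase (Finset.range (k + 1 + 1))
        (fun m => k ^ m * 1 ^ (k + 1 - m) * (k + 1).choose m) (a := k + 1) (by simp)
      rw [← e]
      have e2 := Finset.single_le_sum (f := fun m => k ^ m * 1 ^ (k + 1 - m) * (k + 1).choose m)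
        (s := (Finset.range (k + 1 + 1)).erase (k + 1)) (a := k) (fun _ _ => Nat.zero_le _) (by simp)
      simp at e2 ⊢
      linarith
    have h2 : k ^ (k + 1) ≤ (k + 1) * k ^ k := by rw [pow_succ, mul_comm]; gcongr; omega
    omega
  obtain ⟨k, rfl⟩ := Nat.exists_eq_add_of_le h
  calc (m - 1) ^ (L * m + k) * 2 ^ L = ((m - 1) ^ m * 2) ^ L * (m - 1) ^ k := by
        rw [pow_add, mul_pow, mul_comm L, pow_mul]; ring
    _ ≤ (m ^ m) ^ L * m ^ k := by gcongr; omega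
    _ = _ := by rw [pow_add, mul_comm L, pow_mul]

/-- The columns are independent and each misses `Z` with probability `1 - 1/c`; with at least `L *
c` of them, all miss with probability at most `2⁻ᴸ`. -/
theorem card_forall_notMem_mul_le {q : ℕ} {β : Type*} [Fintype β] [DecidableEq β] (Z : Finset β)
    {c L : ℕ} (h : Z.card * c = Fintype.card β) (hc : 1 ≤ c) (D : Finset (Fin q))
    (hD : L * c ≤ D.card) :
    (Finset.univ.filter fun y : Fin q → β => ∀ l ∈ D, y l ∉ Z).card * 2 ^ L ≤
      Fintype.card β ^ q := by
  have : (Finset.univ.filter fun y : Fin q → β => ∀ l ∈ D, y l ∉ Z) =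
      Fintype.piFinset fun i => if i ∈ D then Zᶜ else Finset.univ := by
    ext y
    simp only [Finset.mem_filter, Finset.mem_univ, true_and, Fintype.mem_piFinset]
    refine forall_congr' fun i => ?_
    split_ifs with hi <;> simp [hi]
  have hcd : ∀ i : Fin q, (if i ∈ D then Zᶜ else Finset.univ).card =
      if i ∈ D then Z.card * (c - 1) else Z.card * c := by
    intro i
    split_ifs
    · rw [Finset.card_compl, ← h, Nat.mul_sub, mul_one]
    · rw [Finset.card_univ, h]
  rw [this, Fintype.card_piFinset, Finset.prod_congr rfl (fun i _ => hcd i), Finset.prod_ite,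
    Finset.prod_const, Finset.prod_const, ← h]
  have h1 : (Finset.univ.filter fun i => i ∈ D).card = D.card := by simp
  have h2 : (Finset.univ.filter fun i => i ∉ D).card = q - D.card := by
    rw [← Finset.compl_filter, Finset.card_compl, h1, Fintype.card_fin]
  have h3 : D.card ≤ q := by simpa using Finset.card_le_univ D
  rw [h1, h2]
  calc (Z.card * (c - 1)) ^ D.card * (Z.card * c) ^ (q - D.card) * 2 ^ L
      = Z.card ^ D.card * ((c - 1) ^ D.card * 2 ^ L) * (Z.card * c) ^ (q - D.card) := by
        rw [mul_pow]; ring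
    _ ≤ Z.card ^ D.card * c ^ D.card * (Z.card * c) ^ (q - D.card) := by
        gcongr; exact pred_pow_mul_two_pow_le hc hD
    _ = _ := by rw [← mul_pow, ← pow_add, Nat.add_sub_cancel' h3]

/-! ### Good choices of levels have probability at least one half -/

/-- A choice of column levels for which every parent table that respects them is cheap. -/
def GoodLevels {n : ℕ} (T : SimpleGraph (Fin n)) (X : ℕ → ℕ → ℕ) (q lam L K : ℕ)
    (y : ℕ → Bool) : Prop :=
  (∀ u < n, ∀ v < n, ∀ t ≤ lam, AgreeOn X q (Reach lam y t) u v → rowDist X q u v ≤ L * 2 ^ t) ∧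
    separation T X q lam (Reach lam y) ≤ K

/-- The sum of the distances along the edges of `T`. -/
noncomputable def edgeDistSum {n : ℕ} (T : SimpleGraph (Fin n)) (X : ℕ → ℕ → ℕ) (q : ℕ) : ℕ :=
  open Classical in
  ∑ e ∈ T.edgeFinset, Sym2.lift ⟨fun u v : Fin n => rowDist X q u v, fun u v => by
    simp [rowDist, ne_comm]⟩ e

/-- Coin tosses in blocks of `lam` for each of `q` columns. -/
def flatten {q lam : ℕ} (y : Fin q → Fin lam → Bool) (j : ℕ) : Bool :=
  if h : j < q * lam then
    y (finProdFinEquiv.symm ⟨j, h⟩).1 (finProdFinEquiv.symm ⟨j, h⟩).2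
  else false

theorem flatten_apply {q lam : ℕ} (y : Fin q → Fin lam → Bool) (l : Fin q) (i : Fin lam) :
    flatten y (l * lam + i) = y l i := by
  have e : (l * lam + i : ℕ) = (finProdFinEquiv (l, i) : Fin (q * lam)) := by
    simp [finProdFinEquiv]; ring
  have h : (l * lam + i : ℕ) < q * lam := e ▸ (finProdFinEquiv (l, i)).2
  have e' : (⟨l * lam + i, h⟩ : Fin (q * lam)) = finProdFinEquiv (l, i) := Fin.ext e
  simp only [flatten, dif_pos h, e', Equiv.symm_apply_apply]

theorem reach_flatten {q lam t : ℕ} (ht : t ≤ lam) (y : Fin q → Fin lam → Bool) (l : Fin q) :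
    Reach lam (flatten y) t l ↔ ∀ i : Fin lam, (i : ℕ) < t → y l i = true := by
  constructor
  · intro h i hi; rw [← flatten_apply y]; exact h i hi
  · intro h i hi
    have := flatten_apply y l ⟨i, hi.trans_le ht⟩
    simp only at this
    rw [this]; exact h _ hi

open Classical in
-- Agreement on the columns of level `t` means that none of the differing columns, of which there
-- are at least `L * 2 ^ t`, reaches level `t`.
theorem card_agreeOn_mul_le {X : ℕ → ℕ → ℕ} {q lam t L u v : ℕ} (ht : t ≤ lam)
    (h : L * 2 ^ t ≤ rowDist X q u v) :
    (Finset.univ.filter fun y : Fin q → Fin lam → Bool =>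
      AgreeOn X q (Reach lam (flatten y) t) u v).card * 2 ^ L ≤ (2 ^ lam) ^ q := by
  have h1 := card_forall_notMem_mul_le (q := q) (L := L) _
    ((card_forall_lt ht).trans (show 2 ^ lam = Fintype.card (Fin lam → Bool) by simp))
    Nat.one_le_two_pow (Finset.univ.filter fun l : Fin q => X u l ≠ X v l) (by
      refine h.trans_eq ?_
      rw [rowDist, Finset.card_filter, Finset.card_filter, Finset.sum_range])
  simp only [Fintype.card_pi, Fintype.card_bool, Finset.prod_const, Finset.card_univ,
    Fintype.card_fin] at h1
  refine le_trans (Nat.mul_le_mul_right _ (Finset.card_le_card fun y hy => ?_)) h1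
  simp only [Finset.mem_filter, Finset.mem_univ, true_and] at hy ⊢
  intro l hl hr
  exact hl (hy l l.2 ((reach_flatten ht y l).2 hr))

open Classical in
-- Disagreement requires that some differing column reach level `t`; union bound over these columns,
-- each having probability `2⁻ᵗ`.
theorem card_not_agreeOn_mul_le {X : ℕ → ℕ → ℕ} {q lam t u v : ℕ} (ht : t ≤ lam) :
    (Finset.univ.filter fun y : Fin q → Fin lam → Bool =>
      ¬ AgreeOn X q (Reach lam (flatten y) t) u v).card * 2 ^ t ≤
      rowDist X q u v * (2 ^ lam) ^ q := by
  set D := Finset.univ.filter fun l : Fin q => X u l ≠ X v l with hD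
  set Z := Finset.univ.filter fun z : Fin lam → Bool => ∀ i : Fin lam, (i : ℕ) < t → z i = true
    with hZ
  have hsub : (Finset.univ.filter fun y : Fin q → Fin lam → Bool =>
      ¬ AgreeOn X q (Reach lam (flatten y) t) u v) ⊆
      D.biUnion fun l => Finset.univ.filter fun y : Fin q → Fin lam → Bool => y l ∈ Z := by
    intro y hy
    simp only [Finset.mem_filter, Finset.mem_univ, true_and, AgreeOn, not_forall] at hy
    obtain ⟨l, hl, hr, hne⟩ := hy
    simp only [Finset.mem_biUnion, Finset.mem_filter, Finset.mem_univ, true_and, hD, hZ]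
    exact ⟨⟨l, hl⟩, hne, (reach_flatten ht y ⟨l, hl⟩).1 hr⟩
  have hc : ∀ l ∈ D, (Finset.univ.filter fun y : Fin q → Fin lam → Bool => y l ∈ Z).card * 2 ^ t =
      (2 ^ lam) ^ q := by
    intro l _
    rw [card_column_mem Z ((card_forall_lt ht).trans
      (show 2 ^ lam = Fintype.card (Fin lam → Bool) by simp)) l]
    simp
  calc _ ≤ (∑ l ∈ D, (Finset.univ.filter fun y : Fin q → Fin lam → Bool => y l ∈ Z).card) * 2 ^ t :=
        Nat.mul_le_mul_right _ ((Finset.card_le_card hsub).trans Finset.card_biUnion_le)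
    _ = D.card * (2 ^ lam) ^ q := by
        rw [Finset.sum_mul, Finset.sum_congr rfl hc, Finset.sum_const, smul_eq_mul]
    _ = _ := by
        congr 1
        rw [rowDist, Finset.card_filter, Finset.card_filter, Finset.sum_range]

open Classical in
-- Linearity of expectation: at level `t` an edge is separated with probability at most its length
-- times `2⁻ᵗ`, which cancels the weight `2 ^ t`. Each of the `lam + 1` levels thus contributes at
-- most the total edge length.
theorem sum_separation_le {n q lam : ℕ} (T : SimpleGraph (Fin n)) (X : ℕ → ℕ → ℕ) :
    ∑ y : Fin q → Fin lam → Bool, separation T X q lam (Reach lam (flatten y)) ≤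
      (lam + 1) * edgeDistSum T X q * (2 ^ lam) ^ q := by
  unfold separation
  rw [Finset.sum_comm]
  have : ∀ t ∈ Finset.range (lam + 1), (∑ y : Fin q → Fin lam → Bool, 2 ^ t *
      (T.edgeFinset.filter fun e => ¬ (e.map fun (v : Fin n) (l : ℕ) =>
        if l < q ∧ Reach lam (flatten y) t l then X v l else 0).IsDiag).card) ≤
      edgeDistSum T X q * (2 ^ lam) ^ q := by
    intro t ht
    have ht' : t ≤ lam := Nat.lt_succ_iff.1 (Finset.mem_range.1 ht)
    simp only [Finset.card_filter]
    rw [← Finset.mul_sum, Finset.sum_comm, edgeDistSum, Finset.sum_mul, Finset.mul_sum]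
    refine Finset.sum_le_sum fun e _ => ?_
    induction e using Sym2.ind with
    | _ u v =>
      rw [← Finset.card_filter, mul_comm]
      simp only [Sym2.map_mk, Sym2.mk_isDiag_iff, ← agreeOn_iff_ite_eq, Sym2.lift_mk]
      exact card_not_agreeOn_mul_le ht'
  calc _ ≤ _ := Finset.sum_le_sum this
    _ = _ := by rw [Finset.sum_const, Finset.card_range, smul_eq_mul, mul_assoc]

open Classical in
-- Either defect has probability at most 1/4: distant rows that agree by the union bound over `n * n
-- * (lam + 1)` triples, excessive separation by Markov's inequality.
theorem card_not_goodLevels_le {n q lam L : ℕ} (T : SimpleGraph (Fin n)) (X : ℕ → ℕ → ℕ)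
    (hL : 4 * (n * (n * (lam + 1))) ≤ 2 ^ L) :
    2 * (Finset.univ.filter fun y : Fin q → Fin lam → Bool =>
      ¬ GoodLevels T X q lam L (4 * ((lam + 1) * edgeDistSum T X q)) (flatten y)).card ≤
      (2 ^ lam) ^ q := by
  set D := (lam + 1) * edgeDistSum T X q with hD
  set A := (Finset.univ.filter fun y : Fin q → Fin lam → Bool => ¬ ∀ u < n, ∀ v < n, ∀ t ≤ lam,
    AgreeOn X q (Reach lam (flatten y) t) u v → rowDist X q u v ≤ L * 2 ^ t) with hA
  set S := (Finset.univ.filter fun y : Fin q → Fin lam → Bool =>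
    ¬ separation T X q lam (Reach lam (flatten y)) ≤ 4 * D) with hS
  have hsub : (Finset.univ.filter fun y : Fin q → Fin lam → Bool =>
      ¬ GoodLevels T X q lam L (4 * D) (flatten y)) ⊆ A ∪ S := by
    intro y hy
    have hy := (Finset.mem_filter.1 hy).2
    rw [GoodLevels, not_and_or] at hy
    simpa only [hA, hS, Finset.mem_union, Finset.mem_filter, Finset.mem_univ, true_and] using hy
  have hAc : 4 * A.card ≤ (2 ^ lam) ^ q := by
    have h1 : A ⊆ (Finset.range n).biUnion fun u => (Finset.range n).biUnion fun v =>
        (Finset.range (lam + 1)).biUnion fun t => Finset.univ.filter fun y =>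
          AgreeOn X q (Reach lam (flatten y) t) u v ∧ ¬ rowDist X q u v ≤ L * 2 ^ t := by
      intro y hy
      simp only [hA, Finset.mem_filter, Finset.mem_univ, true_and] at hy
      push Not at hy
      obtain ⟨u, hu, v, hv, t, ht, ha, hd⟩ := hy
      simp only [Finset.mem_biUnion, Finset.mem_range, Finset.mem_filter, Finset.mem_univ, true_and]
      exact ⟨u, hu, v, hv, t, by omega, ha, by omega⟩
    have h2 : ∀ u v t, t ≤ lam → (Finset.univ.filter fun y : Fin q → Fin lam → Bool =>
        AgreeOn X q (Reach lam (flatten y) t) u v ∧ ¬ rowDist X q u v ≤ L * 2 ^ t).card * 2 ^ L ≤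
        (2 ^ lam) ^ q := by
      intro u v t ht
      by_cases hd : rowDist X q u v ≤ L * 2 ^ t
      · simp [hd]
      · simp only [hd, not_false_eq_true, and_true]
        exact card_agreeOn_mul_le ht (by omega)
    have h3 : A.card * 2 ^ L ≤ n * (n * (lam + 1)) * (2 ^ lam) ^ q := by
      calc _ ≤ (∑ u ∈ Finset.range n, ∑ v ∈ Finset.range n, ∑ t ∈ Finset.range (lam + 1),
          (Finset.univ.filter fun y : Fin q → Fin lam → Bool =>
          AgreeOn X q (Reach lam (flatten y) t) u v ∧ ¬ rowDist X q u v ≤ L * 2 ^ t).card) *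
            2 ^ L := by
            refine Nat.mul_le_mul_right _ ((Finset.card_le_card h1).trans ?_)
            refine Finset.card_biUnion_le.trans (Finset.sum_le_sum fun u _ => ?_)
            exact Finset.card_biUnion_le.trans
              (Finset.sum_le_sum fun v _ => Finset.card_biUnion_le)
        _ ≤ ∑ u ∈ Finset.range n, ∑ v ∈ Finset.range n, ∑ t ∈ Finset.range (lam + 1),
            (2 ^ lam) ^ q := by
            simp only [Finset.sum_mul]
            refine Finset.sum_le_sum fun u _ => Finset.sum_le_sum fun v _ =>
              Finset.sum_le_sum fun t ht => h2 u v t ?_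
            exact Nat.lt_succ_iff.1 (Finset.mem_range.1 ht)
        _ = _ := by simp only [Finset.sum_const, Finset.card_range, smul_eq_mul]; ring
    by_contra hcon
    push Not at hcon
    have h4 : A.card * (4 * (n * (n * (lam + 1)))) ≤ A.card * 2 ^ L := by gcongr
    have h5 : 0 < n * (n * (lam + 1)) := by
      rcases Nat.eq_zero_or_pos (n * (n * (lam + 1))) with h | h
      · rw [h, zero_mul] at h3
        have : A.card = 0 := by
          rcases Nat.eq_zero_or_pos A.card with h' | h'
          · exact h'
          · have : 0 < A.card * 2 ^ L := by positivity
            omega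
        have : 0 < (2 ^ lam) ^ q := by positivity
        omega
      · exact h
    have h6 := Nat.mul_lt_mul_of_pos_left hcon h5
    nlinarith
  have hSc : 4 * S.card ≤ (2 ^ lam) ^ q := by
    have h1 := sum_separation_le (q := q) (lam := lam) T X
    rw [← hD] at h1
    -- Integrality gives `4 * D + 1` instead of `4 * D`, so Markov's inequality also works for `D =
    -- 0`, where it shows that `S` is empty.
    have h2 : S.card * (4 * D + 1) ≤ D * (2 ^ lam) ^ q := by
      calc _ = ∑ y ∈ S, (4 * D + 1) := by rw [Finset.sum_const, smul_eq_mul]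
        _ ≤ ∑ y ∈ S, separation T X q lam (Reach lam (flatten y)) := by
            refine Finset.sum_le_sum fun y hy => ?_
            have := (Finset.mem_filter.1 hy).2
            omega
        _ ≤ _ := (Finset.sum_le_univ_sum_of_nonneg fun _ => Nat.zero_le _).trans h1
    by_contra hcon
    push Not at hcon
    have := Nat.mul_le_mul_left D hcon.le
    nlinarith
  have := (Finset.card_le_card hsub).trans (Finset.card_union_le _ _)
  omega

open RandRAM in
/-- With high probability one of `m` consecutive choices of column levels is good. -/
theorem one_sub_le_coinMeasure_of_goodLevels {n q lam L m off : ℕ} (T : SimpleGraph (Fin n))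
    (X : ℕ → ℕ → ℕ) (hL : 4 * (n * (n * (lam + 1))) ≤ 2 ^ L) (S : Set (ℕ → Bool))
    (hS : ∀ ω : ℕ → Bool, (∃ k < m, GoodLevels T X q lam L (4 * ((lam + 1) * edgeDistSum T X q))
      fun j => ω (off + (k * (q * lam) + j))) → ω ∈ S) :
    1 - (1 / 2) ^ m ≤ coinMeasure.real S := by
  classical
  set K := 4 * ((lam + 1) * edgeDistSum T X q)
  set bad : Finset (Fin (q * lam) → Bool) := Finset.univ.filter fun z =>
    ¬ GoodLevels T X q lam L K fun j => if h : j < q * lam then z ⟨j, h⟩ else false with hbad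
  have hcard : bad.card = (Finset.univ.filter fun y : Fin q → Fin lam → Bool =>
      ¬ GoodLevels T X q lam L K (flatten y)).card := by
    refine Finset.card_equiv ((finProdFinEquiv.symm.arrowCongr (Equiv.refl Bool)).trans
      (Equiv.curry _ _ _)) fun z => ?_
    simp only [hbad, Finset.mem_filter, Finset.mem_univ, true_and]
    have : flatten (((finProdFinEquiv.symm.arrowCongr (Equiv.refl Bool)).trans
      (Equiv.curry _ _ _)) z) = fun j => if h : j < q * lam then z ⟨j, h⟩ else false := by
      funext j
      by_cases h : j < q * lam
      · simp only [flatten, dif_pos h]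
        exact congrArg z (finProdFinEquiv.apply_symm_apply _)
      · simp [flatten, h]
    rw [this]
  have h1 : 2 * bad.card ≤ 2 ^ (q * lam) := by
    rw [hcard, mul_comm q, pow_mul]
    exact card_not_goodLevels_le T X hL
  have h2 := coinMeasure_forall_block_le (m := m) (off := off) bad h1
  -- Goodness depends only on the first `q * lam` coins, so the trials live on disjoint finite
  -- blocks.
  have hGL : ∀ y y' : ℕ → Bool, (∀ j < q * lam, y j = y' j) → GoodLevels T X q lam L K y →
      GoodLevels T X q lam L K y' := by
    intro y y' hy
    have hr : ∀ t ≤ lam, ∀ l < q, (Reach lam y t l ↔ Reach lam y' t l) := by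
      intro t ht l hl
      refine forall_congr' fun i => forall_congr' fun hi => ?_
      rw [hy]
      calc l * lam + i < l * lam + lam := by omega
        _ = (l + 1) * lam := by ring
        _ ≤ q * lam := Nat.mul_le_mul_right _ hl
    rintro ⟨ha, hb⟩
    refine ⟨fun u hu v hv t ht h => ha u hu v hv t ht
      (h.mono fun l hl => (hr t ht l hl).1), le_of_eq_of_le ?_ hb⟩
    unfold separation
    refine Finset.sum_congr rfl fun t ht => ?_
    have : ∀ l, (l < q ∧ Reach lam y' t l) ↔ (l < q ∧ Reach lam y t l) := fun l =>
      and_congr_right fun hl => (hr t (Nat.lt_succ_iff.1 (Finset.mem_range.1 ht)) l hl).symm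
    simp only [this]
  -- Covering the whole space and using subadditivity needs no measurability of `S`.
  have h3 : Set.univ ⊆ S ∪ {ω | ∀ k < m, (fun j : Fin (q * lam) =>
      ω (off + (k * (q * lam) + j))) ∈ bad} := by
    intro ω _
    by_cases h : ω ∈ S
    · exact Or.inl h
    · refine Or.inr fun k hk => ?_
      simp only [hbad, Finset.mem_filter, Finset.mem_univ, true_and]
      intro hg
      exact h (hS ω ⟨k, hk, hGL _ _ (fun j hj => by simp [hj]) hg⟩)
  have h4 : (1 : ℝ) ≤ coinMeasure.real S + coinMeasure.real {ω | ∀ k < m,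
      (fun j : Fin (q * lam) => ω (off + (k * (q * lam) + j))) ∈ bad} := by
    calc (1 : ℝ) = coinMeasure.real Set.univ := by simp
      _ ≤ _ := measureReal_mono h3
      _ ≤ _ := measureReal_union_le _ _
  linarith

/-! ## Refinement of a partition of the rows -/

/-- Row `v` is the first of its class. -/
def IsFirst (X : ℕ → ℕ → ℕ) (q : ℕ) (P : ℕ → Prop) (v : ℕ) : Prop := ∀ u < v, ¬ AgreeOn X q P u v

theorem IsFirst.mono {X : ℕ → ℕ → ℕ} {q v : ℕ} {P P' : ℕ → Prop} (h : IsFirst X q P v)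
    (hP : ∀ l, P l → P' l) : IsFirst X q P' v :=
  fun u hu h' => h u hu (h'.mono fun l _ => hP l)

theorem IsFirst.eq {X : ℕ → ℕ → ℕ} {q u v : ℕ} {P : ℕ → Prop} (hu : IsFirst X q P u)
    (hv : IsFirst X q P v) (h : AgreeOn X q P u v) : u = v := by
  rcases lt_trichotomy u v with h' | h' | h'
  · exact absurd h (hv u h')
  · exact h'
  · exact absurd h.symm (hu v h')

/-- The table entries of `v` are right for the partition given by `P`: the flag tells whether `v`
is the first of its class, and otherwise its parent is. -/
structure Node (X : ℕ → ℕ → ℕ) (q : ℕ) (P : ℕ → Prop) (par fr : ℕ → ℕ) (v : ℕ) : Prop where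
  flag : fr v ≠ 0 ↔ IsFirst X q P v
  lt : fr v = 0 → par v < v
  agree : fr v = 0 → AgreeOn X q P (par v) v
  first : fr v = 0 → IsFirst X q P (par v)

/-- The state of the refinement by column `l` after the first `i` rows. -/
structure Refining (X : ℕ → ℕ → ℕ) (q s n : ℕ) (P : ℕ → Prop) (l : ℕ) (par₀ : ℕ → ℕ) (i : ℕ)
    (par fr : ℕ → ℕ) (tab : ℕ → ℕ → ℕ) : Prop where
  done : ∀ v < i, v < n → Node X q (fun j => P j ∨ j = l) par fr v
  todo : ∀ v, i ≤ v → v < n → Node X q P par fr v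
  -- `tab x c` is the first row of the part of class `c` with entry `x` in column `l`. The part
  -- containing `c` itself is detected by comparison with `c` and needs no entry. Row `0` is
  -- therefore never stored, and `0` can mean that there is no such row yet.
  tab_zero : ∀ c < i, IsFirst X q P c → ∀ x < s, tab x c = 0 →
    ∀ w < i, AgreeOn X q P c w → X w l = x → X c l = x
  tab_agree : ∀ c < i, IsFirst X q P c → ∀ x < s, tab x c ≠ 0 → AgreeOn X q P c (tab x c)
  tab_lt : ∀ c < i, IsFirst X q P c → ∀ x < s, tab x c ≠ 0 → tab x c < i
  tab_col : ∀ c < i, IsFirst X q P c → ∀ x < s, tab x c ≠ 0 → X (tab x c) l = x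
  tab_first : ∀ c < i, IsFirst X q P c → ∀ x < s, tab x c ≠ 0 →
    IsFirst X q (fun j => P j ∨ j = l) (tab x c)
  -- This is what preserves the parents found at coarser levels: a parent changes only to a row that
  -- agrees on the refined column set.
  hist : ∀ v < n, par v = par₀ v ∨ AgreeOn X q (fun j => P j ∨ j = l) (par v) v
  par_lt : ∀ v < n, 0 < v → par v < v
  par_zero : par 0 = 0

theorem AgreeOn.insert {X : ℕ → ℕ → ℕ} {q u v l : ℕ} {P : ℕ → Prop} (h : AgreeOn X q P u v)
    (hl : X u l = X v l) : AgreeOn X q (fun j => P j ∨ j = l) u v := by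
  rintro j hj (h' | rfl)
  · exact h j hj h'
  · exact hl

theorem AgreeOn.of_insert {X : ℕ → ℕ → ℕ} {q u v l : ℕ} {P : ℕ → Prop}
    (h : AgreeOn X q (fun j => P j ∨ j = l) u v) : AgreeOn X q P u v :=
  h.mono fun _ _ => Or.inl

section
variable {X : ℕ → ℕ → ℕ} {q s n l i : ℕ} {P : ℕ → Prop} {par₀ par fr : ℕ → ℕ} {tab : ℕ → ℕ → ℕ}

theorem Refining.zero (h : ∀ v < n, Node X q P par fr v) (h1 : ∀ v < n, 0 < v → par v < v)
    (h0 : par 0 = 0) : Refining X q s n P l par 0 par fr tab where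
  done v hv := by omega
  todo v _ hv := h v hv
  tab_zero c hc := by omega
  tab_agree c hc := by omega
  tab_lt c hc := by omega
  tab_col c hc := by omega
  tab_first c hc := by omega
  hist v _ := Or.inl rfl
  par_lt := h1
  par_zero := h0

/-- A first row stays first under refinement. No earlier row belongs to its class, so its table
starts empty; resetting it here removes whatever an earlier refinement left behind. -/
theorem Refining.succ_of_first (h : Refining X q s n P l par₀ i par fr tab) (hi : i < n)
    (hf : fr i ≠ 0) {tab' : ℕ → ℕ → ℕ} (h0 : ∀ x < s, tab' x i = 0)
    (h1 : ∀ x < s, ∀ c ≠ i, tab' x c = tab x c) :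
    Refining X q s n P l par₀ (i + 1) par fr tab' := by
  have hF : IsFirst X q P i := (h.todo i le_rfl hi).flag.1 hf
  have hF' : IsFirst X q (fun j => P j ∨ j = l) i := hF.mono fun _ => Or.inl
  refine ⟨fun v hv hvn => ?_, fun v hv => h.todo v (by omega), fun c hc hcf x hx ht w hw ha hX => ?_,
    fun c hc hcf x hx ht => ?_, fun c hc hcf x hx ht => ?_, fun c hc hcf x hx ht => ?_,
    fun c hc hcf x hx ht => ?_, h.hist, h.par_lt, h.par_zero⟩
  · rcases Nat.lt_succ_iff_lt_or_eq.1 hv with hv' | rfl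
    · exact h.done v hv' hvn
    · exact ⟨iff_of_true hf hF', fun e => absurd e hf, fun e => absurd e hf, fun e => absurd e hf⟩
  · rcases Nat.lt_succ_iff_lt_or_eq.1 hw with hw' | rfl
    · rcases Nat.lt_succ_iff_lt_or_eq.1 hc with hc' | rfl
      · exact h.tab_zero c hc' hcf x hx (by rwa [h1 x hx c hc'.ne] at ht) w hw' ha hX
      · exact absurd ha.symm (hF w hw')
    · rw [hcf.eq hF ha]; exact hX
  all_goals
    by_cases hci : c = i
    · subst hci; exact absurd (h0 x hx) ht
    rw [h1 x hx c hci] at ht ⊢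
    have hc' : c < i := by omega
  · exact h.tab_agree c hc' hcf x hx ht
  · exact (h.tab_lt c hc' hcf x hx ht).trans (Nat.lt_succ_self _)
  · exact h.tab_col c hc' hcf x hx ht
  · exact h.tab_first c hc' hcf x hx ht

/-- The row stays in the part of its class representative, so nothing changes. -/
theorem Refining.succ_of_eq (h : Refining X q s n P l par₀ i par fr tab) (hi : i < n)
    (hf : fr i = 0) (hX : X (par i) l = X i l) :
    Refining X q s n P l par₀ (i + 1) par fr tab := by
  have hN := h.todo i le_rfl hi
  refine ⟨fun v hv hvn => ?_, fun v hv => h.todo v (by omega), fun c hc hcf x hx ht w hw ha hX => ?_,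
    fun c hc hcf x hx ht => ?_, fun c hc hcf x hx ht => ?_, fun c hc hcf x hx ht => ?_,
    fun c hc hcf x hx ht => ?_, h.hist, h.par_lt, h.par_zero⟩
  · rcases Nat.lt_succ_iff_lt_or_eq.1 hv with hv' | rfl
    · exact h.done v hv' hvn
    · exact ⟨iff_of_false (by simpa using hf) fun h' => h' _ (hN.lt hf) ((hN.agree hf).insert hX),
        hN.lt, fun _ => (hN.agree hf).insert hX, fun _ => (hN.first hf).mono fun _ => Or.inl⟩
  all_goals
    have hci : c ≠ i := by
      rintro rfl
      exact (hN.flag.2 hcf) hf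
    have hc' : c < i := by omega
  · rcases Nat.lt_succ_iff_lt_or_eq.1 hw with hw' | rfl
    · exact h.tab_zero c hc' hcf x hx ht w hw' ha hX
    · have := hcf.eq (hN.first hf) (ha.trans (hN.agree hf).symm)
      rw [this]; omega
  · exact h.tab_agree c hc' hcf x hx ht
  · exact (h.tab_lt c hc' hcf x hx ht).trans (Nat.lt_succ_self _)
  · exact h.tab_col c hc' hcf x hx ht
  · exact h.tab_first c hc' hcf x hx ht

theorem Node.congr {par' fr' : ℕ → ℕ} {v : ℕ} (h : Node X q P par fr v) (h1 : par' v = par v)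
    (h2 : fr' v = fr v) : Node X q P par' fr' v :=
  ⟨by rw [h2]; exact h.flag, by rw [h1, h2]; exact h.lt, by rw [h1, h2]; exact h.agree,
    by rw [h1, h2]; exact h.first⟩

/-- The row leaves the part of its representative for one that has been opened before, whose first
row becomes its parent. -/
theorem Refining.succ_of_tab (h : Refining X q s n P l par₀ i par fr tab) (hi : i < n)
    (hf : fr i = 0) (hs : X i l < s) (ht0 : tab (X i l) (par i) ≠ 0) {par' : ℕ → ℕ}
    (h0 : par' i = tab (X i l) (par i)) (h1 : ∀ v ≠ i, par' v = par v) :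
    Refining X q s n P l par₀ (i + 1) par' fr tab := by
  have hN := h.todo i le_rfl hi
  have e1 := hN.lt hf
  have e2 := hN.first hf
  have e3 := h.tab_lt _ e1 e2 _ hs ht0
  have e4 : AgreeOn X q (fun j => P j ∨ j = l) (par' i) i := by
    rw [h0]
    exact ((h.tab_agree _ e1 e2 _ hs ht0).symm.trans (hN.agree hf)).insert
      (h.tab_col _ e1 e2 _ hs ht0)
  refine ⟨fun v hv hvn => ?_, fun v hv hvn => (h.todo v (by omega) hvn).congr (h1 v (by omega)) rfl,
    fun c hc hcf x hx ht w hw ha hX => ?_,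
    fun c hc hcf x hx ht => ?_, fun c hc hcf x hx ht => ?_, fun c hc hcf x hx ht => ?_,
    fun c hc hcf x hx ht => ?_, fun v hv => ?_, fun v hv hv0 => ?_, ?_⟩
  · rcases Nat.lt_succ_iff_lt_or_eq.1 hv with hv' | rfl
    · exact (h.done v hv' hvn).congr (h1 v (by omega)) rfl
    · refine ⟨iff_of_false (by simpa using hf) fun h' => h' (par' v) (by omega) e4,
        fun _ => by omega, fun _ => e4, fun _ => ?_⟩
      rw [h0]; exact h.tab_first _ e1 e2 _ hs ht0
  rotate_left 5
  · by_cases hvi : v = i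
    · subst hvi; exact Or.inr e4
    · rw [h1 v hvi]; exact h.hist v hv
  · by_cases hvi : v = i
    · subst hvi; omega
    · rw [h1 v hvi]; exact h.par_lt v hv hv0
  · rw [h1 0 (by omega)]; exact h.par_zero
  all_goals
    have hci : c ≠ i := by
      rintro rfl
      exact (hN.flag.2 hcf) hf
    have hc' : c < i := by omega
  · rcases Nat.lt_succ_iff_lt_or_eq.1 hw with hw' | rfl
    · exact h.tab_zero c hc' hcf x hx ht w hw' ha hX
    · have := hcf.eq (hN.first hf) (ha.trans (hN.agree hf).symm)
      subst this; subst hX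
      exact absurd ht ht0
  · exact h.tab_agree c hc' hcf x hx ht
  · exact (h.tab_lt c hc' hcf x hx ht).trans (Nat.lt_succ_self _)
  · exact h.tab_col c hc' hcf x hx ht
  · exact h.tab_first c hc' hcf x hx ht

/-- The row opens a new part of its class. It becomes a first row but keeps its parent, which still
agrees with it on the coarser column set; this is where the tree edge of the row is fixed. -/
theorem Refining.succ_of_new (h : Refining X q s n P l par₀ i par fr tab) (hi : i < n)
    (hlq : l < q) (hf : fr i = 0) (hs : X i l < s) (hX : X (par i) l ≠ X i l)
    (ht0 : tab (X i l) (par i) = 0) {tab' : ℕ → ℕ → ℕ} {fr' : ℕ → ℕ}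
    (h0 : tab' (X i l) (par i) = i) (h1 : ∀ x c, ¬ (x = X i l ∧ c = par i) → tab' x c = tab x c)
    (h2 : fr' i ≠ 0) (h3 : ∀ v ≠ i, fr' v = fr v) :
    Refining X q s n P l par₀ (i + 1) par fr' tab' := by
  have hN := h.todo i le_rfl hi
  have e1 := hN.lt hf
  have e2 := hN.first hf
  have e4 : IsFirst X q (fun j => P j ∨ j = l) i := by
    intro w hw ha
    exact hX (h.tab_zero _ e1 e2 _ hs ht0 w hw ((hN.agree hf).trans ha.of_insert.symm)
      (ha l hlq (Or.inr rfl)))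
  refine ⟨fun v hv hvn => ?_, fun v hv hvn => (h.todo v (by omega) hvn).congr rfl (h3 v (by omega)),
    fun c hc hcf x hx ht w hw ha hwx => ?_,
    fun c hc hcf x hx ht => ?_, fun c hc hcf x hx ht => ?_, fun c hc hcf x hx ht => ?_,
    fun c hc hcf x hx ht => ?_, h.hist, h.par_lt, h.par_zero⟩
  · rcases Nat.lt_succ_iff_lt_or_eq.1 hv with hv' | rfl
    · exact (h.done v hv' hvn).congr rfl (h3 v (by omega))
    · exact ⟨iff_of_true h2 e4, fun e => absurd e h2, fun e => absurd e h2, fun e => absurd e h2⟩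
  all_goals
    have hci : c ≠ i := by
      rintro rfl
      exact (hN.flag.2 hcf) hf
    have hc' : c < i := by omega
  · rcases Nat.lt_succ_iff_lt_or_eq.1 hw with hw' | rfl
    · by_cases hxc : x = X i l ∧ c = par i
      · obtain ⟨rfl, rfl⟩ := hxc
        omega
      · exact h.tab_zero c hc' hcf x hx (by rwa [h1 x c hxc] at ht) w hw' ha hwx
    · have := hcf.eq (hN.first hf) (ha.trans (hN.agree hf).symm)
      subst this; subst hwx
      omega
  all_goals
    by_cases hxc : x = X i l ∧ c = par i
    · obtain ⟨rfl, rfl⟩ := hxc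
      first
        | (rw [h0]; done)
        | (rw [h0]; exact hN.agree hf)
        | (rw [h0]; exact Nat.lt_succ_self i)
        | (rw [h0]; exact e4)
    rw [h1 x c hxc] at ht ⊢
  · exact h.tab_agree c hc' hcf x hx ht
  · exact (h.tab_lt c hc' hcf x hx ht).trans (Nat.lt_succ_self _)
  · exact h.tab_col c hc' hcf x hx ht
  · exact h.tab_first c hc' hcf x hx ht

end

/-! ## The program: construction of a parent table -/

namespace ForLang

instance : Add Ex := ⟨.op .add⟩
instance : Sub Ex := ⟨.op .sub⟩
instance : Mul Ex := ⟨.op .mul⟩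

@[simp] theorem Ex.eval_add (σ : St) (e f : Ex) : (e + f).eval σ = e.eval σ + f.eval σ := rfl
@[simp] theorem Ex.eval_sub (σ : St) (e f : Ex) : (e - f).eval σ = e.eval σ - f.eval σ := rfl
@[simp] theorem Ex.eval_mul (σ : St) (e f : Ex) : (e * f).eval σ = e.eval σ * f.eval σ := rfl
@[simp] theorem Ex.eval_var (σ : St) (x : Fin 32) : (Ex.var x).eval σ = σ.v x := rfl
@[simp] theorem Ex.eval_lit (σ : St) (n : ℕ) : (Ex.lit n).eval σ = n := rfl
@[simp] theorem Ex.eval_raw (σ : St) (e : Ex) : (Ex.raw e).eval σ = σ.lo (e.eval σ) := rfl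
@[simp] theorem Ex.eval_arr (σ : St) (k e : Ex) :
    (Ex.arr k e).eval σ = σ.a (k.eval σ) (e.eval σ) := rfl

section
variable {b M : ℕ} {σ : St}
@[simp] theorem Ex.ok_add (e f : Ex) : (e + f).ok b M σ ↔ e.ok b M σ ∧ f.ok b M σ := Iff.rfl
@[simp] theorem Ex.ok_sub (e f : Ex) : (e - f).ok b M σ ↔ e.ok b M σ ∧ f.ok b M σ := Iff.rfl
@[simp] theorem Ex.ok_mul (e f : Ex) : (e * f).ok b M σ ↔ e.ok b M σ ∧ f.ok b M σ := Iff.rfl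
@[simp] theorem Ex.ok_var (x : Fin 32) : (Ex.var x).ok b M σ := trivial
@[simp] theorem Ex.ok_lit (n : ℕ) : (Ex.lit n).ok b M σ := trivial
@[simp] theorem Ex.ok_raw (e : Ex) : (Ex.raw e).ok b M σ ↔ e.ok b M σ ∧ e.eval σ < b := Iff.rfl
@[simp] theorem Ex.ok_arr (k e : Ex) :
    (Ex.arr k e).ok b M σ ↔ k.ok b M σ ∧ e.ok b M σ ∧ k.eval σ < M := Iff.rfl
end

/-- The truth value of `e ≠ f`. -/
def Ex.ne (e f : Ex) : Ex := .lit 1 - (.lit 1 - ((e - f) + (f - e)))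

@[simp] theorem Ex.eval_ne (σ : St) (e f : Ex) :
    (e.ne f).eval σ = if e.eval σ ≠ f.eval σ then 1 else 0 := by
  simp only [Ex.ne, eval_sub, eval_add, eval_lit]
  split_ifs <;> omega

@[simp] theorem Ex.ok_ne {b M : ℕ} {σ : St} (e f : Ex) :
    (e.ne f).ok b M σ ↔ e.ok b M σ ∧ f.ok b M σ := by
  simp only [Ex.ne, ok_sub, ok_add, ok_lit, true_and]; tauto

/-- The matrix that is stored in the low memory from `o` on with the given strides. -/
def mat (lo : ℕ → ℕ) (o s₁ s₂ : ℕ) (v l : ℕ) : ℕ := lo (o + (v * s₁ + l * s₂))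

/-- The matrix whose offset and strides are in the variables `7`, `8`, `9`. -/
def St.mat (σ : St) : ℕ → ℕ → ℕ := ForLang.mat σ.lo (σ.v 7) (σ.v 8) (σ.v 9)

/-- An entry of `St.mat`. -/
def Ex.row (v l : Ex) : Ex := .raw (.var 7 + (v * .var 8 + l * .var 9))

@[simp] theorem Ex.eval_row (σ : St) (v l : Ex) :
    (Ex.row v l).eval σ = σ.mat (v.eval σ) (l.eval σ) := rfl

@[simp] theorem Ex.ok_row {b M : ℕ} {σ : St} (v l : Ex) : (Ex.row v l).ok b M σ ↔
    (v.ok b M σ ∧ l.ok b M σ) ∧ σ.v 7 + (v.eval σ * σ.v 8 + l.eval σ * σ.v 9) < b := by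
  simp [Ex.row]

/-! ### Frame conditions, and refinement by one column as a program -/

/-- Only variables from `k` on and arrays in `A` have changed. -/
structure Frame (k : ℕ) (A : ℕ → Prop) (σ τ : St) : Prop where
  v : ∀ x : Fin 32, (x : ℕ) < k → τ.v x = σ.v x
  lo : τ.lo = σ.lo
  a : ∀ j, ¬ A j → τ.a j = σ.a j

section
variable {k k' : ℕ} {A A' : ℕ → Prop} {σ τ ρ : St}

theorem Frame.refl (k : ℕ) (A : ℕ → Prop) (σ : St) : Frame k A σ σ :=
  ⟨fun _ _ => rfl, rfl, fun _ _ => rfl⟩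

theorem Frame.trans (h : Frame k A σ τ) (h' : Frame k A τ ρ) : Frame k A σ ρ :=
  ⟨fun x hx => (h'.v x hx).trans (h.v x hx), h'.lo.trans h.lo,
    fun j hj => (h'.a j hj).trans (h.a j hj)⟩

theorem Frame.mono (h : Frame k A σ τ) (hk : k' ≤ k) (hA : ∀ j, A j → A' j) : Frame k' A' σ τ :=
  ⟨fun x hx => h.v x (hx.trans_le hk), h.lo, fun j hj => h.a j fun h' => hj (hA j h')⟩

theorem Frame.tick (h : Frame k A σ τ) : Frame k A σ τ.tick := ⟨h.v, h.lo, h.a⟩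

theorem Frame.set (h : Frame k A σ τ) {x : Fin 32} (hx : k ≤ x) (n : ℕ) :
    Frame k A σ (τ.set x n) := by
  refine ⟨fun y hy => ?_, h.lo, h.a⟩
  rw [St.set_v, Function.update_of_ne (by rintro rfl; omega), h.v y hy]

theorem Frame.put (h : Frame k A σ τ) {j : ℕ} (hj : A j) (i n : ℕ) :
    Frame k A σ (τ.put j i n) := by
  refine ⟨h.v, h.lo, fun j' hj' => ?_⟩
  rw [St.put_a, Function.update_of_ne (by rintro rfl; exact hj' hj), h.a j' hj']

theorem Frame.mat (h : Frame k A σ τ) (hk : 10 ≤ k) : τ.mat = σ.mat := by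
  unfold St.mat
  rw [h.lo, h.v 7 (by simp; omega), h.v 8 (by simp; omega), h.v 9 (by simp; omega)]

end

/-- The rows of `St.mat` are stored in the low memory; their number is in the variable `6`, their
length in the variable `1`, and their entries are less than `s`. -/
structure HasRows (b s : ℕ) (σ : St) : Prop where
  lt : ∀ v < σ.v 6, ∀ l < σ.v 1, σ.v 7 + (v * σ.v 8 + l * σ.v 9) < b
  entry : ∀ v < σ.v 6, ∀ l < σ.v 1, σ.mat v l < s

theorem HasRows.frame {b s k : ℕ} {A : ℕ → Prop} {σ τ : St} (h : HasRows b s σ)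
    (hF : Frame k A σ τ) (hk : 10 ≤ k) : HasRows b s τ := by
  constructor
  · rw [hF.v 6 (by simp; omega), hF.v 1 (by simp; omega), hF.v 7 (by simp; omega),
      hF.v 8 (by simp; omega), hF.v 9 (by simp; omega)]
    exact h.lt
  · rw [hF.v 6 (by simp; omega), hF.v 1 (by simp; omega), hF.mat hk]
    exact h.entry

/-- Refine the partition by the column whose index is in the variable `19`. The parents are in
array `1`, the flags in array `2`, the tables from array `8` on. -/
def refineStm (s : ℕ) : Stm :=
  .loop 21 (.var 6) (.ite (.arr (.lit 2) (.var 21))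
    (.loop 22 (.lit s) (.put (.lit 8 + .var 22) (.var 21) (.lit 0)))
    (.seq (.assign 27 (.arr (.lit 1) (.var 21))) (.seq (.assign 28 (.row (.var 21) (.var 19)))
      (.ite (.ne (.row (.var 27) (.var 19)) (.var 28))
        (.seq (.assign 26 (.arr (.lit 8 + .var 28) (.var 27)))
          (.ite (.var 26) (.put (.lit 1) (.var 21) (.var 26))
            (.seq (.put (.lit 8 + .var 28) (.var 27) (.var 21))
              (.put (.lit 2) (.var 21) (.lit 1)))))
        .skip))))

section
variable {ω : ℕ → Bool} {b s B : ℕ}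

/-- Each row falls under one of the four cases of `Refining`. The step count per row is dominated by
the `s` table entries that are cleared for a first row; since the alphabet is constant, refining by
a column is linear in the number of rows. -/
theorem refineStm_wp {σ : St} {Q : St → Prop} {P : ℕ → Prop} (hB : 1 ≤ B) (hs : s ≤ B)
    (hM : HasRows b s σ) (hl : σ.v 19 < σ.v 1)
    (hN : ∀ v < σ.v 6, Node σ.mat (σ.v 1) P (σ.a 1) (σ.a 2) v)
    (hlt : ∀ v < σ.v 6, 0 < v → σ.a 1 v < v) (h0 : σ.a 1 0 = 0)
    (hQ : ∀ τ, Frame 21 (fun j => j = 1 ∨ j = 2 ∨ 8 ≤ j) σ τ → τ.coins = σ.coins →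
      (∀ v < σ.v 6, Node σ.mat (σ.v 1) (fun j => P j ∨ j = σ.v 19) (τ.a 1) (τ.a 2) v) →
      (∀ v < σ.v 6, 0 < v → τ.a 1 v < v) → τ.a 1 0 = 0 →
      (∀ v < σ.v 6, τ.a 1 v = σ.a 1 v ∨
        AgreeOn σ.mat (σ.v 1) (fun j => P j ∨ j = σ.v 19) (τ.a 1 v) v) →
      τ.clk ≤ σ.clk + 1 + σ.v 6 * (2 * s + 8) → Q τ) :
    (refineStm s).wp ω b (s + 8) B Q σ := by
  refine Stm.wp_loop (fun i τ => Frame 21 (fun j => j = 1 ∨ j = 2 ∨ 8 ≤ j) σ τ ∧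
    τ.coins = σ.coins ∧
    Refining σ.mat (σ.v 1) s (σ.v 6) P (σ.v 19) (σ.a 1) i (τ.a 1) (τ.a 2) (fun x => τ.a (8 + x)) ∧
    τ.clk ≤ σ.clk + 1 + i * (2 * s + 8)) (σ.v 6) rfl (by simp) (fun h => h.v 6) ?_ ?_ ?_
  · exact ⟨(Frame.refl _ _ _).tick, rfl, Refining.zero hN hlt h0, by simp⟩
  · rintro i hi τ ⟨hF, hc, hR, hk⟩
    have v19 : τ.v 19 = σ.v 19 := hF.v 19 (by decide)
    have v6 : τ.v 6 = σ.v 6 := hF.v 6 (by decide)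
    have v1 : τ.v 1 = σ.v 1 := hF.v 1 (by decide)
    have v7 : τ.v 7 = σ.v 7 := hF.v 7 (by decide)
    have v8 : τ.v 8 = σ.v 8 := hF.v 8 (by decide)
    have v9 : τ.v 9 = σ.v 9 := hF.v 9 (by decide)
    have hF₁ : Frame 21 (fun j => j = 1 ∨ j = 2 ∨ 8 ≤ j) σ (τ.set 21 i).tick :=
      (hF.set (by decide) _).tick
    refine ⟨by simp, fun hf => ?_, fun hf => ?_⟩
    · simp at hf
      refine Stm.wp_loop (fun x ρ => Frame 21 (fun j => j = 1 ∨ j = 2 ∨ 8 ≤ j) σ ρ ∧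
        ρ.coins = σ.coins ∧ ρ.v 21 = i ∧ ρ.a 1 = τ.a 1 ∧ ρ.a 2 = τ.a 2 ∧
        (∀ x' < x, ρ.a (8 + x') i = 0) ∧ (∀ x' < s, ∀ c ≠ i, ρ.a (8 + x') c = τ.a (8 + x') c) ∧
        ρ.clk ≤ τ.clk + 3 + 2 * x) s rfl (by simp) (fun _ => hs) ?_ ?_ ?_
      · exact ⟨hF₁.tick.tick, hc, by simp, rfl, rfl, fun x' hx' => by omega, fun _ _ _ _ => rfl, by simp⟩
      · rintro x hx ρ ⟨gF, gc, g21, g1, g2, g0, g3, gk⟩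
        refine ⟨by simp, by simp, by simp, by simp; omega, fun _ => Nat.zero_le _, ?_⟩
        refine ⟨(((gF.set (by decide) _).tick).put (by simp) _ _).tick, gc, by simp [g21],
          ?_, ?_, fun x' hx' => ?_, fun x' hx' c hc' => ?_, by simp; omega⟩
        · simp [g1, Function.update_of_ne (show 1 ≠ 8 + x by omega)]
        · simp [g2, Function.update_of_ne (show 2 ≠ 8 + x by omega)]
        · by_cases e : x' = x
          · subst e; simp [g21]
          · simp [Function.update_of_ne (show 8 + x' ≠ 8 + x by omega), g0 x' (by omega)]
        · by_cases e : x' = x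
          · subst e; simp [g21, Function.update_of_ne hc', g3 x' hx' c hc']
          · simp [Function.update_of_ne (show 8 + x' ≠ 8 + x by omega), g3 x' hx' c hc']
      · rintro ρ ⟨gF, gc, g21, g1, g2, g0, g3, gk⟩
        refine ⟨gF, gc, ?_, by linarith⟩
        rw [g1, g2]
        exact hR.succ_of_first hi hf g0 g3
    · simp at hf
      have hnode := hR.todo i le_rfl hi
      have hpi := hnode.lt hf
      have hsi := hM.entry i hi _ hl
      have b1 := hM.lt i hi _ hl
      have b2 := hM.lt (τ.a 1 i) (hpi.trans hi) _ hl
      refine ⟨by simp, fun h => h.a _ _, by simpa [v7, v8, v9, v19] using b1, fun h => h.lo _, ?_⟩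
      have hF₂ := (((hF₁.tick.set (x := 27) (by decide)
        ((Ex.arr (.lit 1) (.var 21)).eval (τ.set 21 i).tick.tick)).tick).set (x := 28) (by decide)
        ((Ex.row (.var 21) (.var 19)).eval (((τ.set 21 i).tick.tick.set 27
        ((Ex.arr (.lit 1) (.var 21)).eval (τ.set 21 i).tick.tick)).tick))).tick
      set τ₂ := (St.set (St.tick (St.set (τ.set 21 i).tick.tick 27 _)) 28 _).tick with hτ₂
      have w21 : τ₂.v 21 = i := by simp [hτ₂]
      have w27 : τ₂.v 27 = τ.a 1 i := by simp [hτ₂]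
      have w28 : τ₂.v 28 = σ.mat i (σ.v 19) := by
        simp only [hτ₂, St.tick_v, St.set_v, Function.update_self, Ex.eval_row, Ex.eval_var]
        rw [Frame.mat (k := 21) (A := fun j => j = 1 ∨ j = 2 ∨ 8 ≤ j) (σ := σ) _ (by norm_num)]
        · simp [v19]
        · exact ((hF₁.tick.set (by decide) _).tick)
      have w19 : τ₂.v 19 = σ.v 19 := hF₂.v 19 (by decide)
      have w7 : τ₂.v 7 = σ.v 7 := hF₂.v 7 (by decide)
      have w8 : τ₂.v 8 = σ.v 8 := hF₂.v 8 (by decide)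
      have w9 : τ₂.v 9 = σ.v 9 := hF₂.v 9 (by decide)
      have wm : τ₂.mat = σ.mat := hF₂.mat (by norm_num)
      have wc : τ₂.coins = σ.coins := hc
      have wa : τ₂.a = τ.a := rfl
      have wk : τ₂.clk = τ.clk + 4 := rfl
      clear_value τ₂
      -- Matrix entries are below `s`, so the `s` tables after the eight reserved arrays suffice.
      have hsm : 8 + σ.mat i (σ.v 19) < s + 8 := by omega
      refine ⟨by simpa [w7, w8, w9, w19, w27] using b2, fun hne => ?_, fun heq => ?_⟩
      · simp [wm, w27, w28, w19] at hne
        refine ⟨by simpa [w28] using hsm, fun h => h.a _ _, by simp, fun hu => ?_, fun hu => ?_⟩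
        · simp [w28, wa, w27] at hu
          refine ⟨by simp, by simp, by simp, by simp, fun h => h.v _, ?_⟩
          refine ⟨((hF₂.tick.set (by decide) _).tick.tick.put (by simp) _ _).tick, by simpa using wc,
            ?_, by simp [wk]; linarith⟩
          have := hR.succ_of_tab hi hf hsi hu
            (par' := Function.update (τ.a 1) i (τ.a (8 + σ.mat i (σ.v 19)) (τ.a 1 i)))
            (by simp) (fun v hv => by simp [hv])
          have z3 : ∀ x, 8 + x ≠ 1 := by omega
          simpa [w21, w28, w27, wa, Function.update_of_ne (z3 _)] using this
        · simp [w28, wa, w27] at hu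
          refine ⟨by simp, by simp, by simp, by simpa [w28] using hsm, fun h => h.v _, by simp, by simp, by simp,
            by simp, fun _ => hB, ?_⟩
          refine ⟨((((hF₂.tick.set (by decide) _).tick.tick.put (by simp) _ _).tick).put (by simp)
            _ _).tick, by simpa using wc, ?_, by simp [wk]; linarith⟩
          have := hR.succ_of_new hi hl hf hsi hne hu
            (tab' := fun x => Function.update τ.a (8 + σ.mat i (σ.v 19))
              (Function.update (τ.a (8 + σ.mat i (σ.v 19))) (τ.a 1 i) i) (8 + x))
            (fr' := Function.update (τ.a 2) i 1)
            (by simp) (fun x c hxc => by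
              by_cases hx : x = σ.mat i (σ.v 19)
              · subst hx
                simp [Function.update_of_ne (fun h => hxc ⟨rfl, h⟩)]
              · rw [Function.update_of_ne (by omega)]) (by simp) (fun v hv => by simp [hv])
          have z2 : 2 ≠ 8 + σ.mat i (σ.v 19) := by omega
          have z1 : 1 ≠ 8 + σ.mat i (σ.v 19) := by omega
          have z3 : ∀ x, 8 + x ≠ 2 := by omega
          simpa [w21, w28, w27, wa, Function.update_of_ne z2, Function.update_of_ne z1,
            Function.update_of_ne (z3 _)] using this
      · simp [wm, w27, w28, w19] at heq
        refine ⟨hF₂.tick.tick, by simpa using wc, ?_, by simp [wk]; linarith⟩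
        simpa [wa] using hR.succ_of_eq hi hf heq
  · rintro τ ⟨hF, hc, hR, hk⟩
    exact hQ τ hF hc (fun v hv => hR.done v hv hv) hR.par_lt hR.par_zero hR.hist hk

end

section
variable {ω : ℕ → Bool} {b s B : ℕ}

/-! ### Random levels and the sweep from the highest level down -/

/-- Toss coins for the levels of the columns, and write the levels into array `0`. -/
def levelStm : Stm :=
  .loop 19 (.var 1) (.seq (.assign 23 (.lit 1)) (.seq (.assign 24 (.lit 0))
    (.seq (.loop 20 (.var 4) (.seq (.flip 28) (.seq (.assign 23 (.var 23 * .var 28))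
      (.assign 24 (.var 24 + .var 23))))) (.put (.lit 0) (.var 19) (.var 24)))))

/-- All `lam` coins are tossed for every column, even after a tail, so that coin `i` of column `l`
has the fixed position `l * lam + i`. -/
theorem levelStm_wp {σ : St} {Q : St → Prop} (hB : 1 ≤ B)
    (hQ : ∀ τ, Frame 19 (· = 0) σ τ → τ.coins = σ.coins + σ.v 1 * σ.v 4 →
      (∀ l < σ.v 1, τ.a 0 l ≤ σ.v 4 ∧ ∀ t ≤ σ.v 4,
        t ≤ τ.a 0 l ↔ Reach (σ.v 4) (fun j => ω (σ.coins + j)) t l) →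
      τ.clk ≤ σ.clk + 1 + σ.v 1 * (4 * σ.v 4 + 5) → Q τ) :
    levelStm.wp ω b (s + 8) B Q σ := by
  set y : ℕ → Bool := fun j => ω (σ.coins + j) with hy
  refine Stm.wp_loop (fun i τ => Frame 19 (· = 0) σ τ ∧ τ.coins = σ.coins + i * σ.v 4 ∧
    (∀ l < i, τ.a 0 l ≤ σ.v 4 ∧ ∀ t ≤ σ.v 4, t ≤ τ.a 0 l ↔ Reach (σ.v 4) y t l) ∧
    τ.clk ≤ σ.clk + 1 + i * (4 * σ.v 4 + 5)) (σ.v 1) rfl (by simp) (fun h => h.v 1) ?_ ?_ ?_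
  · exact ⟨(Frame.refl _ _ _).tick, by simp, fun l hl => by omega, by simp⟩
  · rintro i hi τ ⟨hF, hc, hL, hk⟩
    have hF₁ : Frame 19 (· = 0) σ (((τ.set 19 i).tick.set 23 1).tick.set 24 0).tick :=
      ((((hF.set (by decide) _).tick).set (by decide) _).tick.set (by decide) _).tick
    refine ⟨by simp, fun _ => hB, by simp, fun _ => Nat.zero_le _, ?_⟩
    simp only [Ex.eval_lit]
    refine Stm.wp_loop (fun t ρ => Frame 19 (· = 0) σ ρ ∧ ρ.a = τ.a ∧ ρ.v 19 = i ∧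
      ρ.coins = σ.coins + (i * σ.v 4 + t) ∧
      (ρ.v 23 = if ∀ t' < t, y (i * σ.v 4 + t') = true then 1 else 0) ∧
      (ρ.v 24 ≤ t ∧ ∀ t' ≤ t, t' ≤ ρ.v 24 ↔ Reach (σ.v 4) y t' i) ∧
      ρ.clk ≤ τ.clk + 4 + 4 * t) (σ.v 4) ?_ (by simp) (fun h => ?_) ?_ ?_ ?_
    · simpa using hF.v 4 (by decide)
    · rw [← hF₁.v 4 (by decide)]; exact h.v 4
    · refine ⟨hF₁.tick, rfl, by simp, by simpa using hc, by simp, ⟨by simp, ?_⟩, by simp⟩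
      intro t' ht'
      obtain rfl : t' = 0 := by omega
      simp [Reach]
    · rintro t ht ρ ⟨gF, ga, g19, gc, g23, ⟨g24, gL⟩, gk⟩
      have hyt : ω ρ.coins = y (i * σ.v 4 + t) := by rw [gc, hy]
      -- Variable `23` is the running product of the coins: it is `1` exactly as long as only heads
      -- have come up, and adding it to variable `24` counts the leading heads.
      have e23 : ρ.v 23 * (ω ρ.coins).toNat =
          if ∀ t' < t + 1, y (i * σ.v 4 + t') = true then 1 else 0 := by
        rw [g23, hyt]
        by_cases h1 : ∀ t' < t + 1, y (i * σ.v 4 + t') = true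
        · rw [if_pos h1, if_pos fun t' h' => h1 t' (by omega), h1 t (by omega)]; rfl
        · rw [if_neg h1]
          by_cases h2 : ∀ t' < t, y (i * σ.v 4 + t') = true
          · have : y (i * σ.v 4 + t) = false := by
              by_contra h3
              refine h1 fun t' ht' => ?_
              rcases Nat.lt_succ_iff_lt_or_eq.1 ht' with h4 | rfl
              · exact h2 t' h4
              · simpa using h3
            rw [this]; simp
          · rw [if_neg h2, zero_mul]
      have le1 : ρ.v 23 * (ω ρ.coins).toNat ≤ 1 := by rw [e23]; split_ifs <;> omega
      refine ⟨by simp, fun _ => ?_, by simp, fun h => ?_, ?_⟩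
      · simpa using le1.trans hB
      · have := h.v 4
        have h4 := gF.v 4 (by decide)
        simp at this ⊢
        omega
      · refine ⟨?_, by simpa using ga, by simpa using g19, ?_, ?_, ⟨?_, fun t' ht' => ?_⟩, ?_⟩
        · have := gF.tick.set (x := 28) (by decide) (ω ρ.coins).toNat
          constructor
          · intro x hx
            have h28 : x ≠ 28 := by rintro rfl; revert hx; decide
            have h23 : x ≠ 23 := by rintro rfl; revert hx; decide
            have h24 : x ≠ 24 := by rintro rfl; revert hx; decide
            have h20 : x ≠ 20 := by rintro rfl; revert hx; decide
            simp [h28, h23, h24, h20, gF.v x hx]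
          · exact gF.lo
          · exact gF.a
        · simp [gc]; ring
        · simpa using e23
        · simp; omega
        · simp only [St.tick_v, St.set_v, Ex.eval_add, Ex.eval_mul, Ex.eval_var]
          simp
          by_cases h1 : ∀ t' < t + 1, y (i * σ.v 4 + t') = true
          · rw [e23, if_pos h1]
            have : t ≤ ρ.v 24 := (gL t le_rfl).2 fun t' h' => h1 t' (by omega)
            exact iff_of_true (by omega) fun t'' h' => h1 t'' (by omega)
          · rw [e23, if_neg h1, add_zero]
            rcases ht'.eq_or_lt with rfl | h'
            · exact iff_of_false (by omega) h1
            · exact gL t' (by omega)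
        · simp; omega
    · rintro ρ ⟨gF, ga, g19, gc, g23, ⟨g24, gL⟩, gk⟩
      refine ⟨by simp, by simp, by simp, by simp, fun h => h.v _, ?_⟩
      refine ⟨(gF.put rfl _ _).tick, ?_, fun l hl => ?_, ?_⟩
      · simp [gc]; ring
      · by_cases hli : l = i
        · subst hli; simpa [g19] using ⟨g24, gL⟩
        · simpa [g19, hli, ga] using hL l (by omega)
      · simp; linarith
  · rintro τ ⟨hF, hc, hL, hk⟩
    exact hQ τ hF hc hL hk

/-- The trivial table: every row but row `0` has the parent `0`. -/
def initStm : Stm :=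
  .seq (.loop 21 (.var 6) (.seq (.put (.lit 1) (.var 21) (.lit 0))
    (.put (.lit 2) (.var 21) (.lit 0)))) (.put (.lit 2) (.lit 0) (.lit 1))

theorem initStm_wp {σ : St} {Q : St → Prop} (hB : 1 ≤ B)
    (hQ : ∀ τ, Frame 21 (fun j => j = 1 ∨ j = 2) σ τ → τ.coins = σ.coins →
      (∀ v < σ.v 6, τ.a 1 v = 0) → (∀ v < σ.v 6, τ.a 2 v ≠ 0 ↔ v = 0) →
      τ.clk ≤ σ.clk + 2 + σ.v 6 * 3 → Q τ) :
    initStm.wp ω b (s + 8) B Q σ := by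
  refine Stm.wp_loop (fun i τ => Frame 21 (fun j => j = 1 ∨ j = 2) σ τ ∧ τ.coins = σ.coins ∧
    (∀ v < i, τ.a 1 v = 0) ∧ (∀ v < i, τ.a 2 v = 0) ∧ τ.clk ≤ σ.clk + 1 + i * 3) (σ.v 6) rfl
    (by simp) (fun h => h.v 6) ?_ ?_ ?_
  · exact ⟨(Frame.refl _ _ _).tick, rfl, fun v hv => by omega, fun v hv => by omega, by simp⟩
  · rintro i hi τ ⟨hF, hc, h1, h2, hk⟩
    refine ⟨by simp, by simp, by simp, by simp, fun _ => Nat.zero_le _, by simp, by simp, by simp,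
      by simp, fun _ => Nat.zero_le _, ?_⟩
    refine ⟨((((hF.set (by decide) _).tick.put (by simp) _ _).tick).put (by simp) _ _).tick, hc,
      fun v hv => ?_, fun v hv => ?_, by simp; omega⟩
    · by_cases hvi : v = i
      · subst hvi; simp
      · simpa [hvi] using h1 v (by omega)
    · by_cases hvi : v = i
      · subst hvi; simp
      · simpa [hvi] using h2 v (by omega)
  · rintro τ ⟨hF, hc, h1, h2, hk⟩
    refine ⟨by simp, by simp, by simp, by simp, fun _ => hB, ?_⟩
    refine hQ _ (hF.put (by simp) _ _).tick hc (fun v hv => by simpa using h1 v hv)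
      (fun v hv => ?_) (by simp; omega)
    by_cases hv0 : v = 0
    · subst hv0; simp
    · simpa [hv0] using h2 v hv

theorem agreeOn_congr {X : ℕ → ℕ → ℕ} {q u v : ℕ} {P P' : ℕ → Prop} (h : ∀ l < q, P l ↔ P' l) :
    AgreeOn X q P u v ↔ AgreeOn X q P' u v :=
  ⟨fun h' => h'.mono fun l hl => (h l hl).2, fun h' => h'.mono fun l hl => (h l hl).1⟩

theorem isFirst_congr {X : ℕ → ℕ → ℕ} {q v : ℕ} {P P' : ℕ → Prop} (h : ∀ l < q, P l ↔ P' l) :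
    IsFirst X q P v ↔ IsFirst X q P' v := by
  simp only [IsFirst, agreeOn_congr h]

theorem node_congr {X : ℕ → ℕ → ℕ} {q v : ℕ} {P P' : ℕ → Prop} {par fr : ℕ → ℕ}
    (h : ∀ l < q, P l ↔ P' l) (hN : Node X q P par fr v) : Node X q P' par fr v :=
  ⟨hN.flag.trans (isFirst_congr h), hN.lt, fun h' => (agreeOn_congr h).1 (hN.agree h'),
    fun h' => (isFirst_congr h).1 (hN.first h')⟩

/-- Refine by all columns, in the order of decreasing levels. -/
def sweepStm (s : ℕ) : Stm :=
  .loop 20 (.var 4 + .lit 1) (.loop 19 (.var 1)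
    (.ite (.arr (.lit 0) (.var 19) + .lit 1 + .var 20 - .var 4) (refineStm s) .skip))

/-- After all columns of level at least `t` have been used, a row with an earlier agreeing row is
not first, so its parent is the first row of its class. Later refinements keep this agreement,
because they either keep the parent or choose one that agrees on even more columns. -/
theorem sweepStm_wp {σ : St} {Q : St → Prop} (hB : 1 ≤ B) (hs : s ≤ B) (hlam : σ.v 4 + 1 ≤ B)
    (hM : HasRows b s σ) (hlev : ∀ l < σ.v 1, σ.a 0 l ≤ σ.v 4)
    (h1 : ∀ v < σ.v 6, σ.a 1 v = 0) (h2 : ∀ v < σ.v 6, σ.a 2 v ≠ 0 ↔ v = 0) (hn : 0 < σ.v 6)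
    (hQ : ∀ τ, Frame 19 (fun j => j = 1 ∨ j = 2 ∨ 8 ≤ j) σ τ → τ.coins = σ.coins →
      (∀ v < σ.v 6, 0 < v → τ.a 1 v < v) → τ.a 1 0 = 0 →
      (∀ v < σ.v 6, ∀ t ≤ σ.v 4, (∃ u < v, AgreeOn σ.mat (σ.v 1) (fun l => t ≤ σ.a 0 l) u v) →
        AgreeOn σ.mat (σ.v 1) (fun l => t ≤ σ.a 0 l) (τ.a 1 v) v) →
      τ.clk ≤ σ.clk + 1 + (σ.v 4 + 1) * (2 + σ.v 1 * (3 + σ.v 6 * (2 * s + 8))) → Q τ) :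
    (sweepStm s).wp ω b (s + 8) B Q σ := by
  set X := σ.mat with hX
  set q := σ.v 1 with hq
  set n := σ.v 6 with hn'
  set lam := σ.v 4 with hlam'
  -- `P i` consists of the columns of level at least `lam + 1 - i`, those used in the first `i`
  -- phases. `P 0` is empty, so the trivial table with the single class of row `0` fits.
  set P : ℕ → ℕ → Prop := fun i l => lam + 1 ≤ σ.a 0 l + i with hP
  set A : ℕ → Prop := fun j => j = 1 ∨ j = 2 ∨ 8 ≤ j with hA
  set J : ℕ → (ℕ → ℕ) → Prop := fun i par => ∀ v < n, ∀ i' ≤ i,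
    (∃ u < v, AgreeOn X q (P i') u v) → AgreeOn X q (P i') (par v) v with hJ
  have hP0 : ∀ u v, AgreeOn X q (P 0) u v := by
    intro u v l hl h
    have := hlev l hl
    simp only [hP] at h
    omega
  refine Stm.wp_loop (fun i τ => Frame 19 A σ τ ∧ τ.coins = σ.coins ∧
    (∀ v < n, Node X q (P i) (τ.a 1) (τ.a 2) v) ∧ (∀ v < n, 0 < v → τ.a 1 v < v) ∧ τ.a 1 0 = 0 ∧
    J i (τ.a 1) ∧ τ.clk ≤ σ.clk + 1 + i * (2 + q * (3 + n * (2 * s + 8)))) (lam + 1) rfl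
    (by simp) (fun _ => hlam) ?_ ?_ ?_
  · refine ⟨(Frame.refl _ _ _).tick, rfl, fun v hv => ?_, fun v hv h => ?_, h1 0 hn,
      fun v hv i' hi' _ => ?_, by simp⟩
    · have hf0 : IsFirst X q (P 0) 0 := fun u hu => by omega
      by_cases hv0 : v = 0
      · subst hv0
        have : σ.a 2 0 ≠ 0 := (h2 0 hv).2 rfl
        exact ⟨iff_of_true this hf0, fun e => absurd e this, fun e => absurd e this,
          fun e => absurd e this⟩
      · have : σ.a 2 v = 0 := by by_contra h; exact hv0 ((h2 v hv).1 h)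
        refine ⟨iff_of_false (by simpa using this) fun h => h 0 (by omega) (hP0 _ _), fun _ => ?_,
          fun _ => hP0 _ _, fun _ => ?_⟩
        · simp only [St.tick_a, h1 v hv]; omega
        · simp only [St.tick_a, h1 v hv]; exact hf0
    · simp only [St.tick_a, h1 v hv]; omega
    · obtain rfl : i' = 0 := by omega
      exact hP0 _ _
  · rintro i hi τ ⟨hF, hc, hN, hlt, h0, hJi, hk⟩
    -- Within a phase the columns of `P i` are processed again; this is harmless, because refining
    -- by a used column changes no class.
    set P' : ℕ → ℕ → Prop := fun j l => P i l ∨ (P (i + 1) l ∧ l < j) with hP'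
    refine Stm.wp_loop (fun j ρ => Frame 19 A σ ρ ∧ ρ.coins = σ.coins ∧ ρ.v 20 = i ∧
      (∀ v < n, Node X q (P' j) (ρ.a 1) (ρ.a 2) v) ∧ (∀ v < n, 0 < v → ρ.a 1 v < v) ∧
      ρ.a 1 0 = 0 ∧ J i (ρ.a 1) ∧ ρ.clk ≤ τ.clk + 2 + j * (3 + n * (2 * s + 8))) q
      (hF.v 1 (by decide)) (by simp) (fun h => ?_) ?_ ?_ ?_
    · rw [hq, ← hF.v 1 (by decide)]; exact h.v 1
    · refine ⟨(hF.set (by decide) _).tick.tick, hc, by simp, fun v hv => ?_, hlt, h0, hJi, by simp⟩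
      exact node_congr (fun l _ => by simp [hP']) (hN v hv)
    · rintro j hj ρ ⟨gF, gc, g20, gN, glt, g0, gJ, gk⟩
      have a0 : ρ.a 0 = σ.a 0 := gF.a 0 (by simp [hA])
      have v4 : ρ.v 4 = lam := gF.v 4 (by decide)
      have gF' : Frame 19 A σ ((ρ.set 19 j).tick.tick) := (gF.set (by decide) _).tick.tick
      -- The truncated difference is nonzero exactly if column `j` has level at least `lam - i`,
      -- that is, if it lies in `P (i + 1)`.
      have hev : (Ex.arr (.lit 0) (.var 19) + .lit 1 + .var 20 - .var 4).eval (ρ.set 19 j).tick =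
          σ.a 0 j + 1 + i - lam := by simp [a0, g20, v4]
      refine ⟨by simp, fun hne => ?_, fun heq => ?_⟩
      · rw [hev] at hne
        have hPj : P (i + 1) j := by simp only [hP]; omega
        have k1 : ((ρ.set 19 j).tick.tick).v 1 = q := gF'.v 1 (by decide)
        have k6 : ((ρ.set 19 j).tick.tick).v 6 = n := gF'.v 6 (by decide)
        have km : ((ρ.set 19 j).tick.tick).mat = X := gF'.mat (by norm_num)
        have k19 : ((ρ.set 19 j).tick.tick).v 19 = j := by simp
        refine refineStm_wp (P := P' j) hB hs (hM.frame gF' (by norm_num)) (by rw [k1, k19]; exact hj)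
          (by rw [k1, k6, km]; exact gN) (by rw [k6]; exact glt) g0 ?_
        rw [k1, k6, km, k19]
        intro τ' fF fc fN flt f0 fhist fk
        refine ⟨gF'.trans (fF.mono (by norm_num) fun _ h => h), fc.trans gc, ?_, fun v hv => ?_, flt, f0,
          fun v hv i' hi' hu => ?_, ?_⟩
        · rw [fF.v 20 (by decide)]; simpa using g20
        · refine node_congr (fun l _ => ?_) (fN v hv)
          simp only [hP']
          constructor
          · rintro ((h | h) | rfl)
            · exact Or.inl h
            · exact Or.inr ⟨h.1, by omega⟩
            · exact Or.inr ⟨hPj, by omega⟩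
          · rintro (h | ⟨h, hl⟩)
            · exact Or.inl (Or.inl h)
            · rcases Nat.lt_succ_iff_lt_or_eq.1 hl with h' | h'
              · exact Or.inl (Or.inr ⟨h, h'⟩)
              · exact Or.inr h'
        · rcases fhist v hv with h | h
          · rw [h]; exact gJ v hv i' hi' hu
          · refine h.mono fun l _ hl => Or.inl (Or.inl ?_)
            simp only [hP] at hl ⊢; omega
        · simp at fk; linarith
      · rw [hev] at heq
        have hPj : ¬ P (i + 1) j := by simp only [hP]; omega
        refine ⟨gF'.tick, gc, by simpa using g20, fun v hv => ?_, glt, g0, gJ, by simp; nlinarith⟩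
        refine node_congr (fun l _ => ?_) (gN v hv)
        simp only [hP']
        refine or_congr Iff.rfl (and_congr_right fun h => ⟨fun h' => by omega, fun h' => ?_⟩)
        rcases Nat.lt_succ_iff_lt_or_eq.1 h' with h' | rfl
        · exact h'
        · exact absurd h hPj
    · rintro ρ ⟨gF, gc, g20, gN, glt, g0, gJ, gk⟩
      have gN' : ∀ v < n, Node X q (P (i + 1)) (ρ.a 1) (ρ.a 2) v := by
        intro v hv
        refine node_congr (fun l hl => ?_) (gN v hv)
        simp only [hP', hl, and_true, hP]
        constructor
        · rintro (h | h) <;> omega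
        · exact Or.inr
      refine ⟨gF, gc, gN', glt, g0, fun v hv i' hi' hu => ?_, by linarith⟩
      rcases hi'.eq_or_lt with rfl | h
      · have hf : ρ.a 2 v = 0 := by
          by_contra h
          obtain ⟨u, hu, ha⟩ := hu
          exact (gN' v hv).flag.1 h u hu ha
        exact (gN' v hv).agree hf
      · exact gJ v hv i' (by omega) hu
  · rintro τ ⟨hF, hc, hN, hlt, h0, hJi, hk⟩
    refine hQ τ hF hc hlt h0 (fun v hv t ht hu => ?_) hk
    have e : ∀ l < q, t ≤ σ.a 0 l ↔ P (lam + 1 - t) l := fun l _ => by simp only [hP]; omega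
    obtain ⟨u, hu, ha⟩ := hu
    exact (agreeOn_congr e).2 (hJi v hv _ (by omega) ⟨u, hu, (agreeOn_congr e).1 ha⟩)

end
-- The cost of a parent table, and the cheapest table of many trials
theorem rowDist_succ (X : ℕ → ℕ → ℕ) (l u v : ℕ) :
    rowDist X (l + 1) u v = rowDist X l u v + if X u l ≠ X v l then 1 else 0 := by
  unfold rowDist
  rw [Finset.range_add_one, Finset.filter_insert]
  split_ifs with h
  · rw [Finset.card_insert_of_notMem (by simp)]
  · rfl

theorem rowDist_zero (X : ℕ → ℕ → ℕ) (u v : ℕ) : rowDist X 0 u v = 0 := by simp [rowDist]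

/-- The cost of a parent table. -/
def tableCost (X : ℕ → ℕ → ℕ) (q n : ℕ) (par : ℕ → ℕ) : ℕ :=
  ∑ v ∈ Finset.range n, rowDist X q (par v) v

theorem tableCost_le (X : ℕ → ℕ → ℕ) (q n : ℕ) (par : ℕ → ℕ) : tableCost X q n par ≤ n * q := by
  calc _ ≤ ∑ v ∈ Finset.range n, q := Finset.sum_le_sum fun v _ => rowDist_le _ _ _ _
    _ = _ := by simp

theorem tableCost_congr {X : ℕ → ℕ → ℕ} {q n : ℕ} {par par' : ℕ → ℕ} (h : ∀ v < n, par v = par' v) :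
    tableCost X q n par = tableCost X q n par' :=
  Finset.sum_congr rfl fun v hv => by rw [h v (Finset.mem_range.1 hv)]

section
variable {ω : ℕ → Bool} {b s B : ℕ}

/-- Compute the cost of the parent table in array `1`. -/
def costStm : Stm :=
  .seq (.assign 25 (.lit 0)) (.loop 21 (.var 6) (.seq (.assign 27 (.arr (.lit 1) (.var 21)))
    (.loop 19 (.var 1) (.assign 25
      (.var 25 + .ne (.row (.var 27) (.var 19)) (.row (.var 21) (.var 19)))))))

theorem costStm_wp {σ : St} {Q : St → Prop} (hnq : σ.v 6 * σ.v 1 ≤ B)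
    (hM : HasRows b s σ) (hp : ∀ v < σ.v 6, σ.a 1 v < σ.v 6)
    (hQ : ∀ τ, Frame 19 (fun _ => False) σ τ → τ.coins = σ.coins →
      τ.v 25 = tableCost σ.mat (σ.v 1) (σ.v 6) (σ.a 1) →
      τ.clk ≤ σ.clk + 2 + σ.v 6 * (3 + 2 * σ.v 1) → Q τ) :
    costStm.wp ω b (s + 8) B Q σ := by
  set X := σ.mat with hX
  set q := σ.v 1 with hq
  set n := σ.v 6 with hn
  refine ⟨by simp, fun _ => Nat.zero_le _, ?_⟩
  have hF₀ : Frame 19 (fun _ => False) σ (σ.set 25 ((Ex.lit 0).eval σ)).tick :=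
    ((Frame.refl _ _ _).set (by decide) _).tick
  refine Stm.wp_loop (fun i τ => Frame 19 (fun _ => False) σ τ ∧ τ.coins = σ.coins ∧
    τ.v 25 = tableCost X q i (σ.a 1) ∧ τ.clk ≤ σ.clk + 2 + i * (3 + 2 * q)) n
    (hF₀.v 6 (by decide)) (by simp) (fun h => ?_) ?_ ?_ ?_
  · rw [hn, ← hF₀.v 6 (by decide)]; exact h.v 6
  · exact ⟨hF₀.tick, rfl, by simp [tableCost], by simp⟩
  · rintro i hi τ ⟨hF, hc, hT, hk⟩
    have ha : τ.a = σ.a := funext fun j => hF.a j (by simp)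
    refine ⟨by simp, fun h => h.a _ _, ?_⟩
    have hF₁ := ((hF.set (x := 21) (by decide) i).tick.set (x := 27) (by decide)
      ((Ex.arr (.lit 1) (.var 21)).eval (τ.set 21 i).tick)).tick
    refine Stm.wp_loop (fun l ρ => Frame 19 (fun _ => False) σ ρ ∧ ρ.coins = σ.coins ∧
      ρ.v 21 = i ∧ ρ.v 27 = σ.a 1 i ∧
      ρ.v 25 = tableCost X q i (σ.a 1) + rowDist X l (σ.a 1 i) i ∧
      ρ.clk ≤ τ.clk + 3 + l * 2) q (hF₁.v 1 (by decide)) (by simp) (fun h => ?_) ?_ ?_ ?_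
    · rw [hq, ← hF₁.v 1 (by decide)]; exact h.v 1
    · exact ⟨hF₁.tick, hc, by simp, by simp [ha], by simp [hT, rowDist_zero], by simp⟩
    · rintro l hl ρ ⟨gF, gc, g21, g27, gT, gk⟩
      have gF' := (gF.set (x := 19) (by decide) l).tick
      have k7 : (ρ.set 19 l).tick.v 7 = σ.v 7 := gF'.v 7 (by decide)
      have k8 : (ρ.set 19 l).tick.v 8 = σ.v 8 := gF'.v 8 (by decide)
      have k9 : (ρ.set 19 l).tick.v 9 = σ.v 9 := gF'.v 9 (by decide)
      have km : (ρ.set 19 l).tick.mat = X := gF'.mat (by norm_num)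
      have k19 : (ρ.set 19 l).tick.v 19 = l := by simp
      have k21 : (ρ.set 19 l).tick.v 21 = i := by simpa using g21
      have k27 : (ρ.set 19 l).tick.v 27 = σ.a 1 i := by simpa using g27
      have k25 : (ρ.set 19 l).tick.v 25 = tableCost X q i (σ.a 1) + rowDist X l (σ.a 1 i) i := by
        simpa using gT
      have hev : (Ex.var 25 + .ne (.row (.var 27) (.var 19)) (.row (.var 21) (.var 19))).eval
          (ρ.set 19 l).tick = tableCost X q i (σ.a 1) + rowDist X (l + 1) (σ.a 1 i) i := by
        rw [rowDist_succ]
        simp only [Ex.eval_add, Ex.eval_ne, Ex.eval_row, Ex.eval_var, km, k19, k21, k27, k25]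
        ring
      refine ⟨?_, fun _ => ?_, ?_⟩
      · simp only [Ex.ok_add, Ex.ok_ne, Ex.ok_row, Ex.ok_var, Ex.eval_var, true_and, k7, k8, k9,
          k19, k21, k27, and_true]
        exact ⟨hM.lt _ (hp i hi) l hl, hM.lt i hi l hl⟩
      -- The partial cost is at most `q` for each of the rows up to `i`, hence at most `n * q`.
      · rw [hev]
        have h1 := tableCost_le X q i (σ.a 1)
        have h2 := rowDist_le X (l + 1) (σ.a 1 i) i
        have h3 : (i + 1) * q ≤ n * q := Nat.mul_le_mul_right _ hi
        rw [add_mul] at h3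
        omega
      · rw [hev]
        exact ⟨(gF'.set (by decide) _).tick, gc, by simpa using g21, by simpa using g27, by simp,
          by simp; omega⟩
    · rintro ρ ⟨gF, gc, g21, g27, gT, gk⟩
      refine ⟨gF, gc, ?_, by linarith⟩
      rw [gT, tableCost, tableCost, Finset.sum_range_succ]
  · rintro τ ⟨hF, hc, hT, hk⟩
    exact hQ τ hF hc hT hk

/-- Copy the parent table in array `1` to array `j` if it is cheaper. -/
def bestStm (j : ℕ) : Stm :=
  .ite (.var 17 - .var 25) (.seq (.assign 17 (.var 25))
    (.loop 21 (.var 6) (.put (.lit j) (.var 21) (.arr (.lit 1) (.var 21))))) .skip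

/-- The table in array `j` is a parent table, with a cost that is at most the variable `17`. -/
structure HasTable (j : ℕ) (σ : St) : Prop where
  lt : ∀ v < σ.v 6, 0 < v → σ.a j v < v
  zero : σ.a j 0 = 0
  cost : tableCost σ.mat (σ.v 1) (σ.v 6) (σ.a j) ≤ σ.v 17

theorem bestStm_wp {σ : St} {Q : St → Prop} {j : ℕ} (hj : j = 3 ∨ j = 4)
    (hlt : ∀ v < σ.v 6, 0 < v → σ.a 1 v < v) (h0 : σ.a 1 0 = 0) (hn : 0 < σ.v 6)
    (hcost : σ.v 25 = tableCost σ.mat (σ.v 1) (σ.v 6) (σ.a 1)) (hT : HasTable j σ)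
    (hQ : ∀ τ, Frame 17 (· = j) σ τ → τ.coins = σ.coins → HasTable j τ → τ.v 17 ≤ σ.v 17 →
      τ.v 17 ≤ σ.v 25 → τ.clk ≤ σ.clk + 3 + σ.v 6 * 2 → Q τ) :
    (bestStm j).wp ω b (s + 8) B Q σ := by
  have hj1 : 1 ≠ j := by omega
  refine ⟨by simp, fun hne => ?_, fun heq => ?_⟩
  · simp at hne
    refine ⟨by simp, fun h => h.v _, ?_⟩
    have hF₀ : Frame 17 (· = j) σ (σ.tick.set 17 ((Ex.var 25).eval σ.tick)).tick :=
      ((Frame.refl _ _ _).tick.set (by decide) _).tick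
    refine Stm.wp_loop (fun i τ => Frame 17 (· = j) σ τ ∧ τ.coins = σ.coins ∧ τ.v 17 = σ.v 25 ∧
      (∀ v < i, τ.a j v = σ.a 1 v) ∧ τ.clk ≤ σ.clk + 3 + i * 2) (σ.v 6) (by simp) (by simp)
      (fun h => h.v 6) ?_ ?_ ?_
    · exact ⟨hF₀.tick, rfl, by simp, fun v hv => by omega, by simp⟩
    · rintro i hi τ ⟨hF, hc, h17, hv, hk⟩
      refine ⟨by simp, by simp, by simp, by simp; omega, fun h => h.a _ _, ?_⟩
      refine ⟨((hF.set (by decide) _).tick.put rfl _ _).tick, hc, by simpa using h17,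
        fun v hvi => ?_, by simp; omega⟩
      by_cases e : v = i
      · subst e; simp [hF.a 1 hj1]
      · simpa [e] using hv v (by omega)
    · rintro τ ⟨hF, hc, h17, hv, hk⟩
      have e6 : τ.v 6 = σ.v 6 := hF.v 6 (by decide)
      refine hQ τ hF hc ⟨?_, ?_, ?_⟩ (by omega) (by omega) hk
      · rw [e6]; intro v h h'; rw [hv v h]; exact hlt v h h'
      · rw [hv 0 hn, h0]
      · rw [e6, hF.v 1 (by decide), hF.mat (by norm_num), h17, tableCost_congr hv, hcost]
  · simp at heq
    exact hQ _ (Frame.refl _ _ _).tick.tick rfl ⟨hT.lt, hT.zero, hT.cost⟩ le_rfl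
      (Nat.sub_eq_zero_iff_le.1 heq) (by simp; omega)

/-- The sweep dominates a trial: `lam + 1` phases of `q` columns with `n` rows each, and all other
terms are at most a constant times `(lam + 1) * (n * q)`. -/
theorem trial_clock {c c' q lam n : ℕ} (hq : 0 < q) (hn : 0 < n)
    (h : c' ≤ c + 9 + (q * (4 * lam + 5) + n * 3 + (lam + 1) * (2 + q * (3 + n * (2 * s + 8))) +
      n * (3 + 2 * q) + n * 2)) : c' ≤ c + (lam + 1) * (n * q) * (2 * s + 50) := by
  have e1 : 1 ≤ lam + 1 := by omega
  have e2 : q ≤ n * q := Nat.le_mul_of_pos_left _ hn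
  have e3 : n ≤ n * q := Nat.le_mul_of_pos_right _ hq
  have e4 : n * q ≤ (lam + 1) * (n * q) := Nat.le_mul_of_pos_left _ e1
  have e5 : (lam + 1) * q ≤ (lam + 1) * (n * q) := Nat.mul_le_mul_left _ e2
  have e6 : (lam + 1) * 1 ≤ (lam + 1) * q := Nat.mul_le_mul_left _ hq
  have e7 : (lam + 1) * (2 + q * (3 + n * (2 * s + 8))) =
      2 * (lam + 1) + 3 * ((lam + 1) * q) + (lam + 1) * (n * q) * (2 * s + 8) := by ring
  have e8 : q * (4 * lam + 5) = 4 * ((lam + 1) * q) + q := by ring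
  have e9 : (lam + 1) * (n * q) * (2 * s + 50) =
    (lam + 1) * (n * q) * (2 * s + 8) + 42 * ((lam + 1) * (n * q)) := by ring
  have e10 : n * (3 + 2 * q) = 3 * n + 2 * (n * q) := by ring
  omega

/-- Construct a parent table from random levels, and keep it in array `j` if it is the best. -/
def trialStm (s j : ℕ) : Stm :=
  .seq levelStm (.seq initStm (.seq (sweepStm s) (.seq costStm (bestStm j))))

/-- The quality of the table is stated for every connected `T` and all `L`, `K`, since the program
knows none of them; they enter only in the analysis. -/
theorem trialStm_wp {σ : St} {Q : St → Prop} {j : ℕ} (hj : j = 3 ∨ j = 4) (hB : 1 ≤ B) (hs : s ≤ B)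
    (hlam : σ.v 4 + 1 ≤ B) (hnq : σ.v 6 * σ.v 1 ≤ B) (hM : HasRows b s σ) (hn : 0 < σ.v 6)
    (hq0 : 0 < σ.v 1) (hT : HasTable j σ) (hq : σ.v 1 ≤ 2 ^ σ.v 4)
    (hQ : ∀ τ, Frame 17 (fun i => i ≠ 7 - j) σ τ → τ.coins = σ.coins + σ.v 1 * σ.v 4 →
      HasTable j τ → τ.v 17 ≤ σ.v 17 →
      (∀ (T : SimpleGraph (Fin (σ.v 6))) (L K : ℕ), T.Connected → 1 ≤ L →
        GoodLevels T σ.mat (σ.v 1) (σ.v 4) L K (fun i => ω (σ.coins + i)) →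
        τ.v 17 ≤ 2 * L * K) →
      τ.clk ≤ σ.clk + (σ.v 4 + 1) * (σ.v 6 * σ.v 1) * (2 * s + 50) → Q τ) :
    (trialStm s j).wp ω b (s + 8) B Q σ := by
  set X := σ.mat with hX
  set q := σ.v 1 with hq'
  set n := σ.v 6 with hn'
  set lam := σ.v 4 with hlam'
  -- `7 - j` exchanges `3` and `4`: the search for one matrix spares the table kept for the other.
  set A : ℕ → Prop := fun i => i ≠ 7 - j with hA
  refine levelStm_wp hB fun τ₁ F₁ c₁ lev k₁ => ?_
  have F₁' : Frame 18 A σ τ₁ := F₁.mono (by norm_num) (by rintro _ rfl; simp only [hA]; omega)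
  refine initStm_wp hB fun τ₂ F₂ c₂ a1 a2 k₂ => ?_
  have F₂' : Frame 18 A σ τ₂ :=
    F₁'.trans (F₂.mono (by norm_num) (by rintro _ (rfl | rfl) <;> simp only [hA] <;> omega))
  have e6 : τ₁.v 6 = n := F₁'.v 6 (by decide)
  have f6 : τ₂.v 6 = n := F₂'.v 6 (by decide)
  have f4 : τ₂.v 4 = lam := F₂'.v 4 (by decide)
  have f1 : τ₂.v 1 = q := F₂'.v 1 (by decide)
  have fm : τ₂.mat = X := F₂'.mat (by norm_num)
  have f0 : τ₂.a 0 = τ₁.a 0 := F₂.a 0 (by simp)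
  rw [e6] at a1 a2 k₂
  refine sweepStm_wp hB hs (by rw [f4]; exact hlam) (hM.frame F₂' (by norm_num))
    (by rw [f1, f4, f0]; exact fun l hl => (lev l hl).1) (by rwa [f6]) (by rwa [f6])
    (by rwa [f6]) ?_
  rw [f6, fm, f1, f4, f0]
  intro τ₃ F₃ c₃ hlt h0 hpar k₃
  have F₃' : Frame 18 A σ τ₃ := F₂'.trans (F₃.mono (by norm_num)
    (by rintro i (rfl | rfl | h) <;> simp only [hA] <;> omega))
  have g6 : τ₃.v 6 = n := F₃'.v 6 (by decide)
  have g1 : τ₃.v 1 = q := F₃'.v 1 (by decide)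
  have gm : τ₃.mat = X := F₃'.mat (by norm_num)
  refine costStm_wp (by rw [g6, g1]; exact hnq) (hM.frame F₃' (by norm_num)) ?_ ?_
  · rw [g6]
    intro v hv
    rcases Nat.eq_zero_or_pos v with rfl | h
    · rw [h0]; exact hn
    · exact (hlt v hv h).trans hv
  rw [g6, g1, gm]
  intro τ₄ F₄ c₄ e25 k₄
  have F₄' : Frame 18 A σ τ₄ := F₃'.trans (F₄.mono (by norm_num) (fun _ h => h.elim))
  have i6 : τ₄.v 6 = n := F₄'.v 6 (by decide)
  have i1 : τ₄.v 1 = q := F₄'.v 1 (by decide)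
  have im : τ₄.mat = X := F₄'.mat (by norm_num)
  have i17 : τ₄.v 17 = σ.v 17 := F₄'.v 17 (by decide)
  have ia : τ₄.a 1 = τ₃.a 1 := F₄.a 1 (by simp)
  have ij : τ₄.a j = σ.a j := by
    rw [F₄.a j (by simp), F₃.a j (by omega), F₂.a j (by omega), F₁.a j (by omega)]
  have hT₄ : HasTable j τ₄ :=
    ⟨by rw [i6, ij]; exact hT.lt, by rw [ij]; exact hT.zero, by
      rw [i6, i1, im, ij, i17]; exact hT.cost⟩
  refine bestStm_wp hj (by rw [i6, ia]; exact hlt) (by rw [ia]; exact h0) (by rwa [i6])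
    (by rw [i1, i6, im, ia]; exact e25) hT₄ fun τ₅ F₅ c₅ hT₅ l₁ l₂ k₅ => ?_
  refine hQ τ₅ ((F₄'.mono (by norm_num) fun _ h => h).trans (F₅.mono le_rfl (by
    rintro _ rfl; simp only [hA]; omega)))
    (c₅.trans (c₄.trans (c₃.trans (c₂.trans c₁)))) hT₅ (by omega) ?_ ?_
  · intro T L K hTc hL hG
    refine l₂.trans ?_
    rw [e25, tableCost]
    have hR : ∀ t ≤ lam, ∀ l < q, (t ≤ τ₁.a 0 l ↔ Reach lam (fun i => ω (σ.coins + i)) t l) :=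
      fun t ht l hl => (lev l hl).2 t ht
    refine (sum_rowDist_parent_le hTc hL hq h0 hlt (R := Reach lam fun i => ω (σ.coins + i))
      (fun l i hi => by omega) (fun v hv t ht hu => ?_) hG.1).trans (by gcongr; exact hG.2)
    obtain ⟨u, hu, ha⟩ := hu
    exact (agreeOn_congr (hR t ht)).1 (hpar v hv t ht ⟨u, hu, (agreeOn_congr (hR t ht)).2 ha⟩)
  · rw [i6] at k₅
    have k₁ : τ₁.clk ≤ σ.clk + 1 + q * (4 * lam + 5) := k₁
    exact trial_clock hq0 hn (by omega)

end
section
variable {ω : ℕ → Bool} {b s B : ℕ}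

theorem Ex.eval_ne_of {σ : St} {e f : Ex} {x y : ℕ} (h : e.eval σ = x) (h' : f.eval σ = y) :
    (e.ne f).eval σ = if x ≠ y then 1 else 0 := by
  subst h h'; exact Ex.eval_ne σ e f

/-- Keep the best parent table of as many trials as the variable `5` says. -/
def treeStm (s j : ℕ) : Stm :=
  .seq (.assign 17 (.var 6 * .var 1)) (.loop 18 (.var 5) (trialStm s j))

/-- The kept cost never increases, so one good trial suffices. The initial zero table is itself a
parent table, of cost at most `n * q`; thus a valid table is present whatever the coins show. -/
theorem treeStm_wp {σ : St} {Q : St → Prop} {j : ℕ} (hj : j = 3 ∨ j = 4) (hB : 1 ≤ B) (hs : s ≤ B)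
    (hlam : σ.v 4 + 1 ≤ B) (hnq : σ.v 6 * σ.v 1 ≤ B) (hM : HasRows b s σ) (hn : 0 < σ.v 6)
    (hq0 : 0 < σ.v 1) (hT : ∀ v, σ.a j v = 0) (hq : σ.v 1 ≤ 2 ^ σ.v 4)
    (hQ : ∀ τ, Frame 17 (fun i => i ≠ 7 - j) σ τ →
      τ.coins = σ.coins + σ.v 5 * (σ.v 1 * σ.v 4) → HasTable j τ →
      (∀ (T : SimpleGraph (Fin (σ.v 6))) (L K : ℕ), T.Connected → 1 ≤ L →
        (∃ k < σ.v 5, GoodLevels T σ.mat (σ.v 1) (σ.v 4) L K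
          (fun i => ω (σ.coins + (k * (σ.v 1 * σ.v 4) + i)))) → τ.v 17 ≤ 2 * L * K) →
      τ.clk ≤ σ.clk + 2 + σ.v 5 * ((σ.v 4 + 1) * (σ.v 6 * σ.v 1) * (2 * s + 50) + 1) → Q τ) :
    (treeStm s j).wp ω b (s + 8) B Q σ := by
  set X := σ.mat with hX
  set q := σ.v 1 with hq'
  set n := σ.v 6 with hn'
  set lam := σ.v 4 with hlam'
  refine ⟨by simp, fun _ => hnq, ?_⟩
  set A : ℕ → Prop := fun i => i ≠ 7 - j with hA
  have F₀ : Frame 17 A σ (σ.set 17 ((Ex.var 6 * .var 1).eval σ)).tick :=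
    ((Frame.refl _ _ _).set (by decide) _).tick
  refine Stm.wp_loop (fun k τ => Frame 17 A σ τ ∧ τ.coins = σ.coins + k * (q * lam) ∧
    HasTable j τ ∧
    (∀ (T : SimpleGraph (Fin n)) (L K : ℕ), T.Connected → 1 ≤ L →
        (∃ k' < k, GoodLevels T X q lam L K (fun i => ω (σ.coins + (k' * (q * lam) + i)))) →
        τ.v 17 ≤ 2 * L * K) ∧
    τ.clk ≤ σ.clk + 2 + k * ((lam + 1) * (n * q) * (2 * s + 50) + 1)) (σ.v 5)
    (F₀.v 5 (by decide)) (by simp) (fun h => ?_) ?_ ?_ ?_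
  · rw [← F₀.v 5 (by decide)]; exact h.v 5
  · refine ⟨F₀.tick, by simp, ⟨fun v _ hv => ?_, hT 0, ?_⟩, ?_, by simp⟩
    · simp [hT v, hv]
    · refine (tableCost_le _ _ _ _).trans ?_
      simp
    · rintro T L K _ _ ⟨k', hk', _⟩; omega
  · rintro k hk τ ⟨hF, hc, hTa, hG, hk'⟩
    have F₁ : Frame 17 A σ (τ.set 18 k).tick := (hF.set (by decide) _).tick
    have e6 : (τ.set 18 k).tick.v 6 = n := F₁.v 6 (by decide)
    have e1 : (τ.set 18 k).tick.v 1 = q := F₁.v 1 (by decide)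
    have e4 : (τ.set 18 k).tick.v 4 = lam := F₁.v 4 (by decide)
    have em : (τ.set 18 k).tick.mat = X := F₁.mat (by norm_num)
    refine trialStm_wp hj hB hs (by rwa [e4]) (by rwa [e6, e1]) (hM.frame F₁ (by norm_num))
      (by rwa [e6]) (by rwa [e1]) ⟨hTa.lt, hTa.zero, hTa.cost⟩ (by rwa [e1, e4]) ?_
    rw [e6, e1, e4, em]
    intro ρ gF gc gT gle gG gk
    refine ⟨F₁.trans gF, ?_, gT, ?_, ?_⟩
    · rw [gc, St.tick_coins, St.set_coins, hc]; ring
    · rintro T L K hTc hL ⟨k', hk', hG'⟩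
      rcases Nat.lt_succ_iff_lt_or_eq.1 hk' with h | rfl
      · exact gle.trans (hG T L K hTc hL ⟨k', h, hG'⟩)
      · refine gG T L K hTc hL ?_
        simpa only [St.tick_coins, St.set_coins, hc, add_assoc] using hG'
    · simp at gk; rw [add_mul, one_mul]; omega
  · rintro τ ⟨hF, hc, hTa, hG, hk'⟩
    exact hQ τ hF hc hTa hG hk'

/-! ### Computation of the distances along a parent table -/

/-- The number of the first `q` columns in which row `i` of `X` differs from row `j` of `Y`. -/
def pairDist (X Y : ℕ → ℕ → ℕ) (q i j : ℕ) : ℕ :=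
  ((Finset.range q).filter fun l => X i l ≠ Y j l).card

theorem pairDist_zero (X Y : ℕ → ℕ → ℕ) (i j : ℕ) : pairDist X Y 0 i j = 0 := by simp [pairDist]

theorem pairDist_succ (X Y : ℕ → ℕ → ℕ) (l i j : ℕ) :
    pairDist X Y (l + 1) i j = pairDist X Y l i j + if X i l ≠ Y j l then 1 else 0 := by
  unfold pairDist
  rw [Finset.range_add_one, Finset.filter_insert]
  split_ifs with h
  · rw [Finset.card_insert_of_notMem (by simp)]
  · rfl

theorem pairDist_le (X Y : ℕ → ℕ → ℕ) (q i j : ℕ) : pairDist X Y q i j ≤ q := by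
  have := Finset.card_filter_le (Finset.range q) (fun l => X i l ≠ Y j l)
  simpa [pairDist] using this

theorem pairDist_mono (X Y : ℕ → ℕ → ℕ) {l q : ℕ} (h : l ≤ q) (i j : ℕ) :
    pairDist X Y l i j ≤ pairDist X Y q i j :=
  Finset.card_le_card (Finset.filter_subset_filter _ (Finset.range_mono h))

/-- The matrix whose offset and strides are in the variables `11`, `12`, `13`. -/
def St.mat' (σ : St) : ℕ → ℕ → ℕ := ForLang.mat σ.lo (σ.v 11) (σ.v 12) (σ.v 13)

/-- The output, with offset and strides in the variables `3`, `14`, `15`. -/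
def St.out (σ : St) : ℕ → ℕ → ℕ := ForLang.mat σ.lo (σ.v 3) (σ.v 14) (σ.v 15)

/-- An entry of `St.mat'`. -/
def Ex.row' (v l : Ex) : Ex := .raw (.var 11 + (v * .var 12 + l * .var 13))

/-- The address of an entry of `St.out`. -/
def Ex.outAddr (v l : Ex) : Ex := .var 3 + (v * .var 14 + l * .var 15)

@[simp] theorem Ex.eval_row' (σ : St) (v l : Ex) :
    (Ex.row' v l).eval σ = σ.mat' (v.eval σ) (l.eval σ) := rfl

@[simp] theorem Ex.ok_row' {M : ℕ} {σ : St} (v l : Ex) : (Ex.row' v l).ok b M σ ↔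
    (v.ok b M σ ∧ l.ok b M σ) ∧ σ.v 11 + (v.eval σ * σ.v 12 + l.eval σ * σ.v 13) < b := by
  simp [Ex.row']

@[simp] theorem Ex.eval_outAddr (σ : St) (v l : Ex) :
    (Ex.outAddr v l).eval σ = σ.v 3 + (v.eval σ * σ.v 14 + l.eval σ * σ.v 15) := rfl

@[simp] theorem Ex.ok_outAddr {M : ℕ} {σ : St} (v l : Ex) :
    (Ex.outAddr v l).ok b M σ ↔ v.ok b M σ ∧ l.ok b M σ := by simp [Ex.outAddr]

/-- The matrices `St.mat`, `St.mat'` are stored below the address in the variable `3`, and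
`St.out` from there on, without overlaps. -/
structure Layout (b : ℕ) (σ : St) : Prop where
  le : σ.v 3 ≤ b
  rows : ∀ v < σ.v 6, ∀ l < σ.v 1, σ.v 7 + (v * σ.v 8 + l * σ.v 9) < σ.v 3
  cols : ∀ j < σ.v 10, ∀ l < σ.v 1, σ.v 11 + (j * σ.v 12 + l * σ.v 13) < σ.v 3
  out : ∀ v < σ.v 6, ∀ j < σ.v 10, σ.v 3 + (v * σ.v 14 + j * σ.v 15) < b
  inj : ∀ v < σ.v 6, ∀ j < σ.v 10, ∀ v' < σ.v 6, ∀ j' < σ.v 10,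
    v * σ.v 14 + j * σ.v 15 = v' * σ.v 14 + j' * σ.v 15 → v = v' ∧ j = j'

/-- Only variables from `18` on and low memory from the address in the variable `3` on have
changed. -/
structure OutFrame (σ τ : St) : Prop where
  v : ∀ x : Fin 32, (x : ℕ) < 18 → τ.v x = σ.v x
  lo : ∀ i < σ.v 3, τ.lo i = σ.lo i
  a : τ.a = σ.a
  coins : τ.coins = σ.coins

variable {σ τ : St}

theorem OutFrame.refl (σ : St) : OutFrame σ σ := ⟨fun _ _ => rfl, fun _ _ => rfl, rfl, rfl⟩

theorem OutFrame.tick (h : OutFrame σ τ) : OutFrame σ τ.tick := ⟨h.v, h.lo, h.a, h.coins⟩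

theorem OutFrame.set (h : OutFrame σ τ) {x : Fin 32} (hx : 18 ≤ (x : ℕ)) (n : ℕ) :
    OutFrame σ (τ.set x n) := by
  refine ⟨fun y hy => ?_, h.lo, h.a, h.coins⟩
  rw [St.set_v, Function.update_of_ne (by rintro rfl; omega), h.v y hy]

theorem OutFrame.putRaw (h : OutFrame σ τ) (i n : ℕ) : OutFrame σ (τ.putRaw (τ.v 3 + i) n) := by
  refine ⟨h.v, fun j hj => ?_, h.a, h.coins⟩
  rw [St.putRaw_lo, h.v 3 (by decide), Function.update_of_ne (by omega), h.lo j hj]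

theorem OutFrame.mat (h : OutFrame σ τ) (hL : Layout b σ) {v l : ℕ} (hv : v < σ.v 6)
    (hl : l < σ.v 1) : τ.mat v l = σ.mat v l := by
  unfold St.mat ForLang.mat
  rw [h.v 7 (by decide), h.v 8 (by decide), h.v 9 (by decide), h.lo _ (hL.rows v hv l hl)]

theorem OutFrame.mat' (h : OutFrame σ τ) (hL : Layout b σ) {j l : ℕ} (hj : j < σ.v 10)
    (hl : l < σ.v 1) : τ.mat' j l = σ.mat' j l := by
  unfold St.mat' ForLang.mat
  rw [h.v 11 (by decide), h.v 12 (by decide), h.v 13 (by decide), h.lo _ (hL.cols j hj l hl)]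

theorem OutFrame.row_lt (h : OutFrame σ τ) (hL : Layout b σ) {v l : ℕ} (hv : v < σ.v 6)
    (hl : l < σ.v 1) : τ.v 7 + (v * τ.v 8 + l * τ.v 9) < b := by
  rw [h.v 7 (by decide), h.v 8 (by decide), h.v 9 (by decide)]
  exact (hL.rows v hv l hl).trans_le hL.le

theorem OutFrame.col_lt (h : OutFrame σ τ) (hL : Layout b σ) {j l : ℕ} (hj : j < σ.v 10)
    (hl : l < σ.v 1) : τ.v 11 + (j * τ.v 12 + l * τ.v 13) < b := by
  rw [h.v 11 (by decide), h.v 12 (by decide), h.v 13 (by decide)]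
  exact (hL.cols j hj l hl).trans_le hL.le

theorem OutFrame.out_lt (h : OutFrame σ τ) (hL : Layout b σ) {v j : ℕ} (hv : v < σ.v 6)
    (hj : j < σ.v 10) : τ.v 3 + (v * τ.v 14 + j * τ.v 15) < b := by
  rw [h.v 3 (by decide), h.v 14 (by decide), h.v 15 (by decide)]
  exact hL.out v hv j hj

/-- Injectivity of the output addressing: writing one entry leaves all others alone, for row-major
as well as transposed order. -/
theorem OutFrame.out_putRaw (h : OutFrame σ τ) (hL : Layout b σ) {v j v' j' : ℕ} (hv : v < σ.v 6)
    (hj : j < σ.v 10) (hv' : v' < σ.v 6) (hj' : j' < σ.v 10) (n : ℕ) :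
    (τ.putRaw (τ.v 3 + (v * τ.v 14 + j * τ.v 15)) n).out v' j' =
      if v' = v ∧ j' = j then n else τ.out v' j' := by
  unfold St.out ForLang.mat
  simp only [St.putRaw_v, St.putRaw_lo, Function.update_apply]
  rw [h.v 3 (by decide), h.v 14 (by decide), h.v 15 (by decide)]
  by_cases e : v' = v ∧ j' = j
  · obtain ⟨rfl, rfl⟩ := e; simp
  · rw [if_neg e, if_neg]
    intro h'
    exact e (hL.inj v' hv' j' hj' v hv j hj (by omega))

theorem St.out_tick (τ : St) : τ.tick.out = τ.out := rfl

theorem St.out_set (τ : St) {x : Fin 32} (hx : 18 ≤ (x : ℕ)) (n : ℕ) : (τ.set x n).out = τ.out := by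
  unfold St.out
  rw [St.set_lo, St.set_v, Function.update_of_ne (by rintro rfl; simp at hx),
    Function.update_of_ne (by rintro rfl; simp at hx),
    Function.update_of_ne (by rintro rfl; simp at hx)]

/-- Compute the first row of the output directly. -/
def firstRowStm : Stm :=
  .loop 20 (.var 10) (.seq (.assign 23 (.lit 0)) (.seq
    (.loop 19 (.var 1) (.assign 23 (.var 23 + .ne (.row (.lit 0) (.var 19))
      (.row' (.var 20) (.var 19)))))
    (.putRaw (.outAddr (.lit 0) (.var 20)) (.var 23))))

theorem firstRowStm_wp {Q : St → Prop} (hq : σ.v 1 ≤ B) (hL : Layout b σ) (hn : 0 < σ.v 6)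
    (hQ : ∀ τ, OutFrame σ τ →
      (∀ j < σ.v 10, τ.out 0 j = pairDist σ.mat σ.mat' (σ.v 1) 0 j) →
      τ.clk ≤ σ.clk + 1 + σ.v 10 * (4 + 2 * σ.v 1) → Q τ) :
    firstRowStm.wp ω b (s + 8) B Q σ := by
  refine Stm.wp_loop (fun i τ => OutFrame σ τ ∧
    (∀ j < i, j < σ.v 10 → τ.out 0 j = pairDist σ.mat σ.mat' (σ.v 1) 0 j) ∧
    τ.clk ≤ σ.clk + 1 + i * (4 + 2 * σ.v 1)) (σ.v 10) rfl (by simp) (fun h => h.v 10) ?_ ?_ ?_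
  · exact ⟨(OutFrame.refl _).tick, fun j hj => by omega, by simp⟩
  · rintro i hi τ ⟨hF, hO, hk⟩
    refine ⟨by simp, fun _ => Nat.zero_le _, ?_⟩
    have F₁ := ((hF.set (x := 20) (by decide) i).tick.set (x := 23) (by decide)
      ((Ex.lit 0).eval (τ.set 20 i).tick)).tick
    refine Stm.wp_loop (fun l ρ => OutFrame σ ρ ∧ ρ.out = τ.out ∧ ρ.v 20 = i ∧
      ρ.v 23 = pairDist σ.mat σ.mat' l 0 i ∧ ρ.clk ≤ τ.clk + 3 + l * 2) (σ.v 1)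
      (F₁.v 1 (by decide)) (by simp) (fun _ => hq) ?_ ?_ ?_
    · refine ⟨F₁.tick, ?_, by simp, by simp [pairDist_zero], by simp⟩
      rw [St.out_tick, St.out_tick, St.out_set _ (by decide), St.out_tick, St.out_set _ (by decide)]
    · rintro l hl ρ ⟨gF, gO, g20, g23, gk⟩
      have gF' := (gF.set (x := 19) (by decide) l).tick
      have hev : (Ex.var 23 + .ne (.row (.lit 0) (.var 19)) (.row' (.var 20) (.var 19))).eval
          (ρ.set 19 l).tick = pairDist σ.mat σ.mat' (l + 1) 0 i := by
        have g20' : (ρ.set 19 l).tick.v 20 = i := by simpa using g20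
        have e1 : (Ex.row (.lit 0) (.var 19)).eval (ρ.set 19 l).tick = σ.mat 0 l := by
          rw [← gF'.mat hL hn hl, Ex.eval_row]; simp
        have e2 : (Ex.row' (.var 20) (.var 19)).eval (ρ.set 19 l).tick = σ.mat' i l := by
          rw [← gF'.mat' hL hi hl, Ex.eval_row', Ex.eval_var, g20']; simp
        rw [pairDist_succ, ← g23, Ex.eval_add, Ex.eval_ne_of e1 e2]
        simp
      refine ⟨?_, fun _ => ?_, (gF'.set (by decide) _).tick, ?_, by simpa using g20, ?_,
        by simp; omega⟩
      · have h1 := gF.row_lt hL hn hl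
        have h2 := gF.col_lt hL hi hl
        simpa [g20] using And.intro h1 h2
      · rw [hev]; exact (pairDist_le _ _ _ _ _).trans (by omega)
      · rw [St.out_tick, St.out_set _ (by decide), St.out_tick, St.out_set _ (by decide), gO]
      · rw [hev]; simp
    · rintro ρ ⟨gF, gO, g20, g23, gk⟩
      have e : (Ex.outAddr (.lit 0) (.var 20)).eval ρ = ρ.v 3 + (0 * ρ.v 14 + i * ρ.v 15) := by
        simp [g20]
      refine ⟨by simp, by simp, ?_, fun h => h.v _, ?_⟩
      · rw [e]; exact gF.out_lt hL hn hi
      · rw [e]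
        refine ⟨(gF.putRaw _ _).tick, fun j hj hj' => ?_, by simp; linarith⟩
        rw [St.out_tick, gF.out_putRaw hL hn hi hn hj']
        simp only [true_and]
        split_ifs with hji
        · subst hji; simpa using g23
        · rw [gO]; exact hO j (by omega) hj'
  · rintro τ ⟨hF, hO, hk⟩
    exact hQ τ hF (fun j hj => hO j hj hj) hk

/-- Update an output row for a column in which the row differs from its parent. -/
def updateStm : Stm :=
  .loop 20 (.var 10) (.putRaw (.outAddr (.var 21) (.var 20))
    (.raw (.outAddr (.var 21) (.var 20)) + .ne (.row (.var 21) (.var 19)) (.row' (.var 20) (.var 19))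
      - .ne (.row (.var 22) (.var 19)) (.row' (.var 20) (.var 19))))

/-- The output row `v` is intermediate between the right row `u` and the right row `v`: the first
`l` columns are those of `v`. -/
def Hybrid (X Y O : ℕ → ℕ → ℕ) (q l u v j : ℕ) : Prop :=
  O v j + pairDist X Y l u j = pairDist X Y q u j + pairDist X Y l v j

/-- Passing from `l` to `l + 1` columns of row `v` changes the distance to row `j` of `Y` by the
difference of the two indicators at column `l`. Hybrid values are at most `2 * q`, which is why `2 *
q ≤ B` is required. -/
theorem updateStm_wp {Q : St → Prop} {σ₀ : St} {u v l : ℕ} (hq : 2 * σ₀.v 1 ≤ B) (hL : Layout b σ₀)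
    (hσ : OutFrame σ₀ σ) (h21 : σ.v 21 = v) (h22 : σ.v 22 = u) (h19 : σ.v 19 = l)
    (hv : v < σ₀.v 6) (hu : u < σ₀.v 6) (hl : l < σ₀.v 1)
    (hH : ∀ j < σ₀.v 10, Hybrid σ₀.mat σ₀.mat' σ.out (σ₀.v 1) l u v j)
    (hQ : ∀ τ, OutFrame σ₀ τ → τ.v 18 = σ.v 18 → τ.v 21 = v → τ.v 22 = u →
      (∀ j < σ₀.v 10, Hybrid σ₀.mat σ₀.mat' τ.out (σ₀.v 1) (l + 1) u v j) →
      (∀ v' < σ₀.v 6, v' ≠ v → ∀ j < σ₀.v 10, τ.out v' j = σ.out v' j) →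
      τ.clk ≤ σ.clk + 1 + 2 * σ₀.v 10 → Q τ) :
    updateStm.wp ω b (s + 8) B Q σ := by
  refine Stm.wp_loop (fun i τ => OutFrame σ₀ τ ∧ τ.v 18 = σ.v 18 ∧ τ.v 21 = v ∧ τ.v 22 = u ∧
      τ.v 19 = l ∧
      (∀ j < i, j < σ₀.v 10 → Hybrid σ₀.mat σ₀.mat' τ.out (σ₀.v 1) (l + 1) u v j) ∧
      (∀ j, i ≤ j → j < σ₀.v 10 → Hybrid σ₀.mat σ₀.mat' τ.out (σ₀.v 1) l u v j) ∧
      (∀ v' < σ₀.v 6, v' ≠ v → ∀ j < σ₀.v 10, τ.out v' j = σ.out v' j) ∧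
      τ.clk ≤ σ.clk + 1 + i * 2) (σ₀.v 10) (hσ.v 10 (by decide)) (by simp) (fun h => ?_) ?_ ?_ ?_
  · rw [← hσ.v 10 (by decide)]; exact h.v 10
  · exact ⟨hσ.tick, rfl, h21, h22, h19, fun j hj => by omega, fun j _ hj => hH j hj,
      fun _ _ _ _ _ => rfl, by simp⟩
  · rintro i hi τ ⟨hF, e18, e21, e22, e19, hD, hTd, hO, hk⟩
    have hF' := (hF.set (x := 20) (by decide) i).tick
    set ρ := (τ.set 20 i).tick with hρ
    have g18 : ρ.v 18 = σ.v 18 := by simpa [hρ] using e18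
    have g21 : ρ.v 21 = v := by simpa [hρ] using e21
    have g22 : ρ.v 22 = u := by simpa [hρ] using e22
    have g19 : ρ.v 19 = l := by simpa [hρ] using e19
    have g20 : ρ.v 20 = i := by simp [hρ]
    have gO : ρ.out = τ.out := by rw [hρ, St.out_tick, St.out_set _ (by decide)]
    have gk : ρ.clk = τ.clk + 1 := rfl
    clear_value ρ
    have e : (Ex.outAddr (.var 21) (.var 20)).eval ρ = ρ.v 3 + (v * ρ.v 14 + i * ρ.v 15) := by
      simp [g20, g21]
    obtain ⟨val, hval⟩ : ∃ val, val = (Ex.raw (.outAddr (.var 21) (.var 20)) +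
      .ne (.row (.var 21) (.var 19)) (.row' (.var 20) (.var 19))
      - .ne (.row (.var 22) (.var 19)) (.row' (.var 20) (.var 19))).eval ρ := ⟨_, rfl⟩
    have hval' : val + pairDist σ₀.mat σ₀.mat' (l + 1) u i =
        pairDist σ₀.mat σ₀.mat' (σ₀.v 1) u i + pairDist σ₀.mat σ₀.mat' (l + 1) v i := by
      have e1 : val = τ.out v i + (if σ₀.mat v l ≠ σ₀.mat' i l then 1 else 0) -
          (if σ₀.mat u l ≠ σ₀.mat' i l then 1 else 0) := by
        have f1 : (Ex.row (.var 21) (.var 19)).eval ρ = σ₀.mat v l := by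
          rw [Ex.eval_row, Ex.eval_var, Ex.eval_var, g19, g21, hF'.mat hL hv hl]
        have f2 : (Ex.row (.var 22) (.var 19)).eval ρ = σ₀.mat u l := by
          rw [Ex.eval_row, Ex.eval_var, Ex.eval_var, g19, g22, hF'.mat hL hu hl]
        have f3 : (Ex.row' (.var 20) (.var 19)).eval ρ = σ₀.mat' i l := by
          rw [Ex.eval_row', Ex.eval_var, Ex.eval_var, g19, g20, hF'.mat' hL hi hl]
        rw [hval, Ex.eval_sub, Ex.eval_add, Ex.eval_ne_of f1 f3, Ex.eval_ne_of f2 f3, Ex.eval_raw,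
          e, ← gO]
        rfl
      have e2 : τ.out v i + pairDist σ₀.mat σ₀.mat' l u i = _ := hTd i le_rfl hi
      -- Columns up to `l` account for at most the whole distance of `u`; hence the truncated
      -- subtraction of the old indicator is exact.
      have e3 := pairDist_mono σ₀.mat σ₀.mat' (show l + 1 ≤ σ₀.v 1 from hl) u i
      rw [pairDist_succ] at e3 ⊢
      rw [pairDist_succ]
      omega
    refine ⟨by simp, ?_, ?_, fun _ => ?_, ?_⟩
    · have h1 := hF'.row_lt hL hv hl
      have h2 := hF'.row_lt hL hu hl
      have h3 := hF'.col_lt hL hi hl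
      have h4 := hF'.out_lt hL hv hi
      simp [g19, g20, g21, g22, h1, h2, h3, h4]
    · rw [e]; exact hF'.out_lt hL hv hi
    · rw [← hval]
      have h1 := pairDist_le σ₀.mat σ₀.mat' (σ₀.v 1) u i
      have h2 := pairDist_le σ₀.mat σ₀.mat' (l + 1) v i
      omega
    · rw [e, ← hval]
      refine ⟨(hF'.putRaw _ _).tick, g18, g21, g22, g19, fun j hj hj' => ?_, fun j hj hj' => ?_,
        fun v' hv' hne j hj => ?_, by simp [gk]; omega⟩
      · unfold Hybrid
        rw [St.out_tick, hF'.out_putRaw hL hv hi hv hj']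
        by_cases hji : j = i
        · subst hji; simpa using hval'
        · rw [if_neg (by tauto), gO]; exact hD j (by omega) hj'
      · unfold Hybrid
        rw [St.out_tick, hF'.out_putRaw hL hv hi hv hj', if_neg (by omega), gO]
        exact hTd j (by omega) hj'
      · rw [St.out_tick, hF'.out_putRaw hL hv hi hv' hj, if_neg (by tauto), gO]
        exact hO v' hv' hne j hj
  · rintro τ ⟨hF, e18, e21, e22, e19, hD, hTd, hO, hk⟩
    exact hQ τ hF e18 e21 e22 (fun j hj => hD j hj hj) hO (by omega)

end
section
variable {ω : ℕ → Bool} {b s B : ℕ} {σ : St}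

/-- Copy an output row. -/
def copyStm : Stm :=
  .loop 20 (.var 10) (.putRaw (.outAddr (.var 21) (.var 20)) (.raw (.outAddr (.var 22) (.var 20))))

theorem copyStm_wp {Q : St → Prop} {σ₀ : St} {u v : ℕ} (hL : Layout b σ₀)
    (hσ : OutFrame σ₀ σ) (h21 : σ.v 21 = v) (h22 : σ.v 22 = u)
    (hv : v < σ₀.v 6) (hu : u < σ₀.v 6) (huv : u ≠ v)
    (hQ : ∀ τ, OutFrame σ₀ τ → τ.v 18 = σ.v 18 → τ.v 21 = v → τ.v 22 = u →
      (∀ j < σ₀.v 10, τ.out v j = σ.out u j) →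
      (∀ v' < σ₀.v 6, v' ≠ v → ∀ j < σ₀.v 10, τ.out v' j = σ.out v' j) →
      τ.clk ≤ σ.clk + 1 + 2 * σ₀.v 10 → Q τ) :
    copyStm.wp ω b (s + 8) B Q σ := by
  refine Stm.wp_loop (fun i τ => OutFrame σ₀ τ ∧ τ.v 18 = σ.v 18 ∧ τ.v 21 = v ∧ τ.v 22 = u ∧
      (∀ j < i, j < σ₀.v 10 → τ.out v j = σ.out u j) ∧
      (∀ v' < σ₀.v 6, v' ≠ v → ∀ j < σ₀.v 10, τ.out v' j = σ.out v' j) ∧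
      τ.clk ≤ σ.clk + 1 + i * 2) (σ₀.v 10) (hσ.v 10 (by decide)) (by simp) (fun h => ?_) ?_ ?_ ?_
  · rw [← hσ.v 10 (by decide)]; exact h.v 10
  · exact ⟨hσ.tick, rfl, h21, h22, fun j hj => by omega, fun _ _ _ _ _ => rfl, by simp⟩
  · rintro i hi τ ⟨hF, e18, e21, e22, hD, hO, hk⟩
    have hF' := (hF.set (x := 20) (by decide) i).tick
    set ρ := (τ.set 20 i).tick with hρ
    have g18 : ρ.v 18 = σ.v 18 := by simpa [hρ] using e18
    have g21 : ρ.v 21 = v := by simpa [hρ] using e21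
    have g22 : ρ.v 22 = u := by simpa [hρ] using e22
    have g20 : ρ.v 20 = i := by simp [hρ]
    have gO : ρ.out = τ.out := by rw [hρ, St.out_tick, St.out_set _ (by decide)]
    have gk : ρ.clk = τ.clk + 1 := rfl
    clear_value ρ
    have e : (Ex.outAddr (.var 21) (.var 20)).eval ρ = ρ.v 3 + (v * ρ.v 14 + i * ρ.v 15) := by
      simp [g20, g21]
    have e' : (Ex.raw (.outAddr (.var 22) (.var 20))).eval ρ = σ.out u i := by
      rw [← hO u hu huv i hi, ← gO]
      simp only [Ex.eval_raw, Ex.eval_outAddr, Ex.eval_var, g22, g20]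
      rfl
    refine ⟨by simp, ?_, ?_, fun h => h.lo _, ?_⟩
    · simpa [g20, g22] using hF'.out_lt hL hu hi
    · rw [e]; exact hF'.out_lt hL hv hi
    · rw [e, e']
      refine ⟨(hF'.putRaw _ _).tick, g18, g21, g22, fun j hj hj' => ?_,
        fun v' hv' hne j hj => ?_, by simp [gk]; omega⟩
      · rw [St.out_tick, hF'.out_putRaw hL hv hi hv hj']
        by_cases hji : j = i
        · subst hji; simp
        · rw [if_neg (by tauto), gO]; exact hD j (by omega) hj'
      · rw [St.out_tick, hF'.out_putRaw hL hv hi hv' hj, if_neg (by tauto), gO]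
        exact hO v' hv' hne j hj
  · rintro τ ⟨hF, e18, e21, e22, hD, hO, hk⟩
    exact hQ τ hF e18 e21 e22 (fun j hj => hD j hj hj) hO (by omega)

/-- Compute the output rows but the first one, along the parent table in array `j`. -/
def otherRowsStm (j : ℕ) : Stm :=
  .loop 18 (.var 6 - .lit 1) (.seq (.assign 21 (.var 18 + .lit 1))
    (.seq (.assign 22 (.arr (.lit j) (.var 21))) (.seq copyStm
      (.loop 19 (.var 1) (.ite (.ne (.row (.var 22) (.var 19)) (.row (.var 21) (.var 19)))
        updateStm .skip)))))

/-- Since parents precede their children, the parent's output row is already right when it is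
copied. Only columns in which the rows differ trigger an update of `m` entries, so the total work
beyond comparisons and copying is proportional to `m` times the cost of the table. -/
theorem otherRowsStm_wp {Q : St → Prop} {t : ℕ} (ht : t = 3 ∨ t = 4) (hq : 2 * σ.v 1 ≤ B)
    (hL : Layout b σ) (hn : 0 < σ.v 6) (hpar : ∀ v < σ.v 6, 0 < v → σ.a t v < v)
    (h0 : ∀ j < σ.v 10, σ.out 0 j = pairDist σ.mat σ.mat' (σ.v 1) 0 j)
    (hQ : ∀ τ, OutFrame σ τ →
      (∀ v < σ.v 6, ∀ j < σ.v 10, τ.out v j = pairDist σ.mat σ.mat' (σ.v 1) v j) →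
      τ.clk ≤ σ.clk + 1 + σ.v 6 * (5 + 2 * σ.v 10 + 3 * σ.v 1) +
        2 * σ.v 10 * tableCost σ.mat (σ.v 1) (σ.v 6) (σ.a t) → Q τ) :
    (otherRowsStm t).wp ω b (s + 8) B Q σ := by
  set X := σ.mat with hX
  set Y := σ.mat' with hY
  set q := σ.v 1 with hq'
  set n := σ.v 6 with hn'
  set m := σ.v 10 with hm
  refine Stm.wp_loop (fun i τ => OutFrame σ τ ∧
    (∀ v < i + 1, ∀ j < m, τ.out v j = pairDist X Y q v j) ∧
    τ.clk ≤ σ.clk + 1 + i * (5 + 2 * m + 3 * q) + 2 * m * tableCost X q (i + 1) (σ.a t)) (n - 1) rfl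
    (by simp) (fun h => (Nat.sub_le _ _).trans (h.v 6)) ?_ ?_ ?_
  · refine ⟨(OutFrame.refl _).tick, fun v hv j hj => ?_, by simp⟩
    obtain rfl : v = 0 := by omega
    exact h0 j hj
  · rintro i hi τ ⟨hF, hO, hk⟩
    have hv : i + 1 < n := by omega
    refine ⟨by simp, fun h => ?_, by simp; omega, fun h => h.a _ _, ?_⟩
    · have h1 := h.v 6
      have h2 := hF.v 6 (by decide)
      simp at h1 ⊢
      omega
    have F₁ := (hF.set (x := 18) (by decide) i).tick
    have F₂ := (F₁.set (x := 21) (by decide) ((Ex.var 18 + .lit 1).eval (τ.set 18 i).tick)).tick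
    have F₃ := (F₂.set (x := 22) (by decide) ((Ex.arr (.lit t) (.var 21)).eval
      ((τ.set 18 i).tick.set 21 ((Ex.var 18 + .lit 1).eval (τ.set 18 i).tick)).tick)).tick
    set ρ := (St.set (St.tick (St.set (τ.set 18 i).tick 21 _)) 22 _).tick with hρ
    have g18 : ρ.v 18 = i := by simp [hρ]
    have g21 : ρ.v 21 = i + 1 := by simp [hρ]
    have g22 : ρ.v 22 = σ.a t (i + 1) := by simp [hρ, hF.a]
    have gO : ρ.out = τ.out := by
      rw [hρ, St.out_tick, St.out_set _ (by decide), St.out_tick, St.out_set _ (by decide),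
        St.out_tick, St.out_set _ (by decide)]
    have gk : ρ.clk = τ.clk + 3 := rfl
    clear_value ρ
    have hpv := hpar (i + 1) hv (by omega)
    set u := σ.a t (i + 1) with hu'
    have hu : u < n := by omega
    refine copyStm_wp hL F₃ g21 g22 hv hu (by omega) fun ρ' F₄ c18 c21 c22 cD cO ck => ?_
    refine Stm.wp_loop (fun l π => OutFrame σ π ∧ π.v 21 = i + 1 ∧ π.v 22 = u ∧
      (∀ j < m, Hybrid X Y π.out q l u (i + 1) j) ∧
      (∀ v' < n, v' ≠ i + 1 → ∀ j < m, π.out v' j = τ.out v' j) ∧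
      π.clk ≤ τ.clk + 5 + 2 * m + l * 3 + 2 * m * rowDist X l u (i + 1)) q (F₄.v 1 (by decide))
      (by simp) (fun h => ?_) ?_ ?_ ?_
    · omega
    -- For `l = 0` the hybrid row is the row of the parent, which has just been copied.
    · refine ⟨F₄.tick, c21, c22, fun j hj => ?_, fun v' hv' hne j hj => ?_, ?_⟩
      · unfold Hybrid
        rw [St.out_tick, cD j hj, gO, pairDist_zero, pairDist_zero, hO u (by omega) j hj]
      · rw [St.out_tick, cO v' hv' hne j hj, gO]
      · rw [rowDist_zero]; simp; omega
    · rintro l hl π ⟨pF, p21, p22, pH, pO, pk⟩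
      have pF' := (pF.set (x := 19) (by decide) l).tick
      set χ := (π.set 19 l).tick with hχ
      have x21 : χ.v 21 = i + 1 := by simpa [hχ] using p21
      have x22 : χ.v 22 = u := by simpa [hχ] using p22
      have x19 : χ.v 19 = l := by simp [hχ]
      have xO : χ.out = π.out := by rw [hχ, St.out_tick, St.out_set _ (by decide)]
      have xk : χ.clk = π.clk + 1 := rfl
      clear_value χ
      have f1 : (Ex.row (.var 22) (.var 19)).eval χ = X u l := by
        rw [Ex.eval_row, Ex.eval_var, Ex.eval_var, x19, x22, pF'.mat hL hu hl]
      have f2 : (Ex.row (.var 21) (.var 19)).eval χ = X (i + 1) l := by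
        rw [Ex.eval_row, Ex.eval_var, Ex.eval_var, x19, x21, pF'.mat hL hv hl]
      refine ⟨?_, fun hne => ?_, fun heq => ?_⟩
      · have h1 := pF'.row_lt hL hv hl
        have h2 := pF'.row_lt hL hu hl
        simp [x19, x21, x22, h1, h2]
      · rw [Ex.eval_ne_of f1 f2] at hne
        have hX : X u l ≠ X (i + 1) l := by by_contra h; exact hne (if_neg (not_not.2 h))
        refine updateStm_wp hq hL pF'.tick x21 x22 x19 hv hu hl
          (by rw [St.out_tick, xO]; exact pH) fun π' qF q18 q21 q22 qH qO qk => ?_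
        refine ⟨qF, q21, q22, qH, fun v' hv' hne j hj => ?_, ?_⟩
        · rw [qO v' hv' hne j hj, St.out_tick, xO, pO v' hv' hne j hj]
        · rw [rowDist_succ, if_pos hX, mul_add]
          rw [St.tick_clk] at qk
          omega
      · rw [Ex.eval_ne_of f1 f2] at heq
        have hX : X u l = X (i + 1) l := by
          by_contra h; rw [if_pos h] at heq; exact one_ne_zero heq
        -- Where the rows agree, both indicators coincide and the hybrid row needs no change.
        refine ⟨pF'.tick.tick, x21, x22, fun j hj => ?_, fun v' hv' hne j hj => ?_, ?_⟩
        · have := pH j hj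
          unfold Hybrid at this ⊢
          rw [St.out_tick, St.out_tick, xO, pairDist_succ, pairDist_succ, hX]
          omega
        · rw [St.out_tick, St.out_tick, xO, pO v' hv' hne j hj]
        · rw [rowDist_succ, if_neg (not_not.2 hX), add_zero]
          simp only [St.tick_clk]
          omega
    · rintro π ⟨pF, p21, p22, pH, pO, pk⟩
      refine ⟨pF, fun v hv' j hj => ?_, ?_⟩
      · by_cases e : v = i + 1
        · subst e
          have := pH j hj
          unfold Hybrid at this
          omega
        · rw [pO v (by omega) e j hj]
          exact hO v (by omega) j hj
      · have e1 : tableCost X q (i + 1 + 1) (σ.a t) =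
            tableCost X q (i + 1) (σ.a t) + rowDist X q u (i + 1) := by
          rw [tableCost, tableCost, Finset.sum_range_succ]
        have e2 : (i + 1) * (5 + 2 * m + 3 * q) =
          i * (5 + 2 * m + 3 * q) + (5 + 2 * m + 3 * q) := by ring
        rw [e1, e2, mul_add (2 * m)]
        omega
  · rintro τ ⟨hF, hO, hk⟩
    rw [Nat.sub_add_cancel hn] at hO hk
    refine hQ τ hF hO (hk.trans ?_)
    gcongr
    omega

/-- Compute all output rows along the parent table in array `j`. -/
def outputStm (j : ℕ) : Stm := .seq firstRowStm (otherRowsStm j)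

theorem outputStm_wp {Q : St → Prop} {t : ℕ} (ht : t = 3 ∨ t = 4) (hq : 2 * σ.v 1 ≤ B)
    (hL : Layout b σ) (hn : 0 < σ.v 6) (hpar : ∀ v < σ.v 6, 0 < v → σ.a t v < v)
    (hz : σ.a t 0 = 0)
    (hQ : ∀ τ, OutFrame σ τ →
      (∀ v < σ.v 6, ∀ j < σ.v 10, τ.out v j = pairDist σ.mat σ.mat' (σ.v 1) v j) →
      τ.clk ≤ σ.clk + 2 + σ.v 10 * (4 + 2 * σ.v 1) + σ.v 6 * (5 + 2 * σ.v 10 + 3 * σ.v 1) +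
        2 * σ.v 10 * tableCost σ.mat (σ.v 1) (σ.v 6) (σ.a t) → Q τ) :
    (outputStm t).wp ω b (s + 8) B Q σ := by
  refine firstRowStm_wp (by omega) hL hn fun τ hF h0 hk => ?_
  have e1 : τ.v 1 = σ.v 1 := hF.v 1 (by decide)
  have e3 : τ.v 3 = σ.v 3 := hF.v 3 (by decide)
  have e6 : τ.v 6 = σ.v 6 := hF.v 6 (by decide)
  have e10 : τ.v 10 = σ.v 10 := hF.v 10 (by decide)
  have e14 : τ.v 14 = σ.v 14 := hF.v 14 (by decide)
  have e15 : τ.v 15 = σ.v 15 := hF.v 15 (by decide)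
  have hL' : Layout b τ := by
    constructor
    · rw [e3]; exact hL.le
    · rw [e3, e6, e1, hF.v 7 (by decide), hF.v 8 (by decide), hF.v 9 (by decide)]; exact hL.rows
    · rw [e3, e10, e1, hF.v 11 (by decide), hF.v 12 (by decide), hF.v 13 (by decide)]
      exact hL.cols
    · rw [e3, e6, e10, e14, e15]; exact hL.out
    · rw [e6, e10, e14, e15]; exact hL.inj
  have hpd : ∀ v < σ.v 6, ∀ j < σ.v 10,
      pairDist τ.mat τ.mat' (σ.v 1) v j = pairDist σ.mat σ.mat' (σ.v 1) v j := by
    intro v hv j hj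
    unfold pairDist
    congr 1
    refine Finset.filter_congr fun l hl => ?_
    rw [hF.mat hL hv (Finset.mem_range.1 hl), hF.mat' hL hj (Finset.mem_range.1 hl)]
  have htc : tableCost τ.mat (σ.v 1) (σ.v 6) (σ.a t) =
      tableCost σ.mat (σ.v 1) (σ.v 6) (σ.a t) := by
    refine Finset.sum_congr rfl fun v hv => ?_
    have hv' := Finset.mem_range.1 hv
    have hp : σ.a t v < σ.v 6 := by
      rcases Nat.eq_zero_or_pos v with rfl | h
      · rwa [hz]
      · exact (hpar v hv' h).trans hv'
    unfold rowDist
    congr 1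
    refine Finset.filter_congr fun l hl => ?_
    rw [hF.mat hL hv' (Finset.mem_range.1 hl),
      hF.mat hL hp (Finset.mem_range.1 hl)]
  refine otherRowsStm_wp ht (by rwa [e1]) hL' (by rwa [e6]) (by rw [e6, hF.a]; exact hpar) ?_ ?_
  · rw [e10, e1]
    intro j hj
    rw [h0 j hj, hpd 0 hn j hj]
  · rw [e6, e10, e1, hF.a, htc]
    intro τ' gF gO gk
    refine hQ τ' ⟨fun x hx => (gF.v x hx).trans (hF.v x hx), fun i hi => ?_, gF.a.trans hF.a,
      gF.coins.trans hF.coins⟩ (fun v hv j hj => ?_) (by omega)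
    · rw [gF.lo i (by rwa [e3]), hF.lo i hi]
    · rw [gO v hv j hj, hpd v hv j hj]

end
section
variable {ω : ℕ → Bool} {b s B : ℕ} {σ : St}

/-! ### Input size, choice of the side, and the whole program -/

/-- Compute the input size (variable `3`), a bound `lam` for its binary logarithm (variable `4`),
and the number `a * lam` of trials (variable `5`). -/
def setupStm (a : ℕ) : Stm :=
  .seq (.assign 3 (.var 0 * .var 1 + .var 1 * .var 2)) (.seq (.assign 4 (.lit 0))
    (.seq (.assign 23 (.lit 1)) (.seq
      (.loop 20 (.var 3) (.ite (.var 3 - .var 23)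
        (.seq (.assign 23 (.var 23 + .var 23)) (.assign 4 (.var 4 + .lit 1))) .skip))
      (.assign 5 (.lit a * .var 4)))))

/-- Only the variables `3`, `4`, `5` and those from `17` on have changed. -/
structure SetupFrame (σ τ : St) : Prop where
  v0 : τ.v 0 = σ.v 0
  v1 : τ.v 1 = σ.v 1
  v2 : τ.v 2 = σ.v 2
  lo : τ.lo = σ.lo
  a : τ.a = σ.a
  coins : τ.coins = σ.coins

/-- Doubling stops as soon as `N` is reached, so the power stays below `2 * N`. `N` rounds suffice,
since without stopping the exponent would reach `N < 2 ^ N`; this linear loop fits into the time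
bound. -/
theorem setupStm_wp {Q : St → Prop} {a N : ℕ} (hN : σ.v 0 * σ.v 1 + σ.v 1 * σ.v 2 = N)
    (hN0 : 1 ≤ N) (hB : 2 * N ≤ B) (hBa : a * (2 * N) ≤ B)
    (hQ : ∀ τ, SetupFrame σ τ → τ.v 3 = N → N ≤ 2 ^ τ.v 4 → 2 ^ τ.v 4 < 2 * N →
      τ.v 5 = a * τ.v 4 → τ.clk ≤ σ.clk + 5 + N * 4 → Q τ) :
    (setupStm a).wp ω b (s + 8) B Q σ := by
  refine ⟨by simp, fun _ => ?_, by simp, fun _ => Nat.zero_le _, by simp, fun _ => ?_, ?_⟩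
  · simp [hN]; omega
  · simp; omega
  refine Stm.wp_loop (fun i τ => SetupFrame σ τ ∧ τ.v 3 = N ∧ τ.v 23 = 2 ^ τ.v 4 ∧
    τ.v 23 < 2 * N ∧ (N ≤ τ.v 23 ∨ i ≤ τ.v 4) ∧ τ.clk ≤ σ.clk + 4 + i * 4) N ?_ (by simp)
    (fun _ => by omega) ?_ ?_ ?_
  · simp [hN]
  · refine ⟨⟨by simp, by simp, by simp, rfl, rfl, rfl⟩, by simp [hN], by simp, ?_, Or.inr (by simp),
      by simp⟩
    simp; omega
  · rintro i hi τ ⟨hF, h3, h23, hlt, hor, hk⟩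
    refine ⟨by simp, fun hne => ?_, fun heq => ?_⟩
    · simp [h3] at hne
      have hlam : τ.v 4 < 2 ^ τ.v 4 := Nat.lt_two_pow_self
      refine ⟨by simp, fun _ => ?_, by simp, fun _ => ?_, ?_⟩
      · simp; omega
      · simp; omega
      · refine ⟨⟨by simp [hF.v0], by simp [hF.v1], by simp [hF.v2], hF.lo, hF.a, hF.coins⟩,
          by simp [h3], ?_, ?_, ?_, ?_⟩
        · simp [pow_succ, ← h23]; ring
        · simp; omega
        · simp; omega
        · simp; omega
    · simp [h3] at heq
      refine ⟨⟨by simp [hF.v0], by simp [hF.v1], by simp [hF.v2], hF.lo, hF.a, hF.coins⟩,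
        by simp [h3], by simpa using h23, by simpa using hlt, Or.inl (Nat.sub_eq_zero_iff_le.1 heq), ?_⟩
      simp; omega
  · rintro τ ⟨hF, h3, h23, hlt, hor, hk⟩
    have hlam : τ.v 4 < 2 ^ τ.v 4 := Nat.lt_two_pow_self
    refine ⟨by simp, fun _ => ?_, ?_⟩
    · simp only [Ex.eval_mul, Ex.eval_lit, Ex.eval_var]
      exact (Nat.mul_le_mul_left a (by omega)).trans hBa
    · refine hQ _ ⟨by simp [hF.v0], by simp [hF.v1], by simp [hF.v2], hF.lo, hF.a, hF.coins⟩
        (by simp [h3]) ?_ ?_ (by simp) ?_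
      · simp; omega
      · simp; omega
      · simp; omega

/-- Select the rows of `A`. -/
def selectAStm : Stm :=
  .seq (.assign 6 (.var 0)) (.seq (.assign 7 (.lit 0)) (.seq (.assign 8 (.var 1))
    (.assign 9 (.lit 1))))

/-- Select the columns of `B`. -/
def selectBStm : Stm :=
  .seq (.assign 6 (.var 2)) (.seq (.assign 7 (.var 0 * .var 1)) (.seq (.assign 8 (.lit 1))
    (.assign 9 (.var 2))))

/-- Compute the output along the parent table of the rows of `A`. -/
def outputAStm : Stm :=
  .seq selectAStm (.seq (.assign 10 (.var 2)) (.seq (.assign 11 (.var 0 * .var 1))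
    (.seq (.assign 12 (.lit 1)) (.seq (.assign 13 (.var 2)) (.seq (.assign 14 (.var 2))
      (.seq (.assign 15 (.lit 1)) (outputStm 3)))))))

/-- Compute the output along the parent table of the columns of `B`. -/
def outputBStm : Stm :=
  .seq selectBStm (.seq (.assign 10 (.var 0)) (.seq (.assign 11 (.lit 0))
    (.seq (.assign 12 (.var 1)) (.seq (.assign 13 (.lit 1)) (.seq (.assign 14 (.lit 1))
      (.seq (.assign 15 (.var 2)) (outputStm 4)))))))

/-- The program. -/
def mainStm (s a : ℕ) : Stm :=
  .seq (setupStm a) (.seq selectAStm (.seq (treeStm s 3) (.seq (.assign 16 (.var 17))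
    (.seq selectBStm (.seq (treeStm s 4) (.ite (.var 2 * .var 16 - .var 0 * .var 17)
      outputBStm outputAStm))))))

theorem pairDist_comm (X Y : ℕ → ℕ → ℕ) (q i j : ℕ) : pairDist X Y q i j = pairDist Y X q j i := by
  unfold pairDist; congr 1; exact Finset.filter_congr fun l _ => ne_comm

theorem index_inj {r v j v' j' : ℕ} (hj : j < r) (hj' : j' < r) (h : v * r + j = v' * r + j') :
    v = v' ∧ j = j' := by
  have h1 : (j + r * v) / r = (j' + r * v') / r := by congr 1; linarith
  have h2 : (j + r * v) % r = (j' + r * v') % r := by congr 1; linarith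
  rw [Nat.add_mul_div_left _ _ (by omega), Nat.add_mul_div_left _ _ (by omega),
    Nat.div_eq_of_lt hj, Nat.div_eq_of_lt hj'] at h1
  rw [Nat.add_mul_mod_self_left, Nat.add_mul_mod_self_left, Nat.mod_eq_of_lt hj,
    Nat.mod_eq_of_lt hj'] at h2
  omega

theorem index_lt {p q i l : ℕ} (hi : i < p) (hl : l < q) : i * q + l < p * q := by
  calc i * q + l < i * q + q := by omega
    _ = (i + 1) * q := by ring
    _ ≤ p * q := Nat.mul_le_mul_right _ hi

/-- The input dimensions are in the variables `0`, `1`, `2`, and the entries are less than `s`. -/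
structure Input (s p q r : ℕ) (lo : ℕ → ℕ) (σ : St) : Prop where
  v0 : σ.v 0 = p
  v1 : σ.v 1 = q
  v2 : σ.v 2 = r
  entry : ∀ i < p * q + q * r, lo i < s

theorem outputAStm_wp {Q : St → Prop} {p q r N : ℕ} {lo : ℕ → ℕ} (hI : Input s p q r lo σ)
    (hlo : σ.lo = lo) (hN : N = p * q + q * r) (h3 : σ.v 3 = N) (hb : b = N + p * r) (hp : 0 < p)
    (hq0 : 0 < q) (hB : 2 * N ≤ B)
    (hpar : ∀ v < p, 0 < v → σ.a 3 v < v) (hz : σ.a 3 0 = 0)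
    (hQ : ∀ τ, (∀ i < p, ∀ j < r, τ.lo (N + (i * r + j)) =
        pairDist (mat lo 0 q 1) (mat lo (p * q) 1 r) q i j) →
      τ.clk ≤ σ.clk + 12 + r * (4 + 2 * q) + p * (5 + 2 * r + 3 * q) +
        2 * r * tableCost (mat lo 0 q 1) q p (σ.a 3) → Q τ) :
    outputAStm.wp ω b (s + 8) B Q σ := by
  have hpq : p ≤ p * q := Nat.le_mul_of_pos_right _ hq0
  have hqp : q ≤ p * q := Nat.le_mul_of_pos_left _ hp
  have hrq : r ≤ q * r := Nat.le_mul_of_pos_left _ hq0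
  have e0 := hI.v0
  have e1 := hI.v1
  have e2 := hI.v2
  refine ⟨by simp, fun h => h.v _, by simp, fun _ => Nat.zero_le _, by simp, fun h => h.v _,
    by simp, fun _ => ?_, by simp, fun h => h.v _, by simp, fun _ => ?_, by simp, fun _ => ?_,
    by simp, fun h => h.v _, by simp, fun h => h.v _, by simp, fun _ => ?_, ?_⟩
  · simp; omega
  · simp [e0, e1]; omega
  · simp; omega
  · simp; omega
  refine outputStm_wp (Or.inl rfl) ?_ ⟨?_, ?_, ?_, ?_, ?_⟩ ?_ ?_ ?_ ?_
  · simp [e1]; omega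
  · simp [h3]; omega
  · simp [e0, e1, h3]
    intro v hv l hl
    have := index_lt hv hl; omega
  · simp [e0, e1, e2, h3]
    intro j hj l hl
    have := index_lt hl hj; omega
  · simp [e0, e2, h3]
    intro v hv j hj
    have := index_lt hv hj; omega
  · simp [e0, e2]
    intro v hv j hj v' hv' j' hj' h
    exact index_inj hj hj' h
  · simp [e0]; omega
  · simpa [e0] using hpar
  · simpa using hz
  · intro τ hF hO hk
    have g3 : τ.v 3 = N := (hF.v 3 (by decide)).trans (by simp [h3])
    have g14 : τ.v 14 = r := (hF.v 14 (by decide)).trans (by simp [e2])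
    have g15 : τ.v 15 = 1 := (hF.v 15 (by decide)).trans (by simp)
    refine hQ τ (fun i hi j hj => ?_) ?_
    · have := hO i (by simpa [e0] using hi) j (by simpa [e2] using hj)
      simp only [St.out, mat, g3, g14, g15, mul_one] at this
      rw [this]
      simp [St.mat, St.mat', e0, e1, e2, hlo]
    · simpa [e0, e1, e2, hlo, St.mat] using hk

/-- The transposed problem: the strides of both inputs and of the output are exchanged and the same
code runs with the columns of `B` as rows. The Hamming distance is symmetric, so the result is the
same matrix. -/
theorem outputBStm_wp {Q : St → Prop} {p q r N : ℕ} {lo : ℕ → ℕ} (hI : Input s p q r lo σ)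
    (hlo : σ.lo = lo) (hN : N = p * q + q * r) (h3 : σ.v 3 = N) (hb : b = N + p * r) (hp : 0 < p)
    (hq0 : 0 < q) (hr : 0 < r) (hB : 2 * N ≤ B)
    (hpar : ∀ v < r, 0 < v → σ.a 4 v < v) (hz : σ.a 4 0 = 0)
    (hQ : ∀ τ, (∀ i < p, ∀ j < r, τ.lo (N + (i * r + j)) =
        pairDist (mat lo 0 q 1) (mat lo (p * q) 1 r) q i j) →
      τ.clk ≤ σ.clk + 12 + p * (4 + 2 * q) + r * (5 + 2 * p + 3 * q) +
        2 * p * tableCost (mat lo (p * q) 1 r) q r (σ.a 4) → Q τ) :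
    outputBStm.wp ω b (s + 8) B Q σ := by
  have hpq : p ≤ p * q := Nat.le_mul_of_pos_right _ hq0
  have hqp : q ≤ p * q := Nat.le_mul_of_pos_left _ hp
  have hrq : r ≤ q * r := Nat.le_mul_of_pos_left _ hq0
  have e0 := hI.v0
  have e1 := hI.v1
  have e2 := hI.v2
  refine ⟨by simp, fun h => h.v _, by simp, fun _ => ?_, by simp, fun _ => ?_,
    by simp, fun h => h.v _, by simp, fun h => h.v _, by simp, fun _ => Nat.zero_le _, by simp,
    fun h => h.v _, by simp, fun _ => ?_, by simp, fun _ => ?_, by simp, fun h => h.v _, ?_⟩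
  · simp [e0, e1]; omega
  · simp; omega
  · simp; omega
  · simp; omega
  refine outputStm_wp (Or.inr rfl) ?_ ⟨?_, ?_, ?_, ?_, ?_⟩ ?_ ?_ ?_ ?_
  · simp [e1]; omega
  · simp [h3]; omega
  · simp [e0, e1, e2, h3]
    intro v hv l hl
    have := index_lt hl hv; omega
  · simp [e0, e1, h3]
    intro j hj l hl
    have := index_lt hj hl; omega
  · simp [e0, e2, h3]
    intro v hv j hj
    have := index_lt hj hv; omega
  · simp [e0, e2]
    intro v hv j hj v' hv' j' hj' h
    exact (index_inj (v := j) (v' := j') hv hv' (by omega)).symm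
  · simp [e2]; omega
  · simpa [e2] using hpar
  · simpa using hz
  · intro τ hF hO hk
    have g3 : τ.v 3 = N := (hF.v 3 (by decide)).trans (by simp [h3])
    have g14 : τ.v 14 = 1 := (hF.v 14 (by decide)).trans (by simp)
    have g15 : τ.v 15 = r := (hF.v 15 (by decide)).trans (by simp [e2])
    refine hQ τ (fun i hi j hj => ?_) ?_
    · have := hO j (by simpa [e2] using hj) i (by simpa [e0] using hi)
      simp only [St.out, mat, g3, g14, g15, mul_one] at this
      rw [add_comm (i * r), this, pairDist_comm]
      simp [St.mat, St.mat', e0, e1, e2, hlo]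
    · simpa [e0, e1, e2, hlo, St.mat] using hk

end
section
variable {ω : ℕ → Bool} {b s B : ℕ} {σ : St}

theorem selectAStm_wp {Q : St → Prop} (hB : 1 ≤ B)
    (hQ : ∀ τ, Frame 6 (fun _ => False) σ τ → (∀ x : Fin 32, 10 ≤ (x : ℕ) → τ.v x = σ.v x) →
      τ.coins = σ.coins → τ.v 6 = σ.v 0 → τ.v 7 = 0 → τ.v 8 = σ.v 1 → τ.v 9 = 1 →
      τ.clk = σ.clk + 4 → Q τ) : selectAStm.wp ω b (s + 8) B Q σ := by
  refine ⟨by simp, fun h => h.v _, by simp, fun _ => Nat.zero_le _, by simp, fun h => h.v _,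
    by simp, fun _ => hB, ?_⟩
  refine hQ _ ((((Frame.refl _ _ _).set (by decide) _).tick.set (by decide) _).tick.set
    (by decide) _ |>.tick.set (by decide) _).tick (fun x hx => ?_) rfl (by simp) (by simp) (by simp)
    (by simp) rfl
  have h6 : x ≠ 6 := by rintro rfl; revert hx; decide
  have h7 : x ≠ 7 := by rintro rfl; revert hx; decide
  have h8 : x ≠ 8 := by rintro rfl; revert hx; decide
  have h9 : x ≠ 9 := by rintro rfl; revert hx; decide
  simp [h6, h7, h8, h9]

theorem selectBStm_wp {Q : St → Prop} (hB : 1 ≤ B) (hB' : σ.v 0 * σ.v 1 ≤ B)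
    (hQ : ∀ τ, Frame 6 (fun _ => False) σ τ → (∀ x : Fin 32, 10 ≤ (x : ℕ) → τ.v x = σ.v x) →
      τ.coins = σ.coins → τ.v 6 = σ.v 2 → τ.v 7 = σ.v 0 * σ.v 1 → τ.v 8 = 1 → τ.v 9 = σ.v 2 →
      τ.clk = σ.clk + 4 → Q τ) : selectBStm.wp ω b (s + 8) B Q σ := by
  refine ⟨by simp, fun h => h.v _, by simp, fun _ => ?_, by simp, fun _ => hB,
    by simp, fun h => h.v _, ?_⟩
  · simpa using hB'
  refine hQ _ ((((Frame.refl _ _ _).set (by decide) _).tick.set (by decide) _).tick.set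
    (by decide) _ |>.tick.set (by decide) _).tick (fun x hx => ?_) rfl (by simp) (by simp) (by simp)
    (by simp) rfl
  have h6 : x ≠ 6 := by rintro rfl; revert hx; decide
  have h7 : x ≠ 7 := by rintro rfl; revert hx; decide
  have h8 : x ≠ 8 := by rintro rfl; revert hx; decide
  have h9 : x ≠ 9 := by rintro rfl; revert hx; decide
  simp [h6, h7, h8, h9]

/-- Everything is dominated by `W = (p + r) * (p + q + r)`, which is at least `N`, `(p + r) * q` and
`p * r`. The factor `(lam + 1) ^ 2` comes from `a * lam` trials with `lam + 1` phases each. -/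
theorem main_clock {a p q r lam N c x m : ℕ} (hp : 0 < p) (hq : 0 < q) (hr : 0 < r)
    (hN : N = p * q + q * r) (hm : m = a * lam)
    (hc : c ≤ 40 + N * 4 + (m * ((lam + 1) * (p * q) * (2 * s + 50) + 1) +
      m * ((lam + 1) * (r * q) * (2 * s + 50) + 1)) + (p + r) * (5 + 3 * q) + 2 * (p * r) + 2 * x) :
    c ≤ (60 + a * (2 * s + 60)) * (lam + 1) ^ 2 * ((p + r) * (p + q + r)) + 2 * x := by
  set W := (p + r) * (p + q + r) with hW
  have e : W = (p + r) * q + (p * p + p * r + p * r + r * r) := by rw [hW]; ring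
  have w1 : N ≤ W := by rw [e, hN]; nlinarith
  have w2 : (p + r) * q ≤ W := by rw [e]; omega
  have w3 : p * r ≤ W := by rw [e]; omega
  have w4 : p + r ≤ (p + r) * q := Nat.le_mul_of_pos_right _ hq
  have w0 : 1 ≤ W := by omega
  have l1 : 1 ≤ (lam + 1) ^ 2 := Nat.one_le_pow _ _ (by omega)
  have l2 : W ≤ (lam + 1) ^ 2 * W := Nat.le_mul_of_pos_left _ l1
  have l3 : lam ≤ (lam + 1) ^ 2 := by nlinarith
  have l4 : lam * (lam + 1) ≤ (lam + 1) ^ 2 := by nlinarith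
  have t1 : m * ((lam + 1) * (p * q) * (2 * s + 50) + 1) +
      m * ((lam + 1) * (r * q) * (2 * s + 50) + 1) =
      a * (2 * s + 50) * (lam * (lam + 1)) * ((p + r) * q) + 2 * a * lam := by rw [hm]; ring
  have t2 : a * (2 * s + 50) * (lam * (lam + 1)) * ((p + r) * q) ≤
      a * (2 * s + 50) * (lam + 1) ^ 2 * W := by gcongr
  have t3 : 2 * a * lam ≤ 10 * a * (lam + 1) ^ 2 * W := by
    calc 2 * a * lam ≤ 10 * a * (lam + 1) ^ 2 := by gcongr; omega
      _ ≤ _ := Nat.le_mul_of_pos_right _ w0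
  have t4 : (60 + a * (2 * s + 60)) * (lam + 1) ^ 2 * W =
      60 * ((lam + 1) ^ 2 * W) + a * (2 * s + 50) * (lam + 1) ^ 2 * W +
        10 * a * (lam + 1) ^ 2 * W := by ring
  have t5 : (p + r) * (5 + 3 * q) = 5 * (p + r) + 3 * ((p + r) * q) := by ring
  omega

theorem output_clock (p q r : ℕ) :
    p * (4 + 2 * q) + r * (5 + 2 * p + 3 * q) ≤ (p + r) * (5 + 3 * q) + 2 * (p * r) := by
  have h1 : p * (4 + 2 * q) + r * (5 + 2 * p + 3 * q) + (p + p * q) =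
    (p + r) * (5 + 3 * q) + 2 * (p * r) := by ring
  omega

set_option maxHeartbeats 1000000 in
-- `cA` and `cB` are the costs of the tables found. Correctness holds for all coins; the dependence
-- on luck is isolated in the last two clauses, which refer to two consecutive ranges of coin
-- tosses, the second starting after the `a * lam * (q * lam)` tosses of the first search.
theorem mainStm_wp {p q r N a : ℕ} {lo : ℕ → ℕ} (hI : Input s p q r lo σ)
    (hlo : σ.lo = lo) (hN : N = p * q + q * r) (hb : b = N + p * r) (hp : 0 < p)
    (hq0 : 0 < q) (hr : 0 < r) (hs : s ≤ B) (hB : 2 * N + 1 ≤ B) (hBa : a * (2 * N) ≤ B)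
    (ha : ∀ j i, σ.a j i = 0) (hc : σ.coins = 0) (hk : σ.clk = 0) :
    (mainStm s a).wp ω b (s + 8) B (fun τ => (∀ i < p, ∀ j < r, τ.lo (N + (i * r + j)) =
        pairDist (mat lo 0 q 1) (mat lo (p * q) 1 r) q i j) ∧
      ∃ lam cA cB : ℕ, N ≤ 2 ^ lam ∧ 2 ^ lam < 2 * N ∧
        τ.clk ≤ (60 + a * (2 * s + 60)) * (lam + 1) ^ 2 * ((p + r) * (p + q + r)) +
          2 * min (r * cA) (p * cB) ∧
        (∀ (T : SimpleGraph (Fin p)) (L K : ℕ), T.Connected → 1 ≤ L →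
          (∃ k < a * lam, GoodLevels T (mat lo 0 q 1) q lam L K
            (fun i => ω (0 + (k * (q * lam) + i)))) → cA ≤ 2 * L * K) ∧
        (∀ (T : SimpleGraph (Fin r)) (L K : ℕ), T.Connected → 1 ≤ L →
          (∃ k < a * lam, GoodLevels T (mat lo (p * q) 1 r) q lam L K
            (fun i => ω (a * lam * (q * lam) + (k * (q * lam) + i)))) → cB ≤ 2 * L * K)) σ := by
  have hpq : p ≤ p * q := Nat.le_mul_of_pos_right _ hq0
  have hqp : q ≤ p * q := Nat.le_mul_of_pos_left _ hp
  have hrq : r * q ≤ N := by rw [hN, mul_comm r]; omega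
  refine setupStm_wp (N := N) (by rw [hI.v0, hI.v1, hI.v2, hN]) (by omega) (by omega) hBa ?_
  intro σ₁ F₁ v3 hlam1 hlam2 v5 k₁
  obtain ⟨lam, hlam⟩ : ∃ lam, lam = σ₁.v 4 := ⟨_, rfl⟩
  rw [← hlam] at hlam1 hlam2 v5
  have hlt : lam < 2 ^ lam := Nat.lt_two_pow_self
  have u0 := F₁.v0.trans hI.v0
  have u1 := F₁.v1.trans hI.v1
  have u2 := F₁.v2.trans hI.v2
  refine selectAStm_wp (by omega) fun σ₂ F₂ G₂ c₂ w6 w7 w8 w9 k₂ => ?_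
  rw [u0] at w6
  rw [u1] at w8
  have w1 : σ₂.v 1 = q := (F₂.v 1 (by decide)).trans u1
  have w4 : σ₂.v 4 = lam := (F₂.v 4 (by decide)).trans hlam.symm
  have w5 : σ₂.v 5 = a * lam := (F₂.v 5 (by decide)).trans v5
  have wlo : σ₂.lo = lo := F₂.lo.trans (F₁.lo.trans hlo)
  have wa : σ₂.a = σ.a := (funext fun j => F₂.a j (by simp)).trans F₁.a
  have wc : σ₂.coins = 0 := c₂.trans (F₁.coins.trans hc)
  have wm : σ₂.mat = mat lo 0 q 1 := by unfold St.mat; rw [wlo, w7, w8, w9]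
  have hR₂ : HasRows b s σ₂ := by
    constructor
    · rw [w6, w1, w7, w8, w9]
      intro v hv l hl
      have := index_lt hv hl; omega
    · rw [w6, w1, wm]
      intro v hv l hl
      have := index_lt hv hl
      exact hI.entry _ (by omega)
  refine treeStm_wp (Or.inl rfl) (by omega) hs (by omega) (by rw [w6, w1]; omega) hR₂ (by omega)
    (by omega) (by rw [wa]; exact ha 3) (by rw [w1, w4]; omega) ?_
  rw [w6, w1, w4, w5, wm, wc]
  intro σ₃ F₃ c₃ T₃ G₃ k₃
  refine ⟨by simp, fun h => h.v _, ?_⟩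
  set σ₄ := (σ₃.set 16 ((Ex.var 17).eval σ₃)).tick with hσ₄
  -- Array `4` is untouched by the first search, hence still zero as the second search requires;
  -- variable `16` saves the first cost from being overwritten.
  have F₄ : Frame 10 (fun i => i ≠ 4) σ₂ σ₄ :=
    ((F₃.mono (by norm_num) (fun _ h => h)).set (by decide) _).tick
  have x0 : σ₄.v 0 = p := (F₄.v 0 (by decide)).trans ((F₂.v 0 (by decide)).trans u0)
  have x1 : σ₄.v 1 = q := (F₄.v 1 (by decide)).trans w1
  have x2 : σ₄.v 2 = r := (F₄.v 2 (by decide)).trans ((F₂.v 2 (by decide)).trans u2)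
  have x16 : σ₄.v 16 = σ₃.v 17 := by simp [hσ₄]
  refine selectBStm_wp (by omega) (by rw [x0, x1]; omega) fun σ₅ F₅ G₅ c₅ y6 y7 y8 y9 k₅ => ?_
  rw [x2] at y6 y9
  rw [x0, x1] at y7
  have y0 : σ₅.v 0 = p := (F₅.v 0 (by decide)).trans x0
  have y1 : σ₅.v 1 = q := (F₅.v 1 (by decide)).trans x1
  have y2 : σ₅.v 2 = r := (F₅.v 2 (by decide)).trans x2
  have y3 : σ₅.v 3 = N :=
    (F₅.v 3 (by decide)).trans ((F₄.v 3 (by decide)).trans ((F₂.v 3 (by decide)).trans v3))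
  have y4 : σ₅.v 4 = lam := (F₅.v 4 (by decide)).trans ((F₄.v 4 (by decide)).trans w4)
  have y5 : σ₅.v 5 = a * lam := (F₅.v 5 (by decide)).trans ((F₄.v 5 (by decide)).trans w5)
  have y16 : σ₅.v 16 = σ₃.v 17 := (G₅ 16 (by decide)).trans x16
  have ylo : σ₅.lo = lo := F₅.lo.trans (F₄.lo.trans wlo)
  have ya4 : σ₅.a 4 = σ.a 4 := (F₅.a 4 (by simp)).trans ((F₄.a 4 (by simp)).trans (by rw [wa]))
  have ya3 : σ₅.a 3 = σ₃.a 3 := F₅.a 3 (by simp)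
  have yc : σ₅.coins = a * lam * (q * lam) := by
    rw [c₅]; exact c₃.trans (Nat.zero_add _)
  have ym : σ₅.mat = mat lo (p * q) 1 r := by unfold St.mat; rw [ylo, y7, y8, y9]
  have hR₅ : HasRows b s σ₅ := by
    constructor
    · rw [y6, y1, y7, y8, y9]
      intro v hv l hl
      have := index_lt hl hv; omega
    · rw [y6, y1, ym]
      intro v hv l hl
      have := index_lt hl hv
      exact hI.entry _ (by omega)
  have kσ₄ : σ₄.clk = σ₃.clk + 1 := rfl
  clear_value σ₄
  refine treeStm_wp (Or.inr rfl) (by omega) hs (by omega) (by rw [y6, y1]; omega) hR₅ (by omega)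
    (by omega) (by rw [ya4]; exact ha 4) (by rw [y1, y4]; omega) ?_
  rw [y6, y1, y4, y5, ym, yc]
  intro σ₆ F₆ c₆ T₆ G₆ k₆
  have z0 : σ₆.v 0 = p := (F₆.v 0 (by decide)).trans y0
  have z1 : σ₆.v 1 = q := (F₆.v 1 (by decide)).trans y1
  have z2 : σ₆.v 2 = r := (F₆.v 2 (by decide)).trans y2
  have z3 : σ₆.v 3 = N := (F₆.v 3 (by decide)).trans y3
  have z6 : σ₆.v 6 = r := (F₆.v 6 (by decide)).trans y6
  have z16 : σ₆.v 16 = σ₃.v 17 := (F₆.v 16 (by decide)).trans y16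
  have zlo : σ₆.lo = lo := F₆.lo.trans ylo
  have za3 : σ₆.a 3 = σ₃.a 3 := (F₆.a 3 (by simp)).trans ya3
  have zm : σ₆.mat = mat lo (p * q) 1 r := (F₆.mat (by norm_num)).trans ym
  have s6 : σ₃.v 6 = p := (F₃.v 6 (by decide)).trans w6
  have s1 : σ₃.v 1 = q := (F₃.v 1 (by decide)).trans w1
  have sm : σ₃.mat = mat lo 0 q 1 := (F₃.mat (by norm_num)).trans wm
  have hI₆ : Input s p q r lo σ₆.tick := ⟨z0, z1, z2, hI.entry⟩
  have costA : tableCost (mat lo 0 q 1) q p (σ₃.a 3) ≤ σ₃.v 17 := by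
    have := T₃.cost; rwa [s6, s1, sm] at this
  have costB : tableCost (mat lo (p * q) 1 r) q r (σ₆.a 4) ≤ σ₆.v 17 := by
    have := T₆.cost; rwa [z6, z1, zm] at this
  have hclk : σ₆.clk ≤ 21 + N * 4 + (a * lam * ((lam + 1) * (p * q) * (2 * s + 50) + 1) +
      a * lam * ((lam + 1) * (r * q) * (2 * s + 50) + 1)) := by omega
  have hev : (Ex.var 2 * .var 16 - .var 0 * .var 17).eval σ₆ = r * σ₃.v 17 - p * σ₆.v 17 := by
    simp [z2, z16, z0]
  refine ⟨by simp, fun hne => ?_, fun heq => ?_⟩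
  · rw [hev] at hne
    refine outputBStm_wp hI₆ zlo hN z3 hb hp hq0 hr (by omega) (by rw [← z6]; exact T₆.lt) T₆.zero ?_
    intro τ hO hτ
    refine ⟨hO, lam, σ₃.v 17, σ₆.v 17, hlam1, hlam2, ?_, G₃, G₆⟩
    have hmin : min (r * σ₃.v 17) (p * σ₆.v 17) = p * σ₆.v 17 := min_eq_right (by omega)
    rw [hmin]
    refine main_clock hp hq0 hr hN rfl ?_
    have h1 : 2 * p * tableCost (mat lo (p * q) 1 r) q r (σ₆.a 4) ≤ 2 * (p * σ₆.v 17) := by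
      rw [mul_assoc]; gcongr
    have h2 : p * (4 + 2 * q) + r * (5 + 2 * p + 3 * q) ≤ (p + r) * (5 + 3 * q) + 2 * (p * r) :=
      output_clock p q r
    simp only [St.tick_a, St.tick_clk] at hτ
    omega
  · rw [hev] at heq
    refine outputAStm_wp hI₆ zlo hN z3 hb hp hq0 (by omega)
      (by rw [St.tick_a, za3, ← s6]; exact T₃.lt) (by rw [St.tick_a, za3]; exact T₃.zero) ?_
    intro τ hO hτ
    refine ⟨hO, lam, σ₃.v 17, σ₆.v 17, hlam1, hlam2, ?_, G₃, G₆⟩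
    have hmin : min (r * σ₃.v 17) (p * σ₆.v 17) = r * σ₃.v 17 := min_eq_left (by omega)
    rw [hmin]
    refine main_clock hp hq0 hr hN rfl ?_
    have h1 : 2 * r * tableCost (mat lo 0 q 1) q p (σ₃.a 3) ≤ 2 * (r * σ₃.v 17) := by
      rw [mul_assoc]; gcongr
    have h2 : r * (4 + 2 * q) + p * (5 + 2 * r + 3 * q) ≤ (r + p) * (5 + 3 * q) + 2 * (r * p) :=
      output_clock r q p
    rw [add_comm r p, mul_comm r p] at h2
    simp only [St.tick_a, St.tick_clk, za3] at hτ
    omega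

end
open RandRAM

/-! ## The program on the machine -/

theorem card_filter_range_eq_hammingDist {q s : ℕ} {x y : ℕ → ℕ} {x' y' : Fin q → Fin s}
    (hx : ∀ l : Fin q, x l = x' l) (hy : ∀ l : Fin q, y l = y' l) :
    ((Finset.range q).filter fun l => x l ≠ y l).card = hammingDist x' y' := by
  rw [hammingDist, Finset.card_filter, Finset.card_filter, Finset.sum_range]
  refine Finset.sum_congr rfl fun l _ => ?_
  simp only [hx, hy, ne_eq, Fin.val_inj]

theorem edgeDistSum_eq_treeCost {n q s : ℕ} {X : ℕ → ℕ → ℕ} (P : Matrix (Fin n) (Fin q) (Fin s))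
    (hX : ∀ (v : Fin n) (l : Fin q), X v l = P v l) (T : SimpleGraph (Fin n)) :
    edgeDistSum T X q = treeCost P T := by
  unfold edgeDistSum treeCost
  refine Finset.sum_congr rfl fun e _ => ?_
  induction e with
  | h u v => exact card_filter_range_eq_hammingDist (hX u) (hX v)

/-- Register `32` receives the number of cells taken by the input and the output. -/
def sizesCmd : Cmd :=
  .seq (.arith .mul 33 0 1) (.seq (.arith .mul 34 1 2) (.seq (.arith .add 33 33 34)
    (.seq (.arith .mul 34 0 2) (.arith .add 32 33 34))))

theorem sizesCmd_exec {ω : ℕ → Bool} {S : State} {p q r B : ℕ} (h0 : S.reg 0 = p)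
    (h1 : S.reg 1 = q) (h2 : S.reg 2 = r) (hp : p ≤ B) (hq : q ≤ B) (hr : r ≤ B)
    (hb : p * q + q * r + p * r ≤ B) :
    ∃ S' t, Exec ω sizesCmd S S' t ∧ S'.reg 32 = p * q + q * r + p * r ∧
      (∀ x < 32, S'.reg x = S.reg x) ∧ S'.mem = S.mem ∧ S'.coins = S.coins ∧
      t ≤ 10 * (B.size + 1) := by
  have z {n : ℕ} (h : n ≤ B) : n.size ≤ B.size := Nat.size_le_size h
  refine ⟨_, _, .seq (.arith _ _ _ _ _) (.seq (.arith _ _ _ _ _) (.seq (.arith _ _ _ _ _)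
    (.seq (.arith _ _ _ _ _) (.arith _ _ _ _ _)))), ?_, fun x hx => ?_, rfl, rfl, ?_⟩
  · simp [Op.eval, h0, h1, h2]
  · have a1 : x ≠ 32 := by omega
    have a2 : x ≠ 33 := by omega
    have a3 : x ≠ 34 := by omega
    simp [a1, a2, a3]
  · have y1 := z hp
    have y2 := z hq
    have y3 := z hr
    have y4 := z (n := p * q) (by omega)
    have y5 := z (n := q * r) (by omega)
    have y6 := z (n := p * r) (by omega)
    have y7 := z (n := p * q + q * r) (by omega)
    simp [Op.eval, h0, h1, h2]
    omega

/-- The state of the language on input `A`, `B`. -/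
def inputSt {p q r s : ℕ} (A : Matrix (Fin p) (Fin q) (Fin s))
    (B : Matrix (Fin q) (Fin r) (Fin s)) : St where
  v x := (inputState A B).reg x
  lo := (inputState A B).mem
  a _ _ := 0
  coins := 0
  clk := 0

section
variable {p q r s : ℕ} (A : Matrix (Fin p) (Fin q) (Fin s)) (B : Matrix (Fin q) (Fin r) (Fin s))

theorem inputState_mem_lt {i : ℕ} (hi : i < p * q + q * r) : (inputState A B).mem i < s := by
  simp only [inputState]
  split_ifs with h h'
  · exact Fin.isLt _
  · exact Fin.isLt _
  · omega

theorem inputState_mem_le (i : ℕ) : (inputState A B).mem i ≤ s := by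
  simp only [inputState]
  split_ifs with h h'
  · exact (Fin.isLt _).le
  · exact (Fin.isLt _).le
  · exact Nat.zero_le _

theorem inputState_mem_eq_zero {i : ℕ} (hi : p * q + q * r ≤ i) : (inputState A B).mem i = 0 := by
  simp only [inputState]
  rw [dif_neg (by omega), dif_neg (by omega)]

theorem mat_left (v : Fin p) (l : Fin q) : mat (inputState A B).mem 0 q 1 v l = A v l := by
  rw [← inputState_mem_left A B, mat, Nat.zero_add, mul_one]

theorem mat_right (v : Fin r) (l : Fin q) :
    mat (inputState A B).mem (p * q) 1 r v l = B.transpose v l := by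
  rw [Matrix.transpose_apply, ← inputState_mem_right A B, mat, mul_one, add_comm (v : ℕ)]

/-- The program for alphabet size `s` with `a * log N` repetitions. -/
def program (s a : ℕ) : Cmd := .seq sizesCmd ((mainStm s a).code (s + 8) 33)

/-- A run of the program, with the bound for its time in terms of the costs of the trees that it
finds. -/
theorem program_exec (a : ℕ) (hp : 0 < p) (hq : 0 < q) (hr : 0 < r) {E : ℕ}
    (hE : E = (s + a + 2) * (2 * (p * q + q * r) + p * r + 2)) (ω : ℕ → Bool) :
    ∃ S t, Exec ω (program s a) (inputState A B) S t ∧ OutputsHamming A B S ∧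
      ∃ lam cA cB : ℕ, p * q + q * r ≤ 2 ^ lam ∧ 2 ^ lam < 2 * (p * q + q * r) ∧
        t ≤ 10 * (E.size + 1) + (mainStm s a).weight (s + 8) * (E.size + 1) *
          ((60 + a * (2 * s + 60)) * (lam + 1) ^ 2 * ((p + r) * (p + q + r)) +
            2 * min (r * cA) (p * cB)) ∧
        (∀ (T : SimpleGraph (Fin p)) (L K : ℕ), T.Connected → 1 ≤ L →
          (∃ k < a * lam, GoodLevels T (mat (inputState A B).mem 0 q 1) q lam L K
            (fun i => ω (0 + (k * (q * lam) + i)))) → cA ≤ 2 * L * K) ∧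
        (∀ (T : SimpleGraph (Fin r)) (L K : ℕ), T.Connected → 1 ≤ L →
          (∃ k < a * lam, GoodLevels T (mat (inputState A B).mem (p * q) 1 r) q lam L K
            (fun i => ω (a * lam * (q * lam) + (k * (q * lam) + i)))) → cB ≤ 2 * L * K) := by
  have hpq : p ≤ p * q := Nat.le_mul_of_pos_right _ hq
  have hqp : q ≤ p * q := Nat.le_mul_of_pos_left _ hp
  have hrq : r ≤ q * r := Nat.le_mul_of_pos_left _ hq
  obtain ⟨N, hN⟩ : ∃ N, N = p * q + q * r := ⟨_, rfl⟩
  -- `E` bounds every stored number: it dominates the alphabet size, the input and output sizes, `2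
  -- * N + 1` and the multiple `a * (2 * N)` that bounds the number of trials.
  have hE' : E = s * (2 * N + p * r + 2) + a * (2 * N) + a * (p * r + 2) +
      2 * (2 * N + p * r + 2) := by rw [hE, hN]; ring
  have hs : s ≤ s * (2 * N + p * r + 2) := Nat.le_mul_of_pos_right _ (by omega)
  obtain ⟨S₁, t₁, x₁, hb₁, hr₁, hm₁, hc₁, ht₁⟩ := sizesCmd_exec (ω := ω) (S := inputState A B)
    (p := p) (q := q) (r := r) (B := E) rfl rfl rfl (by omega) (by omega) (by omega) (by omega)
  have hrel : Rel (p * q + q * r + p * r) (s + 8) S₁ (inputSt A B) :=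
    ⟨fun x => hr₁ x x.2, hb₁, fun x _ => by rw [hm₁]; rfl,
      fun k _ i => by rw [hm₁]; exact inputState_mem_eq_zero A B (by omega), hc₁⟩
  have hbdd : (inputSt A B).Bdd E := by
    refine ⟨fun x => ?_, fun i => (inputState_mem_le A B i).trans (by omega), fun _ _ =>
      Nat.zero_le _⟩
    simp only [inputSt, inputState]
    split_ifs <;> omega
  have hI : Input s p q r (inputState A B).mem (inputSt A B) :=
    ⟨rfl, rfl, rfl, fun i hi => inputState_mem_lt A B hi⟩
  obtain ⟨S, σ, t, x, hS, -, ⟨hO, lam, cA, cB, l1, l2, hclk, gA, gB⟩, -, δ, hδ, ht⟩ :=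
    (mainStm s a).sound (by omega) (by omega) (le_refl 33) _ _ _ hrel hbdd
      (mainStm_wp (ω := ω) (B := E) hI rfl rfl rfl hp hq hr (by omega) (by omega)
        (by rw [← hN]; omega) (fun _ _ => rfl) rfl rfl)
  refine ⟨S, t₁ + t, .seq x₁ x, fun i j => ?_, lam, cA, cB, l1, l2, ?_, gA, gB⟩
  · have hij : (i : ℕ) * r + j < p * r := index_lt i.2 j.2
    rw [hS.lo _ (by omega), hO i i.2 j j.2]
    exact card_filter_range_eq_hammingDist (mat_left A B i) (mat_right A B j)
  · have : δ = σ.clk := by rw [hδ]; exact (Nat.zero_add _).symm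
    rw [this] at ht
    exact add_le_add ht₁ (ht.trans (by gcongr))

end

/-! ### Numerical estimates -/

/-- The run for each sequence of coins yields its own `lam`; this shows that it depends on the input
size only. -/
theorem pow_two_unique {N l l' : ℕ} (h1 : N ≤ 2 ^ l) (h2 : 2 ^ l < 2 * N) (h1' : N ≤ 2 ^ l')
    (h2' : 2 ^ l' < 2 * N) : l = l' := by
  have a1 : 2 ^ l < 2 ^ (l' + 1) := by rw [pow_succ]; omega
  have a2 : 2 ^ l' < 2 ^ (l + 1) := by rw [pow_succ]; omega
  have := (Nat.pow_lt_pow_iff_right (by norm_num)).1 a1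
  have := (Nat.pow_lt_pow_iff_right (by norm_num)).1 a2
  omega

/-- This justifies the choice `L = 3 * lam + 2` in the union bound: `n`, again `n`, and `lam + 1`
are each at most `2 ^ lam`. -/
theorem levels_bound {n N lam : ℕ} (hn : n ≤ N) (h : N ≤ 2 ^ lam) :
    4 * (n * (n * (lam + 1))) ≤ 2 ^ (3 * lam + 2) := by
  have h1 : lam + 1 ≤ 2 ^ lam := Nat.lt_two_pow_self
  have h2 := hn.trans h
  calc 4 * (n * (n * (lam + 1))) ≤ 4 * (2 ^ lam * (2 ^ lam * 2 ^ lam)) := by gcongr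
    _ = 2 ^ (3 * lam + 2) := by ring

theorem cost_bound {c lam M : ℕ} (h : c ≤ 2 * (3 * lam + 2) * (4 * ((lam + 1) * M))) :
    c ≤ 24 * (lam + 1) ^ 2 * M := by
  refine h.trans ?_
  calc 2 * (3 * lam + 2) * (4 * ((lam + 1) * M))
      ≤ 2 * (3 * (lam + 1)) * (4 * ((lam + 1) * M)) := by gcongr; omega
    _ = 24 * (lam + 1) ^ 2 * M := by ring

/-- The word length is logarithmic: the largest number is a constant `m` times a polynomial in `N`,
since `p * r ≤ N * N`. -/
theorem size_bound {m p q r lam : ℕ} (hp : 0 < p) (hq : 0 < q) (hr : 0 < r)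
    (h : p * q + q * r ≤ 2 ^ lam) :
    (m * (2 * (p * q + q * r) + p * r + 2)).size + 1 ≤ (m.size + 3) * (lam + 1) := by
  have hpq : p ≤ p * q := Nat.le_mul_of_pos_right _ hq
  have hrq : r ≤ q * r := Nat.le_mul_of_pos_left _ hq
  have h1 : p * r ≤ 2 ^ lam * 2 ^ lam := Nat.mul_le_mul (by omega) (by omega)
  have h2 : 2 ^ lam ≤ 2 ^ lam * 2 ^ lam := Nat.le_mul_of_pos_left _ (by positivity)
  have h3 : 2 * (p * q + q * r) + p * r + 2 ≤ 2 ^ (2 * lam + 2) := by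
    have e : 2 ^ (2 * lam + 2) = 4 * (2 ^ lam * 2 ^ lam) := by ring
    omega
  have h4 : (m * (2 * (p * q + q * r) + p * r + 2)).size ≤ m.size + (2 * lam + 2) := by
    refine Nat.size_le.2 ?_
    rw [pow_add]
    exact Nat.mul_lt_mul_of_lt_of_le m.lt_size_self h3 (by positivity)
  have h5 : (m.size + 3) * (lam + 1) = m.size * lam + m.size + 3 * lam + 3 := by ring
  omega

/-- For `N ≥ 2` the additive constants are absorbed by `log N ≥ log 2`; three times `1 / log 2` is
less than 5. -/
theorem log_bound {N lam : ℕ} (hN : 2 ≤ N) (h : 2 ^ lam < 2 * N) :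
    ((lam + 1 : ℕ) : ℝ) ≤ 5 * Real.log N := by
  have h0 : (2 : ℝ) ≤ N := by exact_mod_cast hN
  have h1 : Real.log 2 ≤ Real.log N := Real.log_le_log (by norm_num) h0
  have h2 : ((2 : ℝ) ^ lam) ≤ 2 * N := by exact_mod_cast h.le
  have h3 := Real.log_le_log (by positivity) h2
  rw [Real.log_pow, Real.log_mul (by norm_num) (by positivity)] at h3
  have h4 := Real.log_two_gt_d9
  push_cast
  nlinarith

/-- Since `N ≤ 2 ^ lam`, a number of `⌈α⌉ * lam` trials pushes the failure probability below `N ^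
(-α)`. -/
theorem failure_bound {N lam : ℕ} {α : ℝ} (hN : 0 < N) (h : N ≤ 2 ^ lam) :
    ((1 : ℝ) / 2) ^ (⌈α⌉₊ * lam) ≤ 1 / (N : ℝ) ^ α := by
  have h0 : (1 : ℝ) ≤ N := by exact_mod_cast hN
  have h1 : (N : ℝ) ^ α ≤ (N : ℝ) ^ ⌈α⌉₊ := by
    rw [← Real.rpow_natCast]
    exact Real.rpow_le_rpow_of_exponent_le h0 (Nat.le_ceil α)
  have h2 : (N : ℝ) ^ ⌈α⌉₊ ≤ (2 : ℝ) ^ (⌈α⌉₊ * lam) := by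
    rw [mul_comm, pow_mul]
    gcongr
    exact_mod_cast h
  rw [one_div_pow]
  exact one_div_le_one_div_of_le (by positivity) (h1.trans h2)

/-- The word length `X` contributes one factor `l`, and the step count, with the tree cost inserted,
contributes `l ^ 2`; hence the exponent 3. -/
theorem time_bound {w e d l X W m t x : ℕ} (hW : 1 ≤ W) (hX : X ≤ d * l)
    (hx : x ≤ 24 * l ^ 2 * m) (ht : t ≤ 10 * X + w * X * (e * l ^ 2 * W + 2 * x)) :
    t ≤ (10 + w * (e + 48)) * d * l ^ 3 * (W + m) := by
  calc t ≤ 10 * X + w * X * (e * l ^ 2 * W + 2 * x) := ht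
    _ ≤ 10 * (d * l) + w * (d * l) * (e * l ^ 2 * W + 2 * (24 * l ^ 2 * m)) := by gcongr
    _ ≤ 10 * (d * l ^ 3 * (W + m)) + w * (d * l) * ((e + 48) * l ^ 2 * (W + m)) := by
        have h1 : l ≤ l ^ 3 := Nat.le_self_pow (by norm_num) _
        have h2 : l ≤ l ^ 3 * (W + m) := h1.trans (Nat.le_mul_of_pos_right _ (by omega))
        have h3 : e * l ^ 2 * W + 2 * (24 * l ^ 2 * m) ≤ (e + 48) * l ^ 2 * (W + m) := by
          have : (e + 48) * l ^ 2 * (W + m) = e * l ^ 2 * W + 2 * (24 * l ^ 2 * m) +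
            (e * l ^ 2 * m + 48 * l ^ 2 * W) := by ring
          omega
        rw [mul_assoc d]
        gcongr
    _ = _ := by ring

theorem time_bound_real {w e d l X W m t x F N : ℕ} (hW : 1 ≤ W) (hX : X ≤ d * l)
    (hx : x ≤ 24 * l ^ 2 * m) (ht : t ≤ 10 * X + w * X * (e * l ^ 2 * W + 2 * x))
    (hF : F = (10 + w * (e + 48)) * d) (hl : (l : ℝ) ≤ 5 * Real.log N) :
    (t : ℝ) ≤ F * 125 * ((W + m : ℕ) : ℝ) * Real.log N ^ 3 := by
  have h := time_bound hW hX hx ht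
  rw [← hF] at h
  calc (t : ℝ) ≤ F * (l : ℝ) ^ 3 * ((W + m : ℕ) : ℝ) := by exact_mod_cast h
    _ ≤ F * (5 * Real.log N) ^ 3 * ((W + m : ℕ) : ℝ) := by gcongr
    _ = _ := by ring

end ForLang

open ForLang in
theorem mainTheorem5 :
    -- `k`: exponent of the polylogarithmic factor; `s`: alphabet size; `α`: w.h.p. exponent
    ∃ k : ℕ, ∀ (s : ℕ) (α : ℝ), 1 ≤ α →
      ∃ (prog : RandRAM.Cmd) (C : ℝ),
        ∀ (p q r : ℕ), 0 < p → 0 < q → 0 < r →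
        ∀ (A : Matrix (Fin p) (Fin q) (Fin s)) (B : Matrix (Fin q) (Fin r) (Fin s)),
          -- the program always halts with the correct output
          (∀ ω : ℕ → Bool, ∃ S t,
            RandRAM.Exec ω prog (RandRAM.inputState A B) S t ∧ RandRAM.OutputsHamming A B S) ∧
          -- and with high probability it does so within the time bound
          1 - 1 / ((p * q + q * r : ℕ) : ℝ) ^ α ≤
            RandRAM.coinMeasure.real {ω | ∃ S t,
              RandRAM.Exec ω prog (RandRAM.inputState A B) S t ∧
              RandRAM.OutputsHamming A B S ∧
              (t : ℝ) ≤
                C * (((p + r) * (p + q + r) +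
                    min (r * mstCost A) (p * mstCost B.transpose) : ℕ) : ℝ) *
                  Real.log ((p * q + q * r : ℕ) : ℝ) ^ k} := by
  refine ⟨3, fun s α _ => ?_⟩
  obtain ⟨a, ha⟩ : ∃ a, a = ⌈α⌉₊ := ⟨_, rfl⟩
  obtain ⟨w, hw⟩ : ∃ w, w = (mainStm s a).weight (s + 8) := ⟨_, rfl⟩
  obtain ⟨F, hF⟩ : ∃ F, F = (10 + w * (60 + a * (2 * s + 60) + 48)) *
    ((s + a + 2).size + 3) := ⟨_, rfl⟩
  refine ⟨program s a, F * 125, fun p q r hp hq hr A B => ?_⟩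
  have hex := program_exec A B a hp hq hr rfl
  rw [← hw] at hex
  generalize program s a = prog at hex ⊢
  refine ⟨fun ω => ?_, ?_⟩
  · obtain ⟨S, t, h, hO, -⟩ := hex ω
    exact ⟨S, t, h, hO⟩
  have hpq : p ≤ p * q := Nat.le_mul_of_pos_right _ hq
  have hrq : r ≤ q * r := Nat.le_mul_of_pos_left _ hq
  obtain ⟨N, hN⟩ : ∃ N, N = p * q + q * r := ⟨_, rfl⟩
  -- Any sequence of coins serves to name the common value of `lam`.
  obtain ⟨-, -, -, -, lam, -, -, l1, l2, -⟩ := hex fun _ => false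
  rw [← hN] at l1 l2 ⊢
  obtain ⟨W, hW⟩ : ∃ W, W = (p + r) * (p + q + r) := ⟨_, rfl⟩
  have hW1 : 1 ≤ W := by rw [hW]; exact Nat.mul_pos (by omega) (by omega)
  have hX := size_bound (m := s + a + 2) hp hq hr (hN ▸ l1)
  have hlog := log_bound (by omega) l2
  have hfail := failure_bound (α := α) (by omega) l1
  rw [← ha] at hfail
  rw [← hW]
  -- The program's running time involves the minimum of both sides, so it suffices that the search
  -- succeeds on the side attaining the minimum of the optimal costs. No union bound over the two
  -- searches is needed.
  rcases le_total (r * mstCost A) (p * mstCost B.transpose) with hle | hle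
  · rw [min_eq_left hle]
    obtain ⟨T, hT, hc⟩ := exists_isTree_treeCost_eq_mstCost hp A
    rw [← edgeDistSum_eq_treeCost A (mat_left A B)] at hc
    refine (sub_le_sub_left hfail 1).trans (one_sub_le_coinMeasure_of_goodLevels
      (q := q)
      (off := 0) T (mat (RandRAM.inputState A B).mem 0 q 1) (levels_bound (by omega : p ≤ N) l1) _ fun ω hω => ?_)
    obtain ⟨S, t, h, hO, lam', cA, cB, l1', l2', ht, gA, -⟩ := hex ω
    rw [← hN] at l1' l2'
    obtain rfl := pow_two_unique l1 l2 l1' l2'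
    have hcA := cost_bound (gA T _ _ hT.connected (by omega) hω)
    rw [hc] at hcA
    rw [← hW] at ht
    refine ⟨S, t, h, hO, time_bound_real hW1 hX ((min_le_left _ _).trans ?_) ht hF hlog⟩
    calc r * cA ≤ r * (24 * (lam + 1) ^ 2 * mstCost A) := by gcongr
      _ = _ := by ring
  · rw [min_eq_right hle]
    obtain ⟨T, hT, hc⟩ := exists_isTree_treeCost_eq_mstCost hr B.transpose
    rw [← edgeDistSum_eq_treeCost B.transpose (mat_right A B)] at hc
    refine (sub_le_sub_left hfail 1).trans (one_sub_le_coinMeasure_of_goodLevels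
      (q := q)
      -- The trials for `B` use the coins after those consumed by the trials for `A`.
      (off := a * lam * (q * lam)) T (mat (RandRAM.inputState A B).mem (p * q) 1 r) (levels_bound (by omega : r ≤ N) l1) _ fun ω hω => ?_)
    obtain ⟨S, t, h, hO, lam', cA, cB, l1', l2', ht, -, gB⟩ := hex ω
    rw [← hN] at l1' l2'
    obtain rfl := pow_two_unique l1 l2 l1' l2'
    have hcB := cost_bound (gB T _ _ hT.connected (by omega) hω)
    rw [hc] at hcB
    rw [← hW] at ht
    refine ⟨S, t, h, hO, time_bound_real hW1 hX ((min_le_right _ _).trans ?_) ht hF hlog⟩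
    calc p * cB ≤ p * (24 * (lam + 1) ^ 2 * mstCost B.transpose) := by gcongr
      _ = _ := by ring
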